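/- Let $k$ be an algebraic extension of $\mathbf F_2$ (for example $k=\mathbf F_2$, $\mathbf F_8$ or $\overline{\mathbf F}_2$). For $i\ge 0$ let $C_i$ be the smooth projective curve over $k$ with function field $k(C_i)=k(x_0,x_1,\dots,x_i)$, where $x_0$ is transcendental over $k$ and $$x_{j+1}^2+x_{j+1}=x_j+1+\frac1{x_j}\qquad (0\le j<i).$$ Then the genus $g(C_i)$ (the maximum of $\deg D+1-\dim_k L(D)$ over all divisors $D$ on $C_i$, where $L(D)$ is the Riemann–Roch space of $D$) is given for all $i\ge 0$ by $$g(C_i)=2^{i+2}+1-\begin{cases}(i+10)\,2^{\,i/2-1} & \text{if } i \text{ is even},\\ \bigl(i+2\lfloor i/4\rfloor+15\bigr)\,2^{(i-3)/2} & \text{if } i \text{ is odd}.\end{cases}$$ -/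

import Mathlib

noncomputable section

namespace CurveTower

open IsLocalRing

/-- A closed point of the smooth projective curve over `k` with function field `K` (a place of
`K / k`): a valuation ring of `K` that contains `k` and is different from `K`. -/
structure Place (k K : Type*) [Field k] [Field K] [Algebra k K] where
  /-- The local ring of the point. -/
  ring : ValuationSubring K
  algebraMap_mem : ∀ a : k, algebraMap k K a ∈ ring
  ne_top : ring ≠ ⊤

section

variable {k K : Type*} [Field k] [Field K] [Algebra k K]

instance Place.instAlgebra (P : Place k K) : Algebra k P.ring :=
  ((algebraMap k K).codRestrict P.ring P.algebraMap_mem).toAlgebra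

/-- The degree of a point: the degree of its residue field over `k`. -/
def Place.degree (P : Place k K) : ℕ := Module.finrank k (ResidueField P.ring)

/-- A uniformizer (local parameter) at `P`: a generator of the maximal ideal of the local ring. -/
def Place.IsUniformizer (P : Place k K) (t : P.ring) : Prop :=
  maximalIdeal P.ring = Ideal.span {t}

end

/-- Divisors: finite formal `ℤ`-linear combinations of points. -/
abbrev Divisor (k K : Type*) [Field k] [Field K] [Algebra k K] := Place k K →₀ ℤ

section

variable {k K : Type*} [Field k] [Field K] [Algebra k K]

/-- The degree of a divisor, `∑ D(P) · deg P`. -/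
def Divisor.degree (D : Divisor k K) : ℤ := D.sum fun P n => n * (P.degree : ℤ)

/-- The Riemann–Roch space `L(D)` of all `f` with `f = 0` or `ord_P f ≥ - D(P)` at all points `P`.
For a uniformizer `t` at `P` this condition says that `f * t ^ D(P)` lies in the local ring. -/
def Divisor.riemannRochSpace (D : Divisor k K) : Submodule k K where
  carrier := {f | ∀ (P : Place k K) (t : P.ring), P.IsUniformizer t →
    f * (t : K) ^ (D P) ∈ P.ring}
  add_mem' := fun hf hg P t ht => by
    rw [add_mul]
    exact P.ring.add_mem _ _ (hf P t ht) (hg P t ht)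
  zero_mem' := fun P t _ => by
    rw [zero_mul]
    exact P.ring.zero_mem
  smul_mem' := fun c f hf P t ht => by
    rw [Algebra.smul_def, mul_assoc]
    exact P.ring.mul_mem _ _ (P.algebraMap_mem c) (hf P t ht)

/-- `ℓ(D) = dim_k L(D)`. -/
def Divisor.ell (D : Divisor k K) : ℕ := Module.finrank k D.riemannRochSpace

end

/-- `g` is the genus of the function field `K / k`, i.e. of the smooth projective curve over `k`
with function field `K`: the maximum of `deg D + 1 - ℓ(D)` over all divisors `D`. -/
def IsGenus (k K : Type*) [Field k] [Field K] [Algebra k K] (g : ℤ) : Prop :=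
  IsGreatest (Set.range fun D : Divisor k K => D.degree + 1 - (D.ell : ℤ)) g

/-- `K = k(x₀, …, xᵢ)` is the function field of the curve `Cᵢ` over `k`: `x₀` is a coordinate on the
projective line, and each `xⱼ₊₁` satisfies the recursive Artin–Schreier equation
`xⱼ₊₁² + xⱼ₊₁ = xⱼ + 1 + 1 / xⱼ`. -/
structure IsTowerFunctionField (k : Type*) {K : Type*} [Field k] [Field K] [Algebra k K] (i : ℕ)
    (x : Fin (i + 1) → K) : Prop where
  transcendental : Transcendental k (x 0)
  equation : ∀ j : Fin i,
    x j.succ ^ 2 + x j.succ = x j.castSucc + 1 + 1 / x j.castSucc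
  adjoin_eq_top : IntermediateField.adjoin k (Set.range x) = ⊤

/-- The function field of `Cᵢ` exists over every field `k`. -/
theorem exists_isTowerFunctionField (k : Type*) [Field k] (i : ℕ) :
    ∃ (K : IntermediateField k (AlgebraicClosure (RatFunc k))) (x : Fin (i + 1) → K),
      IsTowerFunctionField k i x := by
  have hroot : ∀ a : AlgebraicClosure (RatFunc k), ∃ y, y ^ 2 + y = a + 1 + 1 / a := by
    intro a
    have hd : (Polynomial.X ^ 2 + Polynomial.X - Polynomial.C (a + 1 + 1 / a) :
        Polynomial (AlgebraicClosure (RatFunc k))).degree = 2 := by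
      compute_degree!
    obtain ⟨y, hy⟩ := IsAlgClosed.exists_root _ (by rw [hd]; decide)
    refine ⟨y, ?_⟩
    simpa [Polynomial.IsRoot, sub_eq_zero] using hy
  choose next hnext using hroot
  let y : ℕ → AlgebraicClosure (RatFunc k) := fun n =>
    Nat.rec (algebraMap (RatFunc k) _ RatFunc.X) (fun _ a => next a) n
  let s : Set (AlgebraicClosure (RatFunc k)) := Set.range fun j : Fin (i + 1) => y j
  let x : Fin (i + 1) → IntermediateField.adjoin k s :=
    fun j => ⟨y j, IntermediateField.subset_adjoin k s ⟨j, rfl⟩⟩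
  refine ⟨IntermediateField.adjoin k s, x, ?_, ?_, ?_⟩
  · have h1 : Transcendental k (RatFunc.X : RatFunc k) := RatFunc.transcendental_X
    have h2 : Transcendental k (algebraMap (RatFunc k) (AlgebraicClosure (RatFunc k)) RatFunc.X) :=
      (transcendental_algebraMap_iff (algebraMap (RatFunc k) _).injective).2 h1
    exact (transcendental_algebraMap_iff
      (algebraMap (IntermediateField.adjoin k s) (AlgebraicClosure (RatFunc k))).injective).1 h2
  · intro j
    apply Subtype.ext
    exact hnext (y j)
  · apply IntermediateField.lift_injective
    rw [IntermediateField.lift_adjoin, IntermediateField.lift_top, ← Set.range_comp]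
    rfl

end CurveTower

end

/-!
Each step `z² + z = c` of the tower, with `c = x_i + 1 + 1 / x_i`, is a quadratic Artin–Schreier
extension. If at every point `c` becomes either regular or a simple pole after adding some
`w² + w`, then exactly the points of the second kind ramify, each has different exponent two, and
Riemann–Hurwitz gives `g_{i+1} = 2 g_i - 1 + r_i`, where `r_i` is the total degree of these points.
Concretely, `L(D)` upstairs splits as `L(D) ⊕ L(D - E)` downstairs, `E` being the sum of the
ramified points, for `D` so large that `deg D + 1 - ℓ(D)` takes its maximal value.

Poles of `c` lie above the pole of `x_0` or above a zero of some `x_n`, `n ≤ i`. The pole of `x_0`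
is totally ramified. A point with `x_n = 0` lies over a point where `x_{n-1}² + x_{n-1} + 1 = 0`,
hence over one where `x_{n-2} = 1`, and `x_{n-2} + 1` is conjugate to a zero of the generator; going
down two steps at a time writes `1 / x_n`, modulo regular functions, as a chain
`V_j = y_j (V_{j+1}² + V_{j+1})` of length `n / 2` ending in a simple pole, with each `y_j` close to
a primitive cube root of unity. Such a `V_0` ramifies, being congruent to a simple pole modulo
functions `w² + w`. In the ramified extension the new generator again has a chain, with `y_j + 1` in
place of `y_j`; this time one link can be absorbed, the next step is unramified, and the chain is
one link shorter. When no link is left, all further steps ramify. Counting points gives `r_i`, and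
summing the recursion gives the genus.
-/

noncomputable section

namespace CurveTower

open IsLocalRing

section Places

variable {k K : Type*} [Field k] [Field K] [Algebra k K]

namespace Place

/-- The valuation of `K` with valuation ring the local ring at `P`. Its value group is not
identified with `ℤ`, so orders of vanishing are expressed through the powers of a local parameter
(`Place.IsParam`). -/
abbrev v (P : Place k K) : Valuation K P.ring.ValueGroup := P.ring.valuation

@[ext]
theorem ext {P Q : Place k K} (h : P.ring = Q.ring) : P = Q := by
  cases P; cases Q; cases h; rfl

theorem mem_ring_iff {P : Place k K} {f : K} : f ∈ P.ring ↔ P.v f ≤ 1 :=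
  (P.ring.valuation_le_one_iff f).symm

theorem v_algebraMap_le_one (P : Place k K) (a : k) : P.v (algebraMap k K a) ≤ 1 :=
  mem_ring_iff.1 (P.algebraMap_mem a)

theorem v_algebraMap_eq_one (P : Place k K) {a : k} (ha : a ≠ 0) :
    P.v (algebraMap k K a) = 1 := by
  refine le_antisymm (P.v_algebraMap_le_one a) ?_
  have hinv := P.v_algebraMap_le_one a⁻¹
  rw [map_inv₀, map_inv₀] at hinv
  exact (inv_le_one₀ (zero_lt_iff.2 (by simpa using ha))).1 hinv

theorem exists_one_lt_v (P : Place k K) : ∃ f : K, 1 < P.v f := by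
  by_contra! h
  exact P.ne_top (by ext f; simpa using mem_ring_iff.2 (h f))

theorem mem_maximalIdeal_iff {P : Place k K} {f : P.ring} :
    f ∈ maximalIdeal P.ring ↔ P.v (f : K) < 1 :=
  P.ring.valuation_lt_one_iff f

theorem mem_span_singleton_iff {P : Place k K} {f g : P.ring} :
    f ∈ Ideal.span {g} ↔ P.v (f : K) ≤ P.v (g : K) := by
  rw [Ideal.mem_span_singleton, P.ring.valuation_le_iff]
  constructor
  · rintro ⟨c, rfl⟩
    exact ⟨c, mul_comm _ _⟩
  · rintro ⟨c, hc⟩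
    exact ⟨c, Subtype.ext (hc.symm.trans (mul_comm _ _))⟩

theorem residue_eq_zero_iff {P : Place k K} {f : P.ring} :
    residue P.ring f = 0 ↔ P.v (f : K) < 1 := by
  rw [IsLocalRing.residue_eq_zero_iff, mem_maximalIdeal_iff]

theorem residue_eq_iff {P : Place k K} {f g : K} (hf : f ∈ P.ring) (hg : g ∈ P.ring) :
    residue P.ring ⟨f, hf⟩ = residue P.ring ⟨g, hg⟩ ↔ P.v (f - g) < 1 := by
  rw [← sub_eq_zero, ← map_sub, residue_eq_zero_iff]
  rfl

/-- `t` is a local parameter at `P`: it vanishes at `P`, and its powers exhaust the values of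
nonzero functions. This is the valuation-theoretic form of `Place.IsUniformizer`, for elements of
`K` instead of the local ring. -/
def IsParam (P : Place k K) (t : K) : Prop :=
  P.v t < 1 ∧ ∀ f : K, f ≠ 0 → ∃ n : ℤ, P.v f = P.v t ^ n

namespace IsParam

variable {P : Place k K} {t : K}

theorem ne_zero (h : P.IsParam t) : t ≠ 0 := by
  rintro rfl
  obtain ⟨f, hf⟩ := P.exists_one_lt_v
  obtain ⟨n, hn⟩ := h.2 f (by rintro rfl; simp at hf)
  rcases eq_or_ne n 0 with rfl | hn0
  · simp [hn] at hf
  · simp [hn, zero_zpow n hn0] at hf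

theorem v_pos (h : P.IsParam t) : 0 < P.v t := by
  simpa [zero_lt_iff] using h.ne_zero

theorem congr (h : P.IsParam t) {s : K} (hs : P.v s = P.v t) : P.IsParam s := by
  unfold IsParam
  rwa [hs]

theorem zpow_le_zpow_iff (h : P.IsParam t) {m n : ℤ} : P.v t ^ m ≤ P.v t ^ n ↔ n ≤ m :=
  (zpow_right_strictAnti₀ h.v_pos h.1).le_iff_ge

theorem zpow_le_one_iff (h : P.IsParam t) {n : ℤ} : P.v t ^ n ≤ 1 ↔ 0 ≤ n := by
  rw [← h.zpow_le_zpow_iff, zpow_zero]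

theorem zpow_lt_one_iff (h : P.IsParam t) {n : ℤ} : P.v t ^ n < 1 ↔ 0 < n := by
  rw [← not_le, ← not_le, ← h.zpow_le_zpow_iff, zpow_zero]

theorem zpow_inj (h : P.IsParam t) {m n : ℤ} : P.v t ^ m = P.v t ^ n ↔ m = n :=
  (zpow_right_strictAnti₀ h.v_pos h.1).injective.eq_iff

theorem v_lt_one_iff (h : P.IsParam t) {f : K} : P.v f < 1 ↔ P.v f ≤ P.v t := by
  refine ⟨fun hf => ?_, fun hf => hf.trans_lt h.1⟩
  rcases eq_or_ne f 0 with rfl | hf0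
  · simp
  obtain ⟨n, hn⟩ := h.2 f hf0
  rw [hn, h.zpow_lt_one_iff] at hf
  rw [hn, ← zpow_one (P.v t), ← zpow_mul, one_mul, h.zpow_le_zpow_iff]
  exact hf

theorem v_eq (h : P.IsParam t) {s : K} (hs : P.IsParam s) : P.v s = P.v t :=
  le_antisymm (h.v_lt_one_iff.1 hs.1) (hs.v_lt_one_iff.1 h.1)

theorem isUniformizer_iff (h : P.IsParam t) {s : P.ring} :
    P.IsUniformizer s ↔ P.v (s : K) = P.v t := by
  rw [IsUniformizer, Ideal.ext_iff]
  simp only [mem_maximalIdeal_iff, mem_span_singleton_iff]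
  constructor
  · intro hs
    exact le_antisymm (h.v_lt_one_iff.1 ((hs s).2 le_rfl))
      ((hs ⟨t, mem_ring_iff.2 h.1.le⟩).1 h.1)
  · exact fun hs f => (h.congr hs).v_lt_one_iff

end IsParam

/-- The `k`-subspace of functions `f` with `ord_P f ≥ -n`, where `t` is a local parameter at `P`. -/
def polar (P : Place k K) (t : K) (n : ℤ) : Submodule k K where
  carrier := {f | P.v (f * t ^ n) ≤ 1}
  add_mem' {f g} hf hg := by
    rw [Set.mem_ofPred_eq, add_mul]
    exact P.v.map_add_le hf hg
  zero_mem' := by simp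
  smul_mem' c f hf := by
    rw [Set.mem_ofPred_eq, Algebra.smul_def, mul_assoc, map_mul]
    exact mul_le_one' (P.v_algebraMap_le_one c) hf

theorem mem_polar {P : Place k K} {t : K} {n : ℤ} {f : K} :
    f ∈ P.polar t n ↔ P.v f * P.v t ^ n ≤ 1 := by
  rw [← map_zpow₀, ← map_mul]
  exact Iff.rfl

theorem exists_mem_polar_add_natCast {P : Place k K} {t : K} (ht : P.IsParam t) (f : K) (m : ℤ) :
    ∃ N : ℕ, f ∈ P.polar t (m + N) := by
  rcases eq_or_ne f 0 with rfl | hf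
  · exact ⟨0, zero_mem _⟩
  obtain ⟨n, hn⟩ := ht.2 f hf
  refine ⟨(-n - m).toNat, ?_⟩
  rw [mem_polar, hn, ← zpow_add₀ ht.v_pos.ne', ht.zpow_le_one_iff]
  have := Int.self_le_toNat (-n - m)
  omega

/-- The coefficient of `t ^ (-n)` in the expansion at `P` of a function `f` with `ord_P f ≥ -n`,
as an element of the residue field. -/
def leadingCoeff (P : Place k K) (t : K) (n : ℤ) :
    P.polar t n →ₗ[k] ResidueField P.ring where
  toFun f := residue P.ring ⟨f * t ^ n, mem_ring_iff.2 f.2⟩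
  map_add' f g := by
    rw [← map_add]
    exact congrArg _ (Subtype.ext (add_mul _ _ _))
  map_smul' c f := by
    rw [RingHom.id_apply, Algebra.smul_def]
    change _ = residue P.ring (algebraMap k P.ring c) * _
    rw [← map_mul]
    refine congrArg _ (Subtype.ext ?_)
    change (c • (f : K)) * t ^ n = algebraMap k K c * (f * t ^ n)
    rw [Algebra.smul_def, mul_assoc]

theorem leadingCoeff_eq_zero_iff {P : Place k K} {t : K} (ht : P.IsParam t) {n : ℤ}
    {f : P.polar t (n + 1)} : P.leadingCoeff t (n + 1) f = 0 ↔ (f : K) ∈ P.polar t n := by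
  have key : P.v ((f : K) * t ^ (n + 1)) ≤ P.v t ↔ P.v (f : K) * P.v t ^ n ≤ 1 := by
    rw [map_mul, map_zpow₀, zpow_add_one₀ ht.v_pos.ne', ← mul_assoc]
    exact mul_le_iff_le_one_left ht.v_pos
  rw [mem_polar, ← key, ← ht.v_lt_one_iff]
  exact residue_eq_zero_iff

end Place

/-- The properties of the points of a smooth projective curve over `k` on which the theory of
Riemann–Roch spaces rests. -/
structure IsCurve (k K : Type*) [Field k] [Field K] [Algebra k K] : Prop where
  exists_isParam : ∀ P : Place k K, ∃ t, P.IsParam t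
  finite_residueField : ∀ P : Place k K, Module.Finite k (ResidueField P.ring)
  finite_poles : ∀ f : K, {P : Place k K | f ∉ P.ring}.Finite

namespace Divisor

theorem mem_polar_of_mem_riemannRochSpace {D : Divisor k K} {f : K} (hf : f ∈ D.riemannRochSpace)
    {P : Place k K} {t : K} (ht : P.IsParam t) : f ∈ P.polar t (D P) := by
  have := hf P ⟨t, Place.mem_ring_iff.2 ht.1.le⟩ (ht.isUniformizer_iff.2 rfl)
  rwa [Place.mem_ring_iff, map_mul, map_zpow₀, ← Place.mem_polar] at this

theorem mem_riemannRochSpace_iff {D : Divisor k K} {f : K} {t : Place k K → K}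
    (ht : ∀ P : Place k K, P.IsParam (t P)) :
    f ∈ D.riemannRochSpace ↔ ∀ P : Place k K, f ∈ P.polar (t P) (D P) := by
  refine ⟨fun hf P => mem_polar_of_mem_riemannRochSpace hf (ht P), fun hf P s hs => ?_⟩
  rw [Place.mem_ring_iff, map_mul, map_zpow₀, (ht P).isUniformizer_iff.1 hs]
  exact Place.mem_polar.1 (hf P)

end Divisor

end Places

section RiemannRoch

variable {k K : Type*} [Field k] [Field K] [Algebra k K]

theorem single_natCast_nonneg {ι : Type*} (a : ι) (n : ℕ) :
    (0 : ι →₀ ℤ) ≤ Finsupp.single a (n : ℤ) := by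
  classical
  intro b
  rw [Finsupp.single_apply]
  split_ifs <;> simp

theorem single_one_nonneg {ι : Type*} (a : ι) : (0 : ι →₀ ℤ) ≤ Finsupp.single a 1 :=
  single_natCast_nonneg a 1

theorem exists_multiset_sum_single {ι : Type*} {A : ι →₀ ℤ} (hA : 0 ≤ A) :
    ∃ s : Multiset ι, A = (s.map fun a => Finsupp.single a 1).sum := by
  refine ⟨∑ a ∈ A.support, Multiset.replicate (A a).toNat a, ?_⟩
  have hmap : ((∑ a ∈ A.support, Multiset.replicate (A a).toNat a).map
      fun a => (Finsupp.single a 1 : ι →₀ ℤ)).sum =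
        ∑ a ∈ A.support, (A a).toNat • (Finsupp.single a 1 : ι →₀ ℤ) := by
    rw [← Multiset.coe_mapAddMonoidHom, map_sum, Multiset.sum_sum]
    simp
  rw [hmap]
  conv_lhs => rw [← Finsupp.sum_single A]
  refine Finset.sum_congr rfl fun a _ => ?_
  rw [← natCast_zsmul, Finsupp.smul_single, smul_eq_mul, mul_one, Int.toNat_of_nonneg (hA a)]

theorem finsupp_int_le_induction {ι : Type*} {p : (ι →₀ ℤ) → Prop} {D D' : ι →₀ ℤ} (h : D ≤ D')
    (base : p D) (add_single : ∀ E a, D ≤ E → p E → p (E + Finsupp.single a 1)) : p D' := by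
  have hsum (s : Multiset ι) : D ≤ D + (s.map fun a => (Finsupp.single a 1 : ι →₀ ℤ)).sum ∧
      p (D + (s.map fun a => (Finsupp.single a 1 : ι →₀ ℤ)).sum) := by
    induction s using Multiset.induction with
    | empty => simpa using base
    | cons a s ih =>
      rw [Multiset.map_cons, Multiset.sum_cons, add_comm (Finsupp.single a 1), ← add_assoc]
      exact ⟨ih.1.trans (le_add_of_nonneg_right (single_one_nonneg a)), add_single _ a ih.1 ih.2⟩
  obtain ⟨s, hs⟩ := exists_multiset_sum_single (sub_nonneg.2 h)
  rw [← add_sub_cancel D D', hs]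
  exact (hsum s).2

theorem Place.IsUniformizer.ne_zero {P : Place k K} {t : P.ring} (ht : P.IsUniformizer t) :
    (t : K) ≠ 0 := by
  intro ht0
  obtain ⟨f, hf⟩ := P.exists_one_lt_v
  have hf0 : f ≠ 0 := by rintro rfl; simp at hf
  have hinv : P.v f⁻¹ < 1 := by simpa [map_inv₀] using inv_lt_one_of_one_lt₀ hf
  have hmem : (⟨f⁻¹, mem_ring_iff.2 hinv.le⟩ : P.ring) ∈ maximalIdeal P.ring :=
    mem_maximalIdeal_iff.2 hinv
  rw [ht, mem_span_singleton_iff, ht0, map_zero, nonpos_iff_eq_zero, map_eq_zero] at hmem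
  exact inv_ne_zero hf0 hmem

namespace Divisor

theorem degree_add (D D' : Divisor k K) : (D + D').degree = D.degree + D'.degree :=
  Finsupp.sum_add_index' (by simp) (by intros; ring)

theorem degree_single (P : Place k K) (n : ℤ) :
    Divisor.degree (Finsupp.single P n) = n * P.degree :=
  Finsupp.sum_single_index (by simp)

theorem degree_zero : Divisor.degree (0 : Divisor k K) = 0 := Finsupp.sum_zero_index

theorem degree_sub (D D' : Divisor k K) : (D - D').degree = D.degree - D'.degree := by
  rw [eq_sub_iff_add_eq, ← degree_add, sub_add_cancel]

theorem riemannRochSpace_mono : Monotone (riemannRochSpace : Divisor k K → Submodule k K) := by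
  intro D D' hD f hf P t ht
  obtain ⟨n, hn⟩ := Int.le.dest (hD P)
  rw [← hn, zpow_add₀ ht.ne_zero, zpow_natCast, ← mul_assoc]
  exact P.ring.mul_mem _ _ (hf P t ht) (pow_mem t.2 n)

section LeadingCoeff

variable (D : Divisor k K) {P : Place k K} {t : K} (ht : P.IsParam t)

include ht in
theorem riemannRochSpace_add_single_le_polar :
    (D + Finsupp.single P 1).riemannRochSpace ≤ P.polar t (D P + 1) := by
  intro f hf
  simpa using mem_polar_of_mem_riemannRochSpace hf ht

/-- The leading coefficient at `P` of the functions in `L(D + P)`. -/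
def leadingCoeffMap : (D + Finsupp.single P 1).riemannRochSpace →ₗ[k] ResidueField P.ring :=
  P.leadingCoeff t (D P + 1) ∘ₗ
    Submodule.inclusion (riemannRochSpace_add_single_le_polar D ht)

theorem ker_leadingCoeffMap : LinearMap.ker (leadingCoeffMap D ht) =
    D.riemannRochSpace.submoduleOf (D + Finsupp.single P 1).riemannRochSpace := by
  ext f
  refine (Place.leadingCoeff_eq_zero_iff ht).trans
    ⟨fun hP Q s hs => ?_, fun hf => mem_polar_of_mem_riemannRochSpace hf ht⟩
  rcases eq_or_ne Q P with rfl | hQ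
  · rw [Place.mem_ring_iff, map_mul, map_zpow₀, ht.isUniformizer_iff.1 hs]
    exact Place.mem_polar.1 hP
  · simpa [Finsupp.single_eq_of_ne hQ] using f.2 Q s hs

theorem riemannRochSpace_le_add_single (P : Place k K) :
    D.riemannRochSpace ≤ (D + Finsupp.single P 1).riemannRochSpace :=
  riemannRochSpace_mono (le_add_of_nonneg_right (single_one_nonneg P))

/-- The functions in `L(D + P)` with vanishing leading coefficient at `P` are those in `L(D)`. -/
def kerLeadingCoeffMapEquiv : LinearMap.ker (leadingCoeffMap D ht) ≃ₗ[k] D.riemannRochSpace :=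
  (LinearEquiv.ofEq _ _ (ker_leadingCoeffMap D ht)).trans
    (Submodule.submoduleOfEquivOfLe (riemannRochSpace_le_add_single D P))

variable [Module.Finite k (ResidueField P.ring)] [Module.Finite k D.riemannRochSpace]

include ht in
theorem finite_riemannRochSpace_add_single :
    Module.Finite k (D + Finsupp.single P 1).riemannRochSpace := by
  have := Module.Finite.equiv (kerLeadingCoeffMapEquiv D ht).symm
  have := Module.Finite.equiv (leadingCoeffMap D ht).quotKerEquivRange.symm
  exact Module.Finite.of_submodule_quotient (LinearMap.ker (leadingCoeffMap D ht))

theorem ell_add_single : (D + Finsupp.single P 1).ell =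
    D.ell + Module.finrank k (LinearMap.range (leadingCoeffMap D ht)) := by
  have := finite_riemannRochSpace_add_single D ht
  rw [ell, ell, ← (leadingCoeffMap D ht).finrank_range_add_finrank_ker,
    (kerLeadingCoeffMapEquiv D ht).finrank_eq, add_comm]

include ht in
theorem ell_add_single_le : (D + Finsupp.single P 1).ell ≤ D.ell + P.degree := by
  rw [ell_add_single D ht]
  exact Nat.add_le_add_left (Submodule.finrank_le _) _

theorem ell_add_single_eq_iff : (D + Finsupp.single P 1).ell = D.ell + P.degree ↔
    Function.Surjective (leadingCoeffMap D ht) := by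
  rw [ell_add_single D ht, Nat.add_left_cancel_iff, ← LinearMap.range_eq_top, Place.degree]
  exact ⟨Submodule.eq_top_of_finrank_eq, fun h => by rw [h, finrank_top]⟩

end LeadingCoeff

end Divisor

theorem IsCurve.finite_and_degree_sub_ell_le (h : IsCurve k K) {D D' : Divisor k K} (hD : D ≤ D')
    (hfin : Module.Finite k D.riemannRochSpace) :
    Module.Finite k D'.riemannRochSpace ∧ D.degree - (D.ell : ℤ) ≤ D'.degree - D'.ell := by
  refine finsupp_int_le_induction (p := fun E => Module.Finite k (Divisor.riemannRochSpace E) ∧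
    D.degree - (D.ell : ℤ) ≤ Divisor.degree E - Divisor.ell E) hD ⟨hfin, le_rfl⟩ ?_
  rintro E P - ⟨hE, hle⟩
  obtain ⟨t, ht⟩ := h.exists_isParam P
  have := h.finite_residueField P
  have hell := Divisor.ell_add_single_le E ht
  refine ⟨Divisor.finite_riemannRochSpace_add_single E ht, hle.trans ?_⟩
  rw [Divisor.degree_add, Divisor.degree_single]
  zify at hell
  linarith

/-- The integer `g` is the value of `deg D + 1 - ℓ(D)` on a cofinal set of divisors `D`. On a curve
this makes `g` the genus (`HasGenus.isGenus`); in contrast to a maximum, the condition can be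
checked on the pullbacks of large divisors from a quotient curve. -/
def HasGenus (k K : Type*) [Field k] [Field K] [Algebra k K] (g : ℤ) : Prop :=
  ∀ D : Divisor k K, ∃ D', D ≤ D' ∧ Module.Finite k D'.riemannRochSpace ∧
    D'.degree + 1 - (D'.ell : ℤ) = g

/-- The divisors `D ≥ D₀` are nonspecial for the genus `g`: they satisfy
`ℓ(D) = deg D + 1 - g`. -/
def IsNonspecialAbove (D₀ : Divisor k K) (g : ℤ) : Prop :=
  ∀ D, D₀ ≤ D → Module.Finite k D.riemannRochSpace ∧ D.degree + 1 - (D.ell : ℤ) = g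

namespace HasGenus

variable {g : ℤ}

theorem finite (hg : HasGenus k K g) (D : Divisor k K) : Module.Finite k D.riemannRochSpace := by
  obtain ⟨D', hD, hfin, -⟩ := hg D
  exact Submodule.finiteDimensional_of_le (Divisor.riemannRochSpace_mono hD)

theorem isGenus (h : IsCurve k K) (hg : HasGenus k K g) : IsGenus k K g := by
  constructor
  · obtain ⟨D, -, -, hD⟩ := hg 0
    exact ⟨D, hD⟩
  · rintro _ ⟨D, rfl⟩
    obtain ⟨D', hD, -, rfl⟩ := hg D
    have := (h.finite_and_degree_sub_ell_le hD (hg.finite D)).2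
    dsimp only
    linarith

theorem exists_isNonspecialAbove (h : IsCurve k K) (hg : HasGenus k K g) :
    ∃ D₀ : Divisor k K, IsNonspecialAbove D₀ g := by
  obtain ⟨D₀, -, -, hD₀⟩ := hg 0
  refine ⟨D₀, fun D hD => ⟨hg.finite D, ?_⟩⟩
  obtain ⟨D', hD', -, hgD'⟩ := hg D
  have hle := (h.finite_and_degree_sub_ell_le hD (hg.finite D₀)).2
  have hle' := (h.finite_and_degree_sub_ell_le hD' (hg.finite D)).2
  linarith

end HasGenus

namespace IsNonspecialAbove

variable {g : ℤ} {D₀ D : Divisor k K}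

theorem mono (hD₀ : IsNonspecialAbove D₀ g) (hD : D₀ ≤ D) : IsNonspecialAbove D g :=
  fun E hE => hD₀ E (hD.trans hE)

theorem leadingCoeffMap_surjective (h : IsCurve k K) (hD : IsNonspecialAbove D g) {P : Place k K}
    {t : K} (ht : P.IsParam t) : Function.Surjective (D.leadingCoeffMap ht) := by
  obtain ⟨hfin, hgD⟩ := hD D le_rfl
  have hgP := (hD (D + Finsupp.single P 1) (le_add_of_nonneg_right (single_one_nonneg P))).2
  have := h.finite_residueField P
  rw [Divisor.degree_add, Divisor.degree_single] at hgP
  rw [← Divisor.ell_add_single_eq_iff]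
  zify
  linarith

theorem exists_sub_mem_polar (h : IsCurve k K) (hD : IsNonspecialAbove D g) {P : Place k K}
    {t : K} (ht : P.IsParam t) {f : K} (hf : f ∈ P.polar t (D P + 1)) :
    ∃ b ∈ (D + Finsupp.single P 1).riemannRochSpace, f - b ∈ P.polar t (D P) := by
  obtain ⟨b, hb⟩ := hD.leadingCoeffMap_surjective h ht (P.leadingCoeff t (D P + 1) ⟨f, hf⟩)
  have hbP := Divisor.riemannRochSpace_add_single_le_polar D ht b.2
  refine ⟨b, b.2, (Place.leadingCoeff_eq_zero_iff ht (f := ⟨f, hf⟩ - ⟨(b : K), hbP⟩)).1 ?_⟩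
  rw [map_sub, ← hb, sub_eq_zero]
  rfl

theorem exists_approx_at (h : IsCurve k K) (hD : IsNonspecialAbove D g) {t : Place k K → K}
    (ht : ∀ P : Place k K, P.IsParam (t P)) (P : Place k K) (f : K) :
    ∃ a : K, a - f ∈ P.polar (t P) (D P) ∧ ∀ Q ≠ P, a ∈ Q.polar (t Q) (D Q) := by
  obtain ⟨N, hN⟩ := Place.exists_mem_polar_add_natCast (ht P) f (D P)
  induction N generalizing f with
  | zero =>
    refine ⟨0, ?_, fun Q _ => zero_mem _⟩
    rw [zero_sub]
    exact neg_mem (by simpa using hN)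
  | succ N ih =>
    set E : Divisor k K := D + Finsupp.single P (N : ℤ) with hE
    have hEP : E P = D P + N := by simp [hE]
    obtain ⟨b, hb, hfb⟩ := (hD.mono (le_add_of_nonneg_right
      (single_natCast_nonneg P N))).exists_sub_mem_polar h (ht P) (f := f) (D := E)
        (by rw [hEP, add_assoc]; exact_mod_cast hN)
    obtain ⟨a, ha, haQ⟩ := ih (f - b) (by rwa [← hEP])
    refine ⟨a + b, by convert ha using 1; ring, fun Q hQ => add_mem (haQ Q hQ) ?_⟩
    simpa [hE, Finsupp.single_eq_of_ne hQ] using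
      Divisor.mem_polar_of_mem_riemannRochSpace hb (ht Q)

theorem exists_approx (h : IsCurve k K) (hD : IsNonspecialAbove D g) {t : Place k K → K}
    (ht : ∀ P : Place k K, P.IsParam (t P)) (f : Place k K → K) (hf : f.support.Finite) :
    ∃ a : K, ∀ P, a - f P ∈ P.polar (t P) (D P) := by
  classical
  choose a ha haQ using fun P => hD.exists_approx_at h ht P (f P)
  refine ⟨∑ P ∈ hf.toFinset, a P, fun P => ?_⟩
  by_cases hP : P ∈ hf.toFinset
  · rw [← Finset.add_sum_erase _ _ hP, add_sub_right_comm]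
    exact add_mem (ha P) (sum_mem fun Q hQ => haQ Q P (Finset.ne_of_mem_erase hQ).symm)
  · have hfP : f P = 0 := by simpa [Set.Finite.mem_toFinset] using hP
    rw [hfP, sub_zero]
    exact sum_mem fun Q hQ => haQ Q P (ne_of_mem_of_not_mem hQ hP).symm

end IsNonspecialAbove

end RiemannRoch

section Extension

variable {k K K' : Type*} [Field k] [Field K] [Field K'] [Algebra k K] [Algebra k K']
  [Algebra K K'] [IsScalarTower k K K']

namespace Place

/-- The point of the curve with function field `K` below `Q`, for an algebraic extension `K'` of
`K`: the image of `Q` under the corresponding morphism of curves. -/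
def under (K : Type*) [Field K] [Algebra k K] [Algebra K K'] [IsScalarTower k K K']
    [Algebra.IsAlgebraic K K'] (Q : Place k K') : Place k K where
  ring := Q.ring.comap (algebraMap K K')
  algebraMap_mem a := by
    rw [ValuationSubring.mem_comap, ← IsScalarTower.algebraMap_apply]
    exact Q.algebraMap_mem a
  ne_top h := Q.ne_top (by
    let φ : K →+* Q.ring := (algebraMap K K').codRestrict Q.ring fun a => by
      rw [← ValuationSubring.mem_comap, h]
      exact ValuationSubring.mem_top a
    ext f
    refine ⟨fun _ => ValuationSubring.mem_top f, fun _ => ?_⟩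
    obtain ⟨p, hp, hpf⟩ := (Algebra.IsAlgebraic.isAlgebraic (R := K) f).isIntegral
    have hf : IsIntegral Q.ring f := ⟨p.map φ, hp.map φ, by rwa [Polynomial.eval₂_map]⟩
    obtain ⟨g, rfl⟩ := IsIntegrallyClosed.isIntegral_iff.1 hf
    exact g.2)

variable [Algebra.IsAlgebraic K K'] {P : Place k K} {Q : Place k K'}

theorem v_algebraMap_le_one_iff (hQ : Q.under K = P) {a : K} :
    Q.v (algebraMap K K' a) ≤ 1 ↔ P.v a ≤ 1 := by
  subst hQ
  rw [← mem_ring_iff, ← mem_ring_iff]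
  exact Iff.rfl

theorem v_algebraMap_le_iff (hQ : Q.under K = P) {a b : K} :
    Q.v (algebraMap K K' a) ≤ Q.v (algebraMap K K' b) ↔ P.v a ≤ P.v b := by
  rcases eq_or_ne b 0 with rfl | hb
  · simp
  have hP : 0 < P.v b := by simpa [zero_lt_iff] using hb
  have hQ' : 0 < Q.v (algebraMap K K' b) := by simpa [zero_lt_iff] using hb
  rw [← div_le_one₀ hP, ← div_le_one₀ hQ', ← map_div₀, ← map_div₀, ← map_div₀,
    v_algebraMap_le_one_iff hQ]

theorem v_algebraMap_eq_iff (hQ : Q.under K = P) {a b : K} :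
    Q.v (algebraMap K K' a) = Q.v (algebraMap K K' b) ↔ P.v a = P.v b := by
  simp only [le_antisymm_iff, v_algebraMap_le_iff hQ]

theorem v_algebraMap_lt_one_iff (hQ : Q.under K = P) {a : K} :
    Q.v (algebraMap K K' a) < 1 ↔ P.v a < 1 := by
  simpa using (v_algebraMap_le_iff hQ (a := 1) (b := a)).not

theorem one_lt_v_algebraMap_iff (hQ : Q.under K = P) {a : K} :
    1 < Q.v (algebraMap K K' a) ↔ 1 < P.v a := by
  rw [← not_le, v_algebraMap_le_one_iff hQ, not_le]

theorem v_algebraMap_eq_one_iff (hQ : Q.under K = P) {a : K} :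
    Q.v (algebraMap K K' a) = 1 ↔ P.v a = 1 := by
  simpa using v_algebraMap_eq_iff hQ (a := a) (b := 1)

theorem v_algebraMap_eq_zpow (hQ : Q.under K = P) {a t : K} {n : ℤ} (h : P.v a = P.v t ^ n) :
    Q.v (algebraMap K K' a) = Q.v (algebraMap K K' t) ^ n := by
  rw [← map_zpow₀] at h
  rw [(v_algebraMap_eq_iff hQ).2 h, map_zpow₀, map_zpow₀]

theorem exists_under_eq (P : Place k K) : ∃ Q : Place k K', Q.under K = P := by
  obtain ⟨A, hA, hloc⟩ := IsLocalRing.exists_factor_valuationRing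
    ((algebraMap K K').comp P.ring.subtype)
  have hmem (a : K) : algebraMap K K' a ∈ A ↔ a ∈ P.ring := by
    refine ⟨fun ha => ?_, fun ha => hA ⟨a, ha⟩⟩
    by_contra hna
    have hinv : P.v a⁻¹ < 1 := by
      rw [mem_ring_iff, not_le] at hna
      rw [map_inv₀]
      exact inv_lt_one_of_one_lt₀ hna
    have ha0 : a ≠ 0 := fun h => hna (h ▸ P.ring.zero_mem)
    have hunit : IsUnit (⟨a⁻¹, mem_ring_iff.2 hinv.le⟩ : P.ring) := by
      refine hloc.map_nonunit _ (IsUnit.of_mul_eq_one ⟨algebraMap K K' a, ha⟩ (Subtype.ext ?_))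
      change algebraMap K K' a⁻¹ * algebraMap K K' a = 1
      rw [← map_mul, inv_mul_cancel₀ ha0, map_one]
    exact hinv.ne ((P.ring.valuation_eq_one_iff _).1 hunit)
  refine ⟨⟨A, fun a => ?_, fun h => P.ne_top ?_⟩, Place.ext (SetLike.ext hmem)⟩
  · rw [IsScalarTower.algebraMap_apply k K K', hmem]
    exact P.algebraMap_mem a
  · exact eq_top_iff.2 fun a _ => (hmem a).1 (h ▸ ValuationSubring.mem_top _)

/-- The inclusion of local rings at a point and its image. -/
def ringMap (Q : Place k K') : (Q.under K).ring →+* Q.ring :=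
  ((algebraMap K K').comp (Q.under K).ring.subtype).codRestrict Q.ring fun a => a.2

instance (Q : Place k K') : IsLocalHom (Q.ringMap (K := K)) where
  map_nonunit a ha := by
    rw [ValuationSubring.valuation_eq_one_iff] at ha ⊢
    exact (v_algebraMap_eq_one_iff rfl).1 ha

/-- The inclusion of residue fields at a point and its image. -/
def residueMap (Q : Place k K') : ResidueField (Q.under K).ring →ₗ[k] ResidueField Q.ring where
  toFun := ResidueField.map (Q.ringMap (K := K))
  map_add' := map_add _
  map_smul' c a := by
    rw [RingHom.id_apply, Algebra.smul_def, Algebra.smul_def, map_mul]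
    congr 1
    change ResidueField.map _ (residue _ (algebraMap k (Q.under K).ring c)) =
      residue _ (algebraMap k Q.ring c)
    rw [ResidueField.map_residue]
    exact congrArg _ (Subtype.ext (IsScalarTower.algebraMap_apply k K K' c).symm)

theorem residueMap_residue (Q : Place k K') {a : K} (ha : a ∈ (Q.under K).ring) :
    Q.residueMap (residue (Q.under K).ring ⟨a, ha⟩) =
      residue Q.ring ⟨algebraMap K K' a, ha⟩ := rfl

theorem finite_and_degree_eq (hQ : Q.under K = P)
    (happrox : ∀ f : K', Q.v f ≤ 1 → ∃ a : K, P.v a ≤ 1 ∧ Q.v (f - algebraMap K K' a) < 1)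
    (hfin : Module.Finite k (ResidueField P.ring)) :
    Module.Finite k (ResidueField Q.ring) ∧ Q.degree = P.degree := by
  subst hQ
  have hbij : Function.Bijective (Q.residueMap (K := K)) := by
    refine ⟨(ResidueField.map (Q.ringMap (K := K))).injective, fun c => ?_⟩
    obtain ⟨f, rfl⟩ := residue_surjective c
    obtain ⟨a, ha, haf⟩ := happrox f (Q.ring.valuation_le_one f)
    refine ⟨residue _ ⟨a, mem_ring_iff.2 ha⟩, ?_⟩
    rw [residueMap_residue]
    exact ((residue_eq_iff f.2 _).2 haf).symm
  let e := LinearEquiv.ofBijective _ hbij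
  exact ⟨Module.Finite.equiv e, e.finrank_eq.symm⟩

/-- The map `(α, β) ↦ α + β ζ` between residue fields, where `ζ` is the residue of `z`. -/
def residuePairMap (K : Type*) [Field K] [Algebra k K] [Algebra K K'] [IsScalarTower k K K']
    [Algebra.IsAlgebraic K K'] (Q : Place k K') (z : Q.ring) :
    ResidueField (Q.under K).ring × ResidueField (Q.under K).ring →ₗ[k] ResidueField Q.ring :=
  Q.residueMap.coprod (LinearMap.mulRight k (residue Q.ring z) ∘ₗ Q.residueMap)

theorem residuePairMap_residue (Q : Place k K') {z : K'} (hz : z ∈ Q.ring) {a b : K}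
    (ha : a ∈ (Q.under K).ring) (hb : b ∈ (Q.under K).ring) :
    Q.residuePairMap K ⟨z, hz⟩ (residue _ ⟨a, ha⟩, residue _ ⟨b, hb⟩) =
      residue Q.ring ⟨algebraMap K K' a + algebraMap K K' b * z,
        Q.ring.add_mem _ _ ha (Q.ring.mul_mem _ _ hb hz)⟩ :=
  (map_add (residue Q.ring) ⟨algebraMap K K' a, ha⟩ (⟨algebraMap K K' b, hb⟩ * ⟨z, hz⟩)).symm

theorem finite_and_degree_eq_two_mul (hQ : Q.under K = P) {z : K'} (hz : Q.v z ≤ 1)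
    (happrox : ∀ f : K', Q.v f ≤ 1 → ∃ a b : K, P.v a ≤ 1 ∧ P.v b ≤ 1 ∧
      Q.v (f - (algebraMap K K' a + algebraMap K K' b * z)) < 1)
    (hindep : ∀ a b : K, P.v a ≤ 1 → P.v b ≤ 1 →
      Q.v (algebraMap K K' a + algebraMap K K' b * z) < 1 → P.v a < 1 ∧ P.v b < 1)
    (hfin : Module.Finite k (ResidueField P.ring)) :
    Module.Finite k (ResidueField Q.ring) ∧ Q.degree = 2 * P.degree := by
  subst hQ
  have hbij : Function.Bijective (Q.residuePairMap K ⟨z, mem_ring_iff.2 hz⟩) := by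
    constructor
    · refine (injective_iff_map_eq_zero _).2 ?_
      rintro ⟨a, b⟩ hab
      obtain ⟨⟨a, ha⟩, rfl⟩ := residue_surjective a
      obtain ⟨⟨b, hb⟩, rfl⟩ := residue_surjective b
      rw [residuePairMap_residue, residue_eq_zero_iff] at hab
      rw [Prod.mk_eq_zero, residue_eq_zero_iff, residue_eq_zero_iff]
      exact hindep a b (mem_ring_iff.1 ha) (mem_ring_iff.1 hb) hab
    · intro c
      obtain ⟨f, rfl⟩ := residue_surjective c
      obtain ⟨a, b, ha, hb, habf⟩ := happrox f (Q.ring.valuation_le_one f)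
      refine ⟨(residue _ ⟨a, mem_ring_iff.2 ha⟩, residue _ ⟨b, mem_ring_iff.2 hb⟩), ?_⟩
      rw [residuePairMap_residue]
      exact ((residue_eq_iff f.2 _).2 habf).symm
  let e := LinearEquiv.ofBijective _ hbij
  refine ⟨Module.Finite.equiv e, ?_⟩
  rw [degree, ← e.finrank_eq, Module.finrank_prod, degree, two_mul]

end Place

end Extension

section ArtinSchreierValuation

variable {K Γ : Type*} [Field K] [LinearOrderedCommGroupWithZero Γ] {v : Valuation K Γ} {z : K}

theorem valuation_sq_add_of_one_lt (hz : 1 < v z) : v (z ^ 2 + z) = v z ^ 2 := by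
  rw [← map_pow]
  refine v.map_add_eq_of_lt_left ?_
  rw [map_pow]
  exact lt_self_pow₀ hz one_lt_two

theorem valuation_sq_add_le_one_iff : v (z ^ 2 + z) ≤ 1 ↔ v z ≤ 1 := by
  refine ⟨fun h => ?_, fun h => v.map_add_le ?_ h⟩
  · by_contra! hz
    rw [valuation_sq_add_of_one_lt hz] at h
    exact (one_lt_pow₀ hz two_ne_zero).not_ge h
  · rw [map_pow]
    exact pow_le_one₀ zero_le h

end ArtinSchreierValuation

section Quadratic

/-- `K'` is the quadratic Artin–Schreier extension of `K` generated by a root `z` of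
`z² + z = c`: that `1, z` is a basis of `K'` over `K` is spelled out in coordinates. -/
structure IsArtinSchreier (K : Type*) {K' : Type*} [Field K] [Field K'] [Algebra K K']
    (z : K') (c : K) : Prop where
  equation : z ^ 2 + z = algebraMap K K' c
  exists_eq : ∀ f : K', ∃ a b : K, f = algebraMap K K' a + algebraMap K K' b * z
  eq_zero : ∀ a b : K, algebraMap K K' a + algebraMap K K' b * z = 0 → a = 0 ∧ b = 0

theorem two_eq_zero_of_algebra (K : Type*) {K' : Type*} [Field K] [Field K'] [Algebra K K']
    [CharP K 2] : (2 : K') = 0 := by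
  rw [← map_ofNat (algebraMap K K') 2, CharTwo.two_eq_zero, map_zero]

theorem exists_max_valuation_eq_one {K Γ : Type*} [Field K] [LinearOrderedCommGroupWithZero Γ]
    (v : Valuation K Γ) {a b : K} (hab : ¬ (a = 0 ∧ b = 0)) :
    ∃ d a' b' : K, d ≠ 0 ∧ max (v a') (v b') = 1 ∧ a = d * a' ∧ b = d * b' := by
  rcases le_total (v a) (v b) with hle | hle
  · have hb : b ≠ 0 := by
      rintro rfl
      exact hab ⟨by simpa using hle, rfl⟩
    refine ⟨b, a / b, 1, hb, ?_, (mul_div_cancel₀ a hb).symm, (mul_one b).symm⟩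
    rw [map_one, map_div₀, max_eq_right (div_le_one_of_le₀ hle zero_le)]
  · have ha : a ≠ 0 := by
      rintro rfl
      exact hab ⟨rfl, by simpa using hle⟩
    refine ⟨a, 1, b / a, ha, ?_, (mul_one a).symm, (mul_div_cancel₀ b ha).symm⟩
    rw [map_one, map_div₀, max_eq_left (div_le_one_of_le₀ hle zero_le)]

namespace IsArtinSchreier

variable {k K K' : Type*} [Field k] [Field K] [Field K'] [Algebra k K]
  [Algebra K K'] {z : K'} {c : K}

theorem isAlgebraic (h : IsArtinSchreier K z c) : Algebra.IsAlgebraic K K' := by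
  have hz : IsIntegral K z := by
    refine ⟨Polynomial.X ^ 2 + Polynomial.X - Polynomial.C c, by monicity!, ?_⟩
    simp [h.equation]
  refine ⟨fun f => ?_⟩
  obtain ⟨a, b, rfl⟩ := h.exists_eq f
  exact (isIntegral_algebraMap.add (isIntegral_algebraMap.mul hz)).isAlgebraic

theorem gen_ne_zero (h : IsArtinSchreier K z c) : z ≠ 0 := by
  rintro rfl
  exact one_ne_zero (h.eq_zero 0 1 (by simp)).2

theorem bijective_coprod (h : IsArtinSchreier K z c) : Function.Bijective
    ((Algebra.linearMap K K').coprod (LinearMap.toSpanSingleton K K' z)) := by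
  constructor
  · refine (injective_iff_map_eq_zero _).2 fun ⟨a, b⟩ hab => ?_
    exact Prod.ext_iff.2 (h.eq_zero a b (by simpa [Algebra.smul_def] using hab))
  · intro f
    obtain ⟨a, b, rfl⟩ := h.exists_eq f
    exact ⟨(a, b), by simp [Algebra.smul_def]⟩

/-- The coordinates of an element of `K'` with respect to the basis `1, z`. -/
def coordEquiv (h : IsArtinSchreier K z c) : K' ≃ₗ[K] K × K :=
  (LinearEquiv.ofBijective _ h.bijective_coprod).symm

theorem coordEquiv_apply (h : IsArtinSchreier K z c) (a b : K) :
    h.coordEquiv (algebraMap K K' a + algebraMap K K' b * z) = (a, b) := by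
  refine (LinearEquiv.symm_apply_eq _).2 ?_
  rw [LinearEquiv.ofBijective_apply]
  simp [Algebra.smul_def]

theorem exists_primitive (h : IsArtinSchreier K z c) (P : Place k K) {f : K'} (hf : f ≠ 0) :
    ∃ d a b : K, d ≠ 0 ∧ max (P.v a) (P.v b) = 1 ∧
      f = algebraMap K K' d * (algebraMap K K' a + algebraMap K K' b * z) := by
  obtain ⟨a, b, rfl⟩ := h.exists_eq f
  have hab : ¬ (a = 0 ∧ b = 0) := by
    rintro ⟨rfl, rfl⟩
    simp at hf
  obtain ⟨d, a', b', hd, hmax, rfl, rfl⟩ := exists_max_valuation_eq_one P.v hab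
  refine ⟨d, a', b', hd, hmax, ?_⟩
  rw [map_mul, map_mul]
  ring

section CharTwo

variable [CharP K 2]

theorem shift (h : IsArtinSchreier K z c) (w : K) :
    IsArtinSchreier K (z + algebraMap K K' w) (c + (w ^ 2 + w)) where
  equation := by
    rw [map_add, ← h.equation, map_add, map_pow]
    linear_combination z * algebraMap K K' w * two_eq_zero_of_algebra K (K' := K')
  exists_eq f := by
    obtain ⟨a, b, rfl⟩ := h.exists_eq f
    exact ⟨a - b * w, b, by rw [map_sub, map_mul]; ring⟩
  eq_zero a b hab := by
    obtain ⟨hsum, rfl⟩ := h.eq_zero (a + b * w) b (by rw [← hab, map_add, map_mul]; ring)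
    exact ⟨by simpa using hsum, rfl⟩

theorem sq_add_gen_add_eq_zero (h : IsArtinSchreier K z c) :
    z ^ 2 + z + algebraMap K K' c = 0 := by
  rw [h.equation, ← map_add, CharTwo.add_self_eq_zero, map_zero]

theorem add_one (h : IsArtinSchreier K z c) : IsArtinSchreier K (z + 1) c := by
  have := h.shift 1
  rwa [map_one, one_pow, CharTwo.add_self_eq_zero, add_zero] at this

/-- The automorphism `z ↦ z + 1` of `K'` over `K`. -/
def conj (h : IsArtinSchreier K z c) : K' →ₐ[K] K' :=
  AlgHom.ofLinearMap (LinearMap.id + Algebra.linearMap K K' ∘ₗ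
      LinearMap.snd K K K ∘ₗ h.coordEquiv.toLinearMap)
    (by simpa using (congrArg Prod.snd (h.coordEquiv_apply 1 0) :)) <| by
    intro f g
    obtain ⟨a, b, rfl⟩ := h.exists_eq f
    obtain ⟨a', b', rfl⟩ := h.exists_eq g
    have hmul : (algebraMap K K' a + algebraMap K K' b * z) *
        (algebraMap K K' a' + algebraMap K K' b' * z) =
        algebraMap K K' (a * a' + b * b' * c) +
          algebraMap K K' (a * b' + a' * b - b * b') * z := by
      simp only [map_add, map_mul, map_sub, ← h.equation]
      ring
    simp only [LinearMap.add_apply, LinearMap.id_apply, LinearMap.comp_apply,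
      LinearEquiv.coe_coe, LinearMap.snd_apply, Algebra.linearMap_apply, coordEquiv_apply]
    rw [hmul, coordEquiv_apply]
    simp only [map_add, map_mul, map_sub, ← h.equation]
    linear_combination
      -(algebraMap K K' b * algebraMap K K' b' * (z + 1)) * two_eq_zero_of_algebra K (K' := K')

theorem conj_apply (h : IsArtinSchreier K z c) (a b : K) :
    h.conj (algebraMap K K' a + algebraMap K K' b * z) =
      algebraMap K K' (a + b) + algebraMap K K' b * z := by
  change _ + algebraMap K K' (h.coordEquiv _).2 = _
  rw [coordEquiv_apply, LinearMap.id_apply, map_add]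
  ring

theorem conj_gen (h : IsArtinSchreier K z c) : h.conj z = z + 1 := by
  simpa [add_comm] using h.conj_apply 0 1

theorem mul_conj (h : IsArtinSchreier K z c) (a b : K) :
    (algebraMap K K' a + algebraMap K K' b * z) *
      h.conj (algebraMap K K' a + algebraMap K K' b * z) =
      algebraMap K K' (a ^ 2 + a * b + b ^ 2 * c) := by
  rw [conj_apply]
  simp only [map_add, map_mul, map_pow, ← h.equation]
  linear_combination
    algebraMap K K' a * algebraMap K K' b * z * two_eq_zero_of_algebra K (K' := K')

theorem valuation_conj_sub_lt_one {Γ : Type*} [LinearOrderedCommGroupWithZero Γ]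
    (h : IsArtinSchreier K z c) {v : Valuation K' Γ} {a b : K}
    (hlt : v (algebraMap K K' a + algebraMap K K' b * z) < 1) :
    v (h.conj (algebraMap K K' a + algebraMap K K' b * z) - algebraMap K K' b) < 1 := by
  rw [conj_apply, map_add]
  convert hlt using 2
  ring

end CharTwo

variable [Algebra k K'] [IsScalarTower k K K'] [Algebra.IsAlgebraic K K'] {P : Place k K}
  {Q : Place k K'} {a b : K}

section Unramified

theorem v_gen_le_one (h : IsArtinSchreier K z c) (hc : P.v c ≤ 1) (hQ : Q.under K = P) :
    Q.v z ≤ 1 := by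
  rwa [← valuation_sq_add_le_one_iff, h.equation, Place.v_algebraMap_le_one_iff hQ]

theorem v_under_lt_one (h : IsArtinSchreier K z c) (hz : Q.v z < 1) : (Q.under K).v c < 1 := by
  rw [← Place.v_algebraMap_lt_one_iff rfl, ← h.equation]
  refine Q.v.map_add_lt ?_ hz
  rw [map_pow]
  exact pow_lt_one₀ zero_le hz two_ne_zero

theorem v_le_one (h : IsArtinSchreier K z c) (hc : P.v c ≤ 1) (hQ : Q.under K = P)
    (ha : P.v a ≤ 1) (hb : P.v b ≤ 1) :
    Q.v (algebraMap K K' a + algebraMap K K' b * z) ≤ 1 := by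
  refine Q.v.map_add_le ((Place.v_algebraMap_le_one_iff hQ).2 ha) ?_
  rw [map_mul]
  exact mul_le_one' ((Place.v_algebraMap_le_one_iff hQ).2 hb) (h.v_gen_le_one hc hQ)

theorem v_snd_eq_one (h : IsArtinSchreier K z c) (hc : P.v c ≤ 1) (hQ : Q.under K = P)
    (hab : max (P.v a) (P.v b) = 1)
    (hlt : Q.v (algebraMap K K' a + algebraMap K K' b * z) < 1) : P.v b = 1 := by
  obtain ⟨ha, hb⟩ := max_le_iff.1 hab.le
  by_contra hb1
  have hb_lt : P.v b < 1 := lt_of_le_of_ne hb hb1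
  have ha1 : Q.v (algebraMap K K' a) = 1 := by
    rw [Place.v_algebraMap_eq_one_iff hQ]
    exact ha.antisymm (not_lt.1 fun ha_lt => (max_lt ha_lt hb_lt).ne hab)
  have hbz : Q.v (algebraMap K K' b * z) < 1 := by
    rw [map_mul]
    exact mul_lt_one_of_lt_of_le ((Place.v_algebraMap_lt_one_iff hQ).2 hb_lt)
      (h.v_gen_le_one hc hQ)
  rw [Q.v.map_add_eq_of_lt_left (by rwa [ha1]), ha1] at hlt
  exact lt_irrefl _ hlt

variable [CharP K 2]

theorem v_eq_v_norm (h : IsArtinSchreier K z c) (hc : P.v c ≤ 1) (hQ : Q.under K = P)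
    (hab : max (P.v a) (P.v b) = 1)
    (hlt : Q.v (algebraMap K K' a + algebraMap K K' b * z) < 1) :
    Q.v (algebraMap K K' a + algebraMap K K' b * z) =
      Q.v (algebraMap K K' (a ^ 2 + a * b + b ^ 2 * c)) := by
  have hb1 : Q.v (algebraMap K K' b) = 1 :=
    (Place.v_algebraMap_eq_one_iff hQ).2 (h.v_snd_eq_one hc hQ hab hlt)
  have hconj : Q.v (h.conj (algebraMap K K' a + algebraMap K K' b * z)) = 1 := by
    rw [Q.v.map_eq_of_sub_lt (by rw [hb1]; exact h.valuation_conj_sub_lt_one hlt), hb1]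
  rw [← h.mul_conj, map_mul, hconj, mul_one]

theorem isParam_of_unramified (h : IsArtinSchreier K z c) (hc : P.v c ≤ 1) (hQ : Q.under K = P)
    {t : K} (ht : P.IsParam t) : Q.IsParam (algebraMap K K' t) := by
  refine ⟨(Place.v_algebraMap_lt_one_iff hQ).2 ht.1, fun f hf => ?_⟩
  suffices hg : ∃ g : K, Q.v f = Q.v (algebraMap K K' g) by
    obtain ⟨g, hg⟩ := hg
    have hg0 : g ≠ 0 := by
      rintro rfl
      exact hf (by simpa using hg)
    obtain ⟨n, hn⟩ := ht.2 g hg0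
    exact ⟨n, hg.trans (Place.v_algebraMap_eq_zpow hQ hn)⟩
  obtain ⟨d, a, b, -, hab, rfl⟩ := h.exists_primitive P hf
  obtain ⟨ha, hb⟩ := max_le_iff.1 hab.le
  rcases (h.v_le_one hc hQ ha hb).lt_or_eq with hlt | heq
  · exact ⟨d * (a ^ 2 + a * b + b ^ 2 * c), by rw [map_mul, h.v_eq_v_norm hc hQ hab hlt,
      map_mul, map_mul]⟩
  · exact ⟨d, by rw [map_mul, heq, mul_one]⟩

end Unramified

end IsArtinSchreier

end Quadratic

section QuadraticFibers

variable {k K K' : Type*} [Field k] [Field K] [Field K'] [Algebra k K] [Algebra k K']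
  [Algebra K K'] [IsScalarTower k K K'] [Algebra.IsAlgebraic K K'] {P : Place k K}
  {Q Q' : Place k K'} {z : K'} {a b c : K}

namespace Place

theorem v_add_mul_eq_one_iff (hQ : Q.under K = P) (hz : Q.v z < 1) (hb : P.v b ≤ 1) :
    Q.v (algebraMap K K' a + algebraMap K K' b * z) = 1 ↔ P.v a = 1 := by
  have hbz : Q.v (algebraMap K K' b * z) < 1 := by
    rw [map_mul]
    exact mul_lt_one_of_nonneg_of_lt_one_right ((v_algebraMap_le_one_iff hQ).2 hb) zero_le hz
  rw [← v_algebraMap_eq_one_iff hQ]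
  refine ⟨fun h => ?_, fun h => ?_⟩
  · rw [← add_sub_cancel_right (algebraMap K K' a) (algebraMap K K' b * z),
      Q.v.map_sub_eq_of_lt_left (by rwa [h]), h]
  · rw [Q.v.map_add_eq_of_lt_left (by rwa [h]), h]

theorem exists_v_mul_sub_lt_one (hQ : Q.under K = P) {u : K'} {d r : K}
    (hdu : Q.v (algebraMap K K' d * u) ≤ 1) (hr : P.v r = 1)
    (hu : Q.v (u - algebraMap K K' r) < 1) :
    ∃ e : K, P.v e ≤ 1 ∧ Q.v (algebraMap K K' d * u - algebraMap K K' e) < 1 := by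
  have hr' : Q.v (algebraMap K K' r) = 1 := (v_algebraMap_eq_one_iff hQ).2 hr
  have hu' : Q.v u = 1 := (Q.v.map_eq_of_sub_lt (by rwa [hr'])).trans hr'
  have hd : Q.v (algebraMap K K' d) ≤ 1 := by rwa [map_mul, hu', mul_one] at hdu
  refine ⟨d * r, ?_, ?_⟩
  · rw [map_mul, hr, mul_one]
    exact (v_algebraMap_le_one_iff hQ).1 hd
  · rw [map_mul, ← mul_sub, map_mul]
    exact mul_lt_one_of_nonneg_of_lt_one_right hd zero_le hu

theorem v_inv_sub_inv_lt_one {u w : K'} (hw : Q.v w = 1) (huw : Q.v (u - w) < 1) :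
    Q.v (u⁻¹ - w⁻¹) < 1 := by
  have hu : Q.v u = 1 := (Q.v.map_eq_of_sub_lt (by rwa [hw])).trans hw
  have ne_zero {x : K'} (hx : Q.v x = 1) : x ≠ 0 := by
    rintro rfl
    simp at hx
  rwa [inv_sub_inv (ne_zero hu) (ne_zero hw), map_div₀, map_mul, hu, hw, mul_one, div_one,
    Q.v.map_sub_swap]

end Place

namespace IsArtinSchreier

section Conjugation

variable [CharP K 2]

/-- The image of a point under the involution `z ↦ z + 1`. -/
def conjPlace (h : IsArtinSchreier K z c) (Q : Place k K') : Place k K' where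
  ring := Q.ring.comap (h.conj : K' →+* K')
  algebraMap_mem a := by
    rw [ValuationSubring.mem_comap, IsScalarTower.algebraMap_apply k K K']
    simpa [← IsScalarTower.algebraMap_apply] using Q.algebraMap_mem a
  ne_top htop := (Q.under K).ne_top <| eq_top_iff.2 fun a _ => by
    have ha : algebraMap K K' a ∈ Q.ring.comap (h.conj : K' →+* K') := by simp [htop]
    change algebraMap K K' a ∈ Q.ring
    simpa using ha

theorem under_conjPlace (h : IsArtinSchreier K z c) (Q : Place k K') :
    (h.conjPlace Q).under K = Q.under K := by
  ext a
  change h.conj (algebraMap K K' a) ∈ Q.ring ↔ algebraMap K K' a ∈ Q.ring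
  rw [h.conj.commutes]

theorem mem_conjPlace_ring (h : IsArtinSchreier K z c) {f : K'} :
    f ∈ (h.conjPlace Q).ring ↔ h.conj f ∈ Q.ring := Iff.rfl

theorem v_conjPlace_lt_one_iff (h : IsArtinSchreier K z c) {f : K'} :
    (h.conjPlace Q).v f < 1 ↔ Q.v (h.conj f) < 1 := by
  rcases eq_or_ne f 0 with rfl | hf
  · simp
  have one_lt_inv {Q : Place k K'} {g : K'} (hg : g ≠ 0) : Q.v g < 1 ↔ g⁻¹ ∉ Q.ring := by
    rw [Place.mem_ring_iff, not_le, map_inv₀, one_lt_inv₀ (by simpa [zero_lt_iff] using hg)]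
  rw [one_lt_inv hf, one_lt_inv (by simpa using hf), ← map_inv₀,
    h.mem_conjPlace_ring]

theorem forall_v_le_one_iff_of_unramified (h : IsArtinSchreier K z c) (hc : P.v c ≤ 1) :
    (∀ Q : Place k K', Q.under K = P → Q.v (algebraMap K K' a + algebraMap K K' b * z) ≤ 1) ↔
      P.v a ≤ 1 ∧ P.v b ≤ 1 := by
  refine ⟨fun hf => ?_, fun ⟨ha, hb⟩ Q hQ => h.v_le_one hc hQ ha hb⟩
  obtain ⟨Q, hQ⟩ := P.exists_under_eq (K' := K')
  have hconj : Q.v (h.conj (algebraMap K K' a + algebraMap K K' b * z)) ≤ 1 := by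
    rw [← Place.mem_ring_iff, ← h.mem_conjPlace_ring, Place.mem_ring_iff]
    exact hf _ ((h.under_conjPlace Q).trans hQ)
  have hb : Q.v (algebraMap K K' b) ≤ 1 := by
    convert Q.v.map_sub_le hconj (hf Q hQ) using 2
    rw [conj_apply, map_add]
    ring
  have ha : Q.v (algebraMap K K' a) ≤ 1 := by
    have hbz : Q.v (algebraMap K K' b * z) ≤ 1 := by
      rw [map_mul]
      exact mul_le_one' hb (h.v_gen_le_one hc hQ)
    simpa using Q.v.map_sub_le (hf Q hQ) hbz
  exact ⟨(Place.v_algebraMap_le_one_iff hQ).1 ha, (Place.v_algebraMap_le_one_iff hQ).1 hb⟩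

end Conjugation

section Split

variable [CharP K 2]

theorem exists_v_eq_of_split (h : IsArtinSchreier K z c) (hc : P.v c ≤ 1) (f : K') :
    ∃ g : K, ∀ Q : Place k K', Q.under K = P → Q.v z < 1 → Q.v f = Q.v (algebraMap K K' g) := by
  rcases eq_or_ne f 0 with rfl | hf
  · exact ⟨0, by simp⟩
  obtain ⟨d, a, b, -, hab, rfl⟩ := h.exists_primitive P hf
  obtain ⟨ha, hb⟩ := max_le_iff.1 hab.le
  by_cases ha1 : P.v a = 1
  · refine ⟨d, fun Q hQ hz => ?_⟩
    rw [map_mul, (Place.v_add_mul_eq_one_iff hQ hz hb).2 ha1, mul_one]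
  · refine ⟨d * (a ^ 2 + a * b + b ^ 2 * c), fun Q hQ hz => ?_⟩
    have hlt := (h.v_le_one hc hQ ha hb).lt_of_ne
      fun heq => ha1 ((Place.v_add_mul_eq_one_iff hQ hz hb).1 heq)
    rw [map_mul, h.v_eq_v_norm hc hQ hab hlt, map_mul, map_mul]

theorem eq_of_split (h : IsArtinSchreier K z c) (hc : P.v c ≤ 1) (hQ : Q.under K = P)
    (hz : Q.v z < 1) (hQ' : Q'.under K = P) (hz' : Q'.v z < 1) : Q = Q' := by
  ext f
  obtain ⟨g, hg⟩ := h.exists_v_eq_of_split hc f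
  rw [Place.mem_ring_iff, Place.mem_ring_iff, hg Q hQ hz, hg Q' hQ' hz',
    Place.v_algebraMap_le_one_iff hQ, Place.v_algebraMap_le_one_iff hQ']

theorem degree_of_split (h : IsArtinSchreier K z c) (hc : P.v c ≤ 1) (hQ : Q.under K = P)
    (hz : Q.v z < 1) (hfin : Module.Finite k (ResidueField P.ring)) :
    Module.Finite k (ResidueField Q.ring) ∧ Q.degree = P.degree := by
  refine Place.finite_and_degree_eq hQ (fun f hf => ?_) hfin
  rcases eq_or_ne f 0 with rfl | hf0
  · exact ⟨0, by simp⟩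
  obtain ⟨d, a, b, -, hab, rfl⟩ := h.exists_primitive P hf0
  obtain ⟨ha, hb⟩ := max_le_iff.1 hab.le
  by_cases ha1 : P.v a = 1
  · refine Place.exists_v_mul_sub_lt_one hQ hf ha1 ?_
    rw [add_sub_cancel_left, map_mul]
    exact mul_lt_one_of_nonneg_of_lt_one_right ((Place.v_algebraMap_le_one_iff hQ).2 hb)
      zero_le hz
  -- Here `a + b z` vanishes at `Q`, but its conjugate is congruent to `b`, a unit.
  · have hlt := (h.v_le_one hc hQ ha hb).lt_of_ne
      fun heq => ha1 ((Place.v_add_mul_eq_one_iff hQ hz hb).1 heq)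
    have hb1 : P.v b = 1 := h.v_snd_eq_one hc hQ hab hlt
    have hconj := h.valuation_conj_sub_lt_one hlt
    have hconj0 : h.conj (algebraMap K K' a + algebraMap K K' b * z) ≠ 0 := by
      intro h0
      rw [h0, zero_sub, Valuation.map_neg, (Place.v_algebraMap_eq_one_iff hQ).2 hb1] at hconj
      exact lt_irrefl _ hconj
    have heq : algebraMap K K' d * (algebraMap K K' a + algebraMap K K' b * z) =
        algebraMap K K' (d * (a ^ 2 + a * b + b ^ 2 * c)) *
          (h.conj (algebraMap K K' a + algebraMap K K' b * z))⁻¹ := by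
      rw [map_mul, ← h.mul_conj, mul_assoc, mul_inv_cancel_right₀ hconj0]
    rw [heq] at hf ⊢
    refine Place.exists_v_mul_sub_lt_one hQ hf (r := b⁻¹) (by rw [map_inv₀, hb1, inv_one]) ?_
    rw [map_inv₀]
    exact Place.v_inv_sub_inv_lt_one ((Place.v_algebraMap_eq_one_iff hQ).2 hb1) hconj

theorem exists_under_eq_of_split (h : IsArtinSchreier K z c) (hc : P.v c < 1) :
    ∃ Q : Place k K', Q.under K = P ∧ Q.v z < 1 := by
  obtain ⟨Q, hQ⟩ := P.exists_under_eq (K' := K')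
  by_cases hz : Q.v z < 1
  · exact ⟨Q, hQ, hz⟩
  refine ⟨h.conjPlace Q, (h.under_conjPlace Q).trans hQ, ?_⟩
  have hmul : z * (z + 1) = algebraMap K K' c := by rw [← h.equation]; ring
  rw [v_conjPlace_lt_one_iff, conj_gen, ← one_mul (Q.v (z + 1))]
  nth_rw 1 [← (h.v_gen_le_one hc.le hQ).eq_of_not_lt hz]
  rw [← map_mul, hmul]
  exact (Place.v_algebraMap_lt_one_iff hQ).2 hc

end Split

section Inert

variable (hroot : ∀ r : K, P.v r ≤ 1 → ¬ P.v (c + (r ^ 2 + r)) < 1)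

include hroot

theorem v_eq_one_of_inert [CharP K 2] (h : IsArtinSchreier K z c) (hc : P.v c ≤ 1)
    (hQ : Q.under K = P) (hab : max (P.v a) (P.v b) = 1) :
    Q.v (algebraMap K K' a + algebraMap K K' b * z) = 1 := by
  obtain ⟨ha, hb⟩ := max_le_iff.1 hab.le
  by_contra hne
  have hlt := (h.v_le_one hc hQ ha hb).lt_of_ne hne
  have hb1 : P.v b = 1 := h.v_snd_eq_one hc hQ hab hlt
  have hb0 : b ≠ 0 := by
    rintro rfl
    simp at hb1
  refine hroot (a / b) (by rwa [map_div₀, hb1, div_one]) ?_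
  have hnorm : a ^ 2 + a * b + b ^ 2 * c = b ^ 2 * (c + ((a / b) ^ 2 + a / b)) := by
    field_simp
    ring
  rwa [h.v_eq_v_norm hc hQ hab hlt, Place.v_algebraMap_lt_one_iff hQ, hnorm, map_mul, map_pow,
    hb1, one_pow, one_mul] at hlt

theorem v_le_one_iff_of_inert [CharP K 2] (h : IsArtinSchreier K z c) (hc : P.v c ≤ 1)
    (hQ : Q.under K = P) :
    Q.v (algebraMap K K' a + algebraMap K K' b * z) ≤ 1 ↔ P.v a ≤ 1 ∧ P.v b ≤ 1 := by
  refine ⟨fun hf => ?_, fun ⟨ha, hb⟩ => h.v_le_one hc hQ ha hb⟩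
  by_cases h0 : a = 0 ∧ b = 0
  · obtain ⟨rfl, rfl⟩ := h0
    simp
  obtain ⟨d, a, b, -, hab, rfl, rfl⟩ := exists_max_valuation_eq_one P.v h0
  obtain ⟨ha, hb⟩ := max_le_iff.1 hab.le
  rw [map_mul, map_mul, mul_assoc, ← mul_add, map_mul, h.v_eq_one_of_inert hroot hc hQ hab,
    mul_one, Place.v_algebraMap_le_one_iff hQ] at hf
  rw [map_mul, map_mul]
  exact ⟨mul_le_one' hf ha, mul_le_one' hf hb⟩

theorem eq_of_inert [CharP K 2] (h : IsArtinSchreier K z c) (hc : P.v c ≤ 1)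
    (hQ : Q.under K = P) (hQ' : Q'.under K = P) : Q = Q' := by
  ext f
  obtain ⟨a, b, rfl⟩ := h.exists_eq f
  rw [Place.mem_ring_iff, Place.mem_ring_iff, h.v_le_one_iff_of_inert hroot hc hQ,
    h.v_le_one_iff_of_inert hroot hc hQ']

theorem degree_of_inert [CharP K 2] (h : IsArtinSchreier K z c) (hc : P.v c ≤ 1)
    (hQ : Q.under K = P) (hfin : Module.Finite k (ResidueField P.ring)) :
    Module.Finite k (ResidueField Q.ring) ∧ Q.degree = 2 * P.degree := by
  refine Place.finite_and_degree_eq_two_mul hQ (h.v_gen_le_one hc hQ) (fun f hf => ?_)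
    (fun a b ha hb hlt => ?_) hfin
  · obtain ⟨a, b, rfl⟩ := h.exists_eq f
    obtain ⟨ha, hb⟩ := (h.v_le_one_iff_of_inert hroot hc hQ).1 hf
    exact ⟨a, b, ha, hb, by simp⟩
  · rw [← max_lt_iff]
    exact (max_le ha hb).lt_of_ne fun hab => hlt.ne (h.v_eq_one_of_inert hroot hc hQ hab)

end Inert

section Ramified

theorem one_lt_v_of_ramified (h : IsArtinSchreier K z c) (hc : P.IsParam c⁻¹)
    (hQ : Q.under K = P) : 1 < Q.v z := by
  rw [← not_le, ← valuation_sq_add_le_one_iff, h.equation, Place.v_algebraMap_le_one_iff hQ,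
    not_le, ← inv_lt_one₀ (by simpa using hc.v_pos), ← map_inv₀]
  exact hc.1

theorem v_algebraMap_of_ramified (h : IsArtinSchreier K z c) (hc : P.IsParam c⁻¹)
    (hQ : Q.under K = P) {n : ℤ} (hn : P.v a = P.v c⁻¹ ^ n) :
    Q.v (algebraMap K K' a) = Q.v z⁻¹ ^ (2 * n) := by
  rw [Place.v_algebraMap_eq_zpow hQ hn, map_inv₀, map_inv₀, ← h.equation,
    valuation_sq_add_of_one_lt (h.one_lt_v_of_ramified hc hQ), map_inv₀, zpow_mul, ← inv_pow]
  norm_cast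

theorem v_mul_gen_of_ramified (h : IsArtinSchreier K z c) (hc : P.IsParam c⁻¹)
    (hQ : Q.under K = P) {n : ℤ} (hn : P.v b = P.v c⁻¹ ^ n) :
    Q.v (algebraMap K K' b * z) = Q.v z⁻¹ ^ (2 * n - 1) := by
  have hz : Q.v z⁻¹ ≠ 0 := by
    rw [map_inv₀]
    exact inv_ne_zero (zero_lt_one.trans (h.one_lt_v_of_ramified hc hQ)).ne'
  rw [map_mul, h.v_algebraMap_of_ramified hc hQ hn, zpow_sub_one₀ hz, map_inv₀, inv_inv]

theorem v_of_ramified (h : IsArtinSchreier K z c) (hc : P.IsParam c⁻¹) (hQ : Q.under K = P) :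
    Q.v (algebraMap K K' a + algebraMap K K' b * z) =
      max (Q.v (algebraMap K K' a)) (Q.v (algebraMap K K' b * z)) := by
  rcases eq_or_ne a 0 with rfl | ha
  · simp
  rcases eq_or_ne b 0 with rfl | hb
  · simp
  obtain ⟨m, hm⟩ := hc.2 a ha
  obtain ⟨n, hn⟩ := hc.2 b hb
  have hz := h.one_lt_v_of_ramified hc hQ
  have hz0 : 0 < Q.v z⁻¹ := by
    rw [map_inv₀]
    exact inv_pos.2 (zero_lt_one.trans hz)
  have hz1 : Q.v z⁻¹ < 1 := by
    rw [map_inv₀]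
    exact inv_lt_one_of_one_lt₀ hz
  apply Q.v.map_add_of_distinct_val
  rw [h.v_algebraMap_of_ramified hc hQ hm, h.v_mul_gen_of_ramified hc hQ hn,
    (zpow_right_strictAnti₀ hz0 hz1).injective.ne_iff]
  omega

theorem isParam_of_ramified (h : IsArtinSchreier K z c) (hc : P.IsParam c⁻¹)
    (hQ : Q.under K = P) : Q.IsParam z⁻¹ := by
  refine ⟨?_, fun f hf => ?_⟩
  · rw [map_inv₀]
    exact inv_lt_one_of_one_lt₀ (h.one_lt_v_of_ramified hc hQ)
  obtain ⟨a, b, rfl⟩ := h.exists_eq f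
  have hpos : 0 < Q.v (algebraMap K K' a + algebraMap K K' b * z) := by
    simpa [zero_lt_iff] using hf
  rw [h.v_of_ramified hc hQ] at hpos ⊢
  rcases max_choice (Q.v (algebraMap K K' a)) (Q.v (algebraMap K K' b * z)) with hmax | hmax
  · rw [hmax] at hpos ⊢
    obtain ⟨n, hn⟩ := hc.2 a (by rintro rfl; simp at hpos)
    exact ⟨_, h.v_algebraMap_of_ramified hc hQ hn⟩
  · rw [hmax] at hpos ⊢
    obtain ⟨n, hn⟩ := hc.2 b (by rintro rfl; simp at hpos)
    exact ⟨_, h.v_mul_gen_of_ramified hc hQ hn⟩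

theorem v_mul_gen_le_one_iff_of_ramified (h : IsArtinSchreier K z c) (hc : P.IsParam c⁻¹)
    (hQ : Q.under K = P) : Q.v (algebraMap K K' b * z) ≤ 1 ↔ P.v b < 1 := by
  rcases eq_or_ne b 0 with rfl | hb
  · simp
  obtain ⟨n, hn⟩ := hc.2 b hb
  rw [h.v_mul_gen_of_ramified hc hQ hn, hn, hc.zpow_lt_one_iff,
    (h.isParam_of_ramified hc hQ).zpow_le_one_iff]
  omega

theorem v_mul_gen_lt_one_of_ramified (h : IsArtinSchreier K z c) (hc : P.IsParam c⁻¹)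
    (hQ : Q.under K = P) (hb : P.v b < 1) : Q.v (algebraMap K K' b * z) < 1 := by
  rcases eq_or_ne b 0 with rfl | hb0
  · simp
  obtain ⟨n, hn⟩ := hc.2 b hb0
  rw [hn, hc.zpow_lt_one_iff] at hb
  rw [h.v_mul_gen_of_ramified hc hQ hn, (h.isParam_of_ramified hc hQ).zpow_lt_one_iff]
  omega

theorem v_le_one_iff_of_ramified (h : IsArtinSchreier K z c) (hc : P.IsParam c⁻¹)
    (hQ : Q.under K = P) :
    Q.v (algebraMap K K' a + algebraMap K K' b * z) ≤ 1 ↔ P.v a ≤ 1 ∧ P.v b < 1 := by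
  rw [h.v_of_ramified hc hQ, max_le_iff, Place.v_algebraMap_le_one_iff hQ,
    h.v_mul_gen_le_one_iff_of_ramified hc hQ]

theorem eq_of_ramified (h : IsArtinSchreier K z c) (hc : P.IsParam c⁻¹)
    (hQ : Q.under K = P) (hQ' : Q'.under K = P) : Q = Q' := by
  ext f
  obtain ⟨a, b, rfl⟩ := h.exists_eq f
  rw [Place.mem_ring_iff, Place.mem_ring_iff, h.v_le_one_iff_of_ramified hc hQ,
    h.v_le_one_iff_of_ramified hc hQ']

theorem degree_of_ramified (h : IsArtinSchreier K z c) (hc : P.IsParam c⁻¹)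
    (hQ : Q.under K = P) (hfin : Module.Finite k (ResidueField P.ring)) :
    Module.Finite k (ResidueField Q.ring) ∧ Q.degree = P.degree := by
  refine Place.finite_and_degree_eq hQ (fun f hf => ?_) hfin
  obtain ⟨a, b, rfl⟩ := h.exists_eq f
  obtain ⟨ha, hb⟩ := (h.v_le_one_iff_of_ramified hc hQ).1 hf
  exact ⟨a, ha, by simpa using h.v_mul_gen_lt_one_of_ramified hc hQ hb⟩

end Ramified

end IsArtinSchreier

end QuadraticFibers

section Fiber

variable {k K K' : Type*} [Field k] [Field K] [Field K'] [Algebra k K] [Algebra k K']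
  [Algebra K K'] [IsScalarTower k K K'] [Algebra.IsAlgebraic K K']
  {z : K'} {c : K} {P : Place k K}

/-- The points of `K' = K ⊕ K z` above `P` all have ramification index `e`, their degrees add up
to `2 / e` times the degree of `P`, and the functions regular at all of them are those with
coordinates `a` and `b` such that `ord_P a ≥ 0` and `ord_P b ≥ e - 1`. -/
structure IsFiber (P : Place k K) (z : K') (e : ℕ) : Prop where
  exists_finset : ∃ S : Finset (Place k K'), (∀ Q, Q ∈ S ↔ Q.under K = P) ∧
    e * ∑ Q ∈ S, Q.degree = 2 * P.degree
  finite_residueField : ∀ Q : Place k K', Q.under K = P → Module.Finite k (ResidueField Q.ring)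
  exists_isParam : ∀ Q : Place k K', Q.under K = P → ∀ t, P.IsParam t →
    ∃ s, Q.IsParam s ∧ Q.v s ^ e = Q.v (algebraMap K K' t)
  forall_le_one_iff : ∀ (a b t : K), P.IsParam t →
    ((∀ Q : Place k K', Q.under K = P → Q.v (algebraMap K K' a + algebraMap K K' b * z) ≤ 1) ↔
      P.v a ≤ 1 ∧ P.v b ≤ P.v t ^ (e - 1))

namespace IsArtinSchreier

theorem isFiber_of_ramified (h : IsArtinSchreier K z c) (hc : P.IsParam c⁻¹)
    (hfin : Module.Finite k (ResidueField P.ring)) : IsFiber P z 2 where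
  exists_finset := by
    obtain ⟨Q, hQ⟩ := P.exists_under_eq (K' := K')
    refine ⟨{Q}, fun Q' => ?_, by rw [Finset.sum_singleton, (h.degree_of_ramified hc hQ hfin).2]⟩
    rw [Finset.mem_singleton]
    exact ⟨fun hQ' => hQ' ▸ hQ, fun hQ' => h.eq_of_ramified hc hQ' hQ⟩
  finite_residueField Q hQ := (h.degree_of_ramified hc hQ hfin).1
  exists_isParam Q hQ t ht := by
    refine ⟨z⁻¹, h.isParam_of_ramified hc hQ, ?_⟩
    have htc : P.v t = P.v c⁻¹ ^ (1 : ℤ) := by rw [zpow_one, hc.v_eq ht]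
    rw [h.v_algebraMap_of_ramified hc hQ htc]
    norm_cast
  forall_le_one_iff a b t ht := by
    rw [Nat.add_one_sub_one, pow_one, ← ht.v_lt_one_iff]
    obtain ⟨Q, hQ⟩ := P.exists_under_eq (K' := K')
    exact ⟨fun H => (h.v_le_one_iff_of_ramified hc hQ).1 (H Q hQ),
      fun H Q' hQ' => (h.v_le_one_iff_of_ramified hc hQ').2 H⟩

variable [CharP K 2]

theorem v_gen_lt_one_or (h : IsArtinSchreier K z c) (hc : P.v c < 1) {Q : Place k K'}
    (hQ : Q.under K = P) : Q.v z < 1 ∨ Q.v (z + 1) < 1 := by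
  by_contra! hlt
  have hmul : Q.v (z * (z + 1)) = 1 := by
    rw [map_mul, (h.v_gen_le_one hc.le hQ).antisymm hlt.1,
      (h.add_one.v_gen_le_one hc.le hQ).antisymm hlt.2, mul_one]
  rw [mul_add, mul_one, ← sq, h.equation, Place.v_algebraMap_eq_one_iff hQ] at hmul
  exact hc.ne hmul

theorem exists_finset_of_split (h : IsArtinSchreier K z c) (hc : P.v c < 1)
    (hfin : Module.Finite k (ResidueField P.ring)) :
    ∃ S : Finset (Place k K'), (∀ Q, Q ∈ S ↔ Q.under K = P) ∧
      ∑ Q ∈ S, Q.degree = 2 * P.degree := by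
  classical
  obtain ⟨Q₀, hQ₀, hz₀⟩ := h.exists_under_eq_of_split hc
  obtain ⟨Q₁, hQ₁, hz₁⟩ := h.add_one.exists_under_eq_of_split hc
  have hne : Q₀ ≠ Q₁ := by
    rintro rfl
    simpa using Q₀.v.map_sub_lt hz₁ hz₀
  refine ⟨{Q₀, Q₁}, fun Q => ?_, ?_⟩
  · rw [Finset.mem_insert, Finset.mem_singleton]
    refine ⟨?_, fun hQ => ?_⟩
    · rintro (rfl | rfl)
      exacts [hQ₀, hQ₁]
    · exact (h.v_gen_lt_one_or hc hQ).imp (fun hz => h.eq_of_split hc.le hQ hz hQ₀ hz₀)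
        (fun hz => h.add_one.eq_of_split hc.le hQ hz hQ₁ hz₁)
  · rw [Finset.sum_pair hne, (h.degree_of_split hc.le hQ₀ hz₀ hfin).2,
      (h.add_one.degree_of_split hc.le hQ₁ hz₁ hfin).2, two_mul]

theorem finite_residueField_of_split (h : IsArtinSchreier K z c) (hc : P.v c < 1)
    (hfin : Module.Finite k (ResidueField P.ring)) {Q : Place k K'} (hQ : Q.under K = P) :
    Module.Finite k (ResidueField Q.ring) :=
  (h.v_gen_lt_one_or hc hQ).elim (fun hz => (h.degree_of_split hc.le hQ hz hfin).1)
    (fun hz => (h.add_one.degree_of_split hc.le hQ hz hfin).1)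

theorem isFiber_of_unramified (h : IsArtinSchreier K z c) (hc : P.v c ≤ 1)
    (hfin : Module.Finite k (ResidueField P.ring)) : IsFiber P z 1 where
  exists_finset := by
    simp only [one_mul]
    by_cases! hroot : ∃ r : K, P.v r ≤ 1 ∧ P.v (c + (r ^ 2 + r)) < 1
    · obtain ⟨r, -, hr⟩ := hroot
      exact (h.shift r).exists_finset_of_split hr hfin
    · replace hroot r hr := (hroot r hr).not_gt
      obtain ⟨Q, hQ⟩ := P.exists_under_eq (K' := K')
      refine ⟨{Q}, fun Q' => ?_, ?_⟩
      · rw [Finset.mem_singleton]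
        exact ⟨fun hQ' => hQ' ▸ hQ, fun hQ' => h.eq_of_inert hroot hc hQ' hQ⟩
      · rw [Finset.sum_singleton, (h.degree_of_inert hroot hc hQ hfin).2]
  finite_residueField Q hQ := by
    by_cases! hroot : ∃ r : K, P.v r ≤ 1 ∧ P.v (c + (r ^ 2 + r)) < 1
    · obtain ⟨r, -, hr⟩ := hroot
      exact (h.shift r).finite_residueField_of_split hr hfin hQ
    · exact (h.degree_of_inert (fun r hr => (hroot r hr).not_gt) hc hQ hfin).1
  exists_isParam Q hQ t ht := ⟨_, h.isParam_of_unramified hc hQ ht, pow_one _⟩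
  forall_le_one_iff a b t _ := by
    rw [Nat.sub_self, pow_zero]
    exact h.forall_v_le_one_iff_of_unramified hc

end IsArtinSchreier

end Fiber

section Genus

theorem finite_and_finrank_eq_comap_inl_add_map_snd {k V W : Type*} [Field k] [AddCommGroup V]
    [Module k V] [AddCommGroup W] [Module k W] (M : Submodule k (V × W))
    [Module.Finite k (M.comap (LinearMap.inl k V W))]
    [Module.Finite k (M.map (LinearMap.snd k V W))] :
    Module.Finite k M ∧ Module.finrank k M = Module.finrank k (M.comap (LinearMap.inl k V W)) +
      Module.finrank k (M.map (LinearMap.snd k V W)) := by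
  let π : M →ₗ[k] W := LinearMap.snd k V W ∘ₗ M.subtype
  have hrange : LinearMap.range π = M.map (LinearMap.snd k V W) := by
    rw [LinearMap.range_comp, Submodule.range_subtype]
  let kerEquiv : M.comap (LinearMap.inl k V W) ≃ₗ[k] LinearMap.ker π :=
    { toFun a := ⟨⟨(a, 0), a.2⟩, rfl⟩
      map_add' a b := by ext <;> simp
      map_smul' r a := by ext <;> simp
      invFun m := ⟨(m : V × W).1, by
        obtain ⟨⟨⟨a, b⟩, hab⟩, rfl : b = 0⟩ := m
        exact hab⟩
      left_inv a := rfl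
      right_inv m := by
        obtain ⟨⟨⟨a, b⟩, hab⟩, rfl : b = 0⟩ := m
        rfl }
  have := Module.Finite.equiv kerEquiv
  have := Module.Finite.equiv (π.quotKerEquivRange.trans (LinearEquiv.ofEq _ _ hrange)).symm
  have hfin : Module.Finite k M := Module.Finite.of_submodule_quotient (LinearMap.ker π)
  refine ⟨hfin, ?_⟩
  rw [← π.finrank_range_add_finrank_ker, hrange, ← kerEquiv.finrank_eq, add_comm]

variable {k K K' : Type*} [Field k] [Field K] [Field K'] [Algebra k K] [Algebra k K']
  [Algebra K K'] [IsScalarTower k K K'] [Algebra.IsAlgebraic K K']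

theorem finite_setOf_under_mem {z : Place k K → K'} {e : Place k K → ℕ}
    (hF : ∀ P : Place k K, IsFiber P (z P) (e P)) {S : Set (Place k K)} (hS : S.Finite) :
    {Q : Place k K' | Q.under K ∈ S}.Finite := by
  choose T hT using fun P => (hF P).exists_finset
  refine (hS.biUnion fun P _ => (T P).finite_toSet).subset fun Q hQ => ?_
  exact Set.mem_biUnion hQ (Finset.mem_coe.2 (((hT _).1 Q).2 rfl))

theorem exists_nonneg_forall_le_under (K : Type*) [Field K] [Algebra k K] [Algebra K K']
    [IsScalarTower k K K'] [Algebra.IsAlgebraic K K'] (D' : Divisor k K') :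
    ∃ A : Divisor k K, 0 ≤ A ∧ ∀ Q, D' Q ≤ A (Q.under K) := by
  classical
  have hnonneg : 0 ≤ D' ⊔ 0 := le_sup_right
  refine ⟨Finsupp.mapDomain (Place.under K) (D' ⊔ 0), ?_, fun Q => ?_⟩
  · exact Finsupp.mapDomain_nonneg hnonneg
  · have hle : Finsupp.single Q ((D' ⊔ 0) Q) ≤ D' ⊔ 0 := by
      intro Q'
      rw [Finsupp.single_apply]
      split_ifs with hQ
      exacts [hQ ▸ le_rfl, hnonneg Q']
    have hQ := Finsupp.mapDomain_mono (f := Place.under K) hle (Q.under K)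
    rw [Finsupp.mapDomain_single, Finsupp.single_eq_same] at hQ
    exact le_sup_left.trans hQ

section Pullback

variable {z : Place k K → K'} {e : Place k K → ℕ} (hF : ∀ P : Place k K, IsFiber P (z P) (e P))

/-- The pullback of a divisor along the morphism of curves belonging to `K' / K`. The ramification
indices are read off from the fibers. -/
def Divisor.pullback (D : Divisor k K) : Divisor k K' :=
  Finsupp.ofSupportFinite (fun Q => e (Q.under K) * D (Q.under K)) <|
    (finite_setOf_under_mem hF D.support.finite_toSet).subset fun _ hQ =>
      Finset.mem_coe.2 (Finsupp.mem_support_iff.2 (right_ne_zero_of_mul hQ))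

theorem Divisor.pullback_apply (D : Divisor k K) (Q : Place k K') :
    D.pullback hF Q = e (Q.under K) * D (Q.under K) := rfl

theorem Divisor.degree_pullback (D : Divisor k K) : (D.pullback hF).degree = 2 * D.degree := by
  classical
  choose S hS hdeg using fun P => (hF P).exists_finset
  have hsub : (D.pullback hF).support ⊆ D.support.biUnion S := by
    intro Q hQ
    rw [Finsupp.mem_support_iff, pullback_apply] at hQ
    exact Finset.mem_biUnion.2
      ⟨Q.under K, Finsupp.mem_support_iff.2 (right_ne_zero_of_mul hQ), (hS _ Q).2 rfl⟩
  have hdisj : (D.support : Set (Place k K)).PairwiseDisjoint S := by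
    intro P _ P' _ hne
    refine Finset.disjoint_left.2 fun Q hQ hQ' => hne ?_
    rw [← (hS P Q).1 hQ, (hS P' Q).1 hQ']
  rw [degree, Finsupp.sum_of_support_subset _ hsub _ (by simp), Finset.sum_biUnion hdisj, degree,
    Finsupp.sum, Finset.mul_sum]
  refine Finset.sum_congr rfl fun P _ => ?_
  have hdegP : (e P : ℤ) * ∑ Q ∈ S P, (Q.degree : ℤ) = 2 * P.degree := by exact_mod_cast hdeg P
  calc ∑ Q ∈ S P, D.pullback hF Q * (Q.degree : ℤ)
      = ∑ Q ∈ S P, D P * (e P * (Q.degree : ℤ)) := by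
        refine Finset.sum_congr rfl fun Q hQ => ?_
        rw [pullback_apply, (hS P Q).1 hQ]
        ring
    _ = D P * (e P * ∑ Q ∈ S P, (Q.degree : ℤ)) := by rw [Finset.mul_sum, Finset.mul_sum]
    _ = 2 * (D P * P.degree) := by rw [hdegP]; ring

end Pullback

theorem IsFiber.forall_mem_polar_iff {P : Place k K} {z : K'} {e : ℕ} (hP : IsFiber P z e)
    (he : 1 ≤ e) {t : K} (ht : P.IsParam t) {s : Place k K' → K'}
    (hs : ∀ Q : Place k K', Q.IsParam (s Q))
    {n : ℤ} {a b : K} :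
    (∀ Q : Place k K', Q.under K = P →
      algebraMap K K' a + algebraMap K K' b * z ∈ Q.polar (s Q) (e * n)) ↔
      a ∈ P.polar t n ∧ b ∈ P.polar t (n - (e - 1)) := by
  have hv (Q : Place k K') (hQ : Q.under K = P) :
      algebraMap K K' a + algebraMap K K' b * z ∈ Q.polar (s Q) (e * n) ↔
        Q.v (algebraMap K K' (a * t ^ n) + algebraMap K K' (b * t ^ n) * z) ≤ 1 := by
    obtain ⟨s', hs', hst⟩ := hP.exists_isParam Q hQ t ht
    have hmul : algebraMap K K' (a * t ^ n) + algebraMap K K' (b * t ^ n) * z =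
        (algebraMap K K' a + algebraMap K K' b * z) * algebraMap K K' t ^ n := by
      simp only [map_mul, map_zpow₀]
      ring
    rw [Place.mem_polar, zpow_mul, zpow_natCast, hs'.v_eq (hs Q), hst, hmul, map_mul, map_zpow₀]
  have hexp : P.v t ^ (n - (e - 1)) = P.v t ^ n / P.v t ^ (e - 1) := by
    rw [zpow_sub₀ ht.v_pos.ne', ← Nat.cast_pred he, zpow_natCast]
  rw [forall₂_congr hv, hP.forall_le_one_iff _ _ _ ht, Place.mem_polar, Place.mem_polar, map_mul,
    map_zpow₀, map_mul, map_zpow₀, hexp, ← mul_div_assoc, div_le_one₀ (pow_pos ht.v_pos _)]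

variable {y : K'} {u : K} {w : Place k K → K} {e : Place k K → ℕ}

theorem mem_riemannRochSpace_pullback (hK' : IsCurve k K')
    (hF : ∀ P : Place k K, IsFiber P (y + algebraMap K K' (w P)) (e P))
    (he : ∀ P, 1 ≤ e P) {t : Place k K → K} (ht : ∀ P : Place k K, P.IsParam (t P))
    {D E : Divisor k K} (hE : ∀ P, E P = e P - 1) {a b : K} :
    algebraMap K K' a + algebraMap K K' b * y ∈ (D.pullback hF).riemannRochSpace ↔
      ∀ P, a - b * w P ∈ P.polar (t P) (D P) ∧ b ∈ P.polar (t P) ((D - E) P) := by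
  choose s hs using hK'.exists_isParam
  have hfib (P : Place k K) := (hF P).forall_mem_polar_iff (he P) (ht P) hs (n := D P)
    (a := a - b * w P) (b := b)
  have hsplit (P : Place k K) : algebraMap K K' (a - b * w P) +
      algebraMap K K' b * (y + algebraMap K K' (w P)) =
        algebraMap K K' a + algebraMap K K' b * y := by
    rw [map_sub, map_mul]
    ring
  simp only [hsplit, ← hE, ← Finsupp.sub_apply] at hfib
  rw [Divisor.mem_riemannRochSpace_iff hs]
  exact ⟨fun H P => (hfib P).1 fun Q hQ => hQ ▸ H Q, fun H Q => (hfib _).2 (H _) Q rfl⟩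

theorem IsCurve.of_isFiber (hK : IsCurve k K) (h : IsArtinSchreier K y u)
    (hF : ∀ P : Place k K, IsFiber P (y + algebraMap K K' (w P)) (e P)) : IsCurve k K' where
  exists_isParam Q := by
    obtain ⟨t, ht⟩ := hK.exists_isParam (Q.under K)
    obtain ⟨s, hs, -⟩ := (hF _).exists_isParam Q rfl t ht
    exact ⟨s, hs⟩
  finite_residueField Q := (hF _).finite_residueField Q rfl
  finite_poles f := by
    obtain ⟨a, b, rfl⟩ := h.exists_eq f
    refine (finite_setOf_under_mem hF (((hK.finite_poles a).union (hK.finite_poles b)).union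
      (hK.finite_poles u))).subset fun Q hQ => ?_
    by_contra hcon
    simp only [Set.mem_union, Set.mem_ofPred_eq, not_or, not_not, Place.mem_ring_iff] at hcon
    exact hQ (Place.mem_ring_iff.2 (h.v_le_one hcon.2 rfl hcon.1.1 hcon.1.2))

theorem IsNonspecialAbove.finite_and_ell_pullback {g : ℤ} (hK : IsCurve k K)
    (h : IsArtinSchreier K y u)
    (hF : ∀ P : Place k K, IsFiber P (y + algebraMap K K' (w P)) (e P))
    (he : ∀ P, 1 ≤ e P) (hw : w.support.Finite) {D E : Divisor k K} (hE : ∀ P, E P = e P - 1)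
    (hDE : IsNonspecialAbove (D - E) g) (hD : IsNonspecialAbove D g) :
    Module.Finite k (D.pullback hF).riemannRochSpace ∧
      (D.pullback hF).ell = D.ell + (D - E).ell := by
  choose t ht using hK.exists_isParam
  let coord : K' ≃ₗ[k] K × K := h.coordEquiv.restrictScalars k
  let M : Submodule k (K × K) := (D.pullback hF).riemannRochSpace.map coord.toLinearMap
  have hmem (a b : K) : (a, b) ∈ M ↔
      ∀ P, a - b * w P ∈ P.polar (t P) (D P) ∧ b ∈ P.polar (t P) ((D - E) P) := by
    rw [← mem_riemannRochSpace_pullback (hK.of_isFiber h hF) hF he ht hE]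
    exact (Submodule.mem_map_equiv ..).trans (by
      rw [(LinearEquiv.symm_apply_eq coord).2 (h.coordEquiv_apply a b).symm])
  have hinl : M.comap (LinearMap.inl k K K) = D.riemannRochSpace := by
    ext a
    rw [Submodule.mem_comap, LinearMap.inl_apply, hmem, Divisor.mem_riemannRochSpace_iff ht]
    simp
  have hsnd : M.map (LinearMap.snd k K K) = (D - E).riemannRochSpace := by
    ext b
    rw [Submodule.mem_map, Divisor.mem_riemannRochSpace_iff ht]
    constructor
    · rintro ⟨⟨a, b⟩, hab, rfl⟩ P
      exact ((hmem a b).1 hab P).2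
    · intro hb
      obtain ⟨a, ha⟩ := hD.exists_approx hK ht (fun P => b * w P)
        (hw.subset fun P hP => right_ne_zero_of_mul hP)
      exact ⟨(a, b), (hmem a b).2 fun P => ⟨ha P, hb P⟩, rfl⟩
  have : Module.Finite k (M.comap (LinearMap.inl k K K)) := hinl ▸ (hD D le_rfl).1
  have : Module.Finite k (M.map (LinearMap.snd k K K)) := hsnd ▸ (hDE (D - E) le_rfl).1
  obtain ⟨hfin, hrank⟩ := finite_and_finrank_eq_comap_inl_add_map_snd M
  let e := coord.submoduleMap (D.pullback hF).riemannRochSpace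
  refine ⟨Module.Finite.equiv e.symm, ?_⟩
  rw [Divisor.ell, e.finrank_eq, hrank, hinl, hsnd, Divisor.ell, Divisor.ell]

/-- Only the ramified points contribute to the different, each with multiplicity two, because
their standard forms have simple poles. -/
theorem HasGenus.of_isFiber {g : ℤ} (hK : IsCurve k K) (hg : HasGenus k K g)
    (h : IsArtinSchreier K y u)
    (hF : ∀ P : Place k K, IsFiber P (y + algebraMap K K' (w P)) (e P))
    (he : ∀ P, 1 ≤ e P) (hw : w.support.Finite) {E : Divisor k K} (hE : ∀ P, E P = e P - 1) :
    HasGenus k K' (2 * g - 1 + E.degree) := by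
  obtain ⟨D₀, hD₀⟩ := hg.exists_isNonspecialAbove hK
  intro D'
  obtain ⟨A, hA, hD'A⟩ := exists_nonneg_forall_le_under K D'
  have hE0 : 0 ≤ E := fun P => by
    rw [hE]
    exact sub_nonneg.2 (Nat.one_le_cast.2 (he P))
  set D : Divisor k K := D₀ ⊔ 0 + E + A with hD_def
  have hDE : D₀ ≤ D - E := by
    rw [show D - E = D₀ ⊔ 0 + A by rw [hD_def]; abel]
    exact le_sup_left.trans (le_add_of_nonneg_right hA)
  have hD : D₀ ≤ D := hDE.trans (sub_le_self _ hE0)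
  have hAD : A ≤ D := le_add_of_nonneg_left (add_nonneg le_sup_right hE0)
  obtain ⟨hfin, hell⟩ :=
    IsNonspecialAbove.finite_and_ell_pullback hK h hF he hw hE (hD₀.mono hDE) (hD₀.mono hD)
  refine ⟨D.pullback hF, fun Q => ?_, hfin, ?_⟩
  · rw [Divisor.pullback_apply]
    calc D' Q ≤ D (Q.under K) := (hD'A Q).trans (hAD _)
      _ ≤ e (Q.under K) * D (Q.under K) :=
        le_mul_of_one_le_left ((hA.trans hAD) _) (Nat.one_le_cast.2 (he _))
  · have hgD := (hD₀ D hD).2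
    have hgDE := (hD₀ _ hDE).2
    rw [Divisor.degree_sub] at hgDE
    rw [Divisor.degree_pullback, hell]
    push_cast
    linarith

end Genus

theorem valuation_eq_of_add_le_one {K Γ : Type*} [Field K] [LinearOrderedCommGroupWithZero Γ]
    {v : Valuation K Γ} {a b : K} (hb : 1 < v b) (hab : v (a + b) ≤ 1) : v a = v b := by
  rw [← v.map_sub_eq_of_lt_right (hab.trans_lt hb), add_sub_cancel_right]

section Stages

variable {k K : Type*} [Field k] [Field K] [Algebra k K] {P : Place k K} {r : ℕ} {y V V' W : K}

namespace Place

theorem IsParam.one_lt_v_of_inv (hV : P.IsParam V⁻¹) : 1 < P.v V := by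
  rw [← inv_lt_one₀ (by simpa using hV.v_pos), ← map_inv₀]
  exact hV.1

theorem IsParam.inv_of_add (hV : P.IsParam V⁻¹) (hVV' : P.v (V' + V) ≤ 1) : P.IsParam V'⁻¹ := by
  refine hV.congr ?_
  rw [map_inv₀, map_inv₀, valuation_eq_of_add_le_one hV.one_lt_v_of_inv hVV']

theorem v_eq_one_of_cyclotomic (hy : P.v (y ^ 2 + y + 1) < 1) : P.v y = 1 ∧ P.v (y + 1) = 1 := by
  have hmul : P.v (y * (y + 1)) = 1 := by
    rw [show y * (y + 1) = (y ^ 2 + y + 1) - 1 by ring,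
      P.v.map_sub_eq_of_lt_right (by rwa [map_one]), map_one]
  have hy_le : P.v y ≤ 1 := by
    rw [← valuation_sq_add_le_one_iff, show y ^ 2 + y = y * (y + 1) by ring, hmul]
  have hy1_le : P.v (y + 1) ≤ 1 := P.v.map_add_le hy_le P.v.map_one.le
  rw [map_mul] at hmul
  exact ⟨hy_le.antisymm (hmul.ge.trans (mul_le_of_le_one_right' hy1_le)),
    hy1_le.antisymm (hmul.ge.trans (mul_le_of_le_one_left' hy_le))⟩

theorem v_cyclotomic_lt_one_of_mul_sq_le_one (hW : 1 < P.v W)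
    (hyW : P.v ((y ^ 2 + y + 1) * W ^ 2) ≤ 1) : P.v (y ^ 2 + y + 1) < 1 := by
  by_contra! hy
  rw [map_mul, map_pow] at hyW
  exact (one_lt_pow₀ hW two_ne_zero).not_ge ((le_mul_of_one_le_left' hy).trans hyW)

theorem v_le_of_sq_add_le_one (hV : 1 < P.v V) (hW : P.v (W ^ 2 + W + V) ≤ 1) :
    P.v W ≤ P.v V := by
  rcases le_or_gt (P.v W) 1 with hW1 | hW1
  · exact hW1.trans hV.le
  · rw [← valuation_eq_of_add_le_one hV hW, valuation_sq_add_of_one_lt hW1]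
    exact le_self_pow₀ hW1.le two_ne_zero

theorem v_mul_sq_le_one_of_sq_add_le_one {a : K} (hV : 1 < P.v V) (haV : P.v (a * V ^ 2) ≤ 1)
    (hW : P.v (W ^ 2 + W + V) ≤ 1) : P.v (a * W ^ 2) ≤ 1 := by
  have hWV := v_le_of_sq_add_le_one hV hW
  calc P.v (a * W ^ 2) = P.v a * P.v W ^ 2 := by rw [map_mul, map_pow]
    _ ≤ P.v a * P.v V ^ 2 := by gcongr
    _ = P.v (a * V ^ 2) := by rw [map_mul, map_pow]
    _ ≤ 1 := haV

/-- `V` is, modulo regular functions, the start of a chain `V = V₀, V₁, …, V_r` in which `V_r` has a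
simple pole at `P` and `V_j = y_j (V_{j+1}² + V_{j+1})`. The `y_j` approximate primitive cube roots
of unity, so closely that `(y_j² + y_j + 1) V_{j+1}²` is regular. -/
def EvenStage (P : Place k K) : ℕ → K → Prop
  | 0, V => P.IsParam V⁻¹
  | r + 1, V => ∃ y W : K, P.v ((y ^ 2 + y + 1) * W ^ 2) ≤ 1 ∧
      P.v (V + y * (W ^ 2 + W)) ≤ 1 ∧ P.EvenStage r W

/-- The analogue of `Place.EvenStage` for chains with
`V_j = (y_j + 1) (V_{j+1}² + V_{j+1}) + V_{j+1}`. -/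
def OddStage (P : Place k K) : ℕ → K → Prop
  | 0, V => P.IsParam V⁻¹
  | r + 1, V => ∃ y W : K, P.v ((y ^ 2 + y + 1) * W ^ 2) ≤ 1 ∧
      P.v (V + ((y + 1) * (W ^ 2 + W) + W)) ≤ 1 ∧ P.OddStage r W

theorem EvenStage.one_lt_v (hV : P.EvenStage r V) : 1 < P.v V := by
  induction r generalizing V with
  | zero => exact IsParam.one_lt_v_of_inv hV
  | succ r ih =>
    obtain ⟨y, W, hyW, hVW, hW⟩ := hV
    have hW1 := ih hW
    have hy := (v_eq_one_of_cyclotomic (v_cyclotomic_lt_one_of_mul_sq_le_one hW1 hyW)).1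
    have hv : 1 < P.v (y * (W ^ 2 + W)) := by
      rw [map_mul, hy, one_mul, valuation_sq_add_of_one_lt hW1]
      exact one_lt_pow₀ hW1 two_ne_zero
    rwa [valuation_eq_of_add_le_one hv hVW]

theorem OddStage.one_lt_v (hV : P.OddStage r V) : 1 < P.v V := by
  induction r generalizing V with
  | zero => exact IsParam.one_lt_v_of_inv hV
  | succ r ih =>
    obtain ⟨y, W, hyW, hVW, hW⟩ := hV
    have hW1 := ih hW
    have hy := (v_eq_one_of_cyclotomic (v_cyclotomic_lt_one_of_mul_sq_le_one hW1 hyW)).2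
    have hlt : P.v W < P.v ((y + 1) * (W ^ 2 + W)) := by
      rw [map_mul, hy, one_mul, valuation_sq_add_of_one_lt hW1]
      exact lt_self_pow₀ hW1 one_lt_two
    have hv := P.v.map_add_eq_of_lt_left hlt
    rw [valuation_eq_of_add_le_one (hv ▸ hW1.trans hlt) hVW, hv]
    exact hW1.trans hlt

section CharTwo

variable [CharP K 2]

theorem v_add_le_one_trans (hV : P.v (V + V') ≤ 1) (hW : P.v (V' + W) ≤ 1) :
    P.v (V + W) ≤ 1 := by
  rw [show V + W = (V + V') + (V' + W) by
    linear_combination -V' * CharTwo.two_eq_zero (R := K)]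
  exact P.v.map_add_le hV hW

theorem EvenStage.of_add (hV : P.EvenStage r V) (hVV' : P.v (V' + V) ≤ 1) : P.EvenStage r V' := by
  cases r with
  | zero => exact IsParam.inv_of_add hV hVV'
  | succ r =>
    obtain ⟨y, W, hyW, hVW, hW⟩ := hV
    exact ⟨y, W, hyW, v_add_le_one_trans hVV' hVW, hW⟩

theorem OddStage.of_add (hV : P.OddStage r V) (hVV' : P.v (V' + V) ≤ 1) : P.OddStage r V' := by
  cases r with
  | zero => exact IsParam.inv_of_add hV hVV'
  | succ r =>
    obtain ⟨y, W, hyW, hVW, hW⟩ := hV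
    exact ⟨y, W, hyW, v_add_le_one_trans hVV' hVW, hW⟩

theorem v_even_reduction_le_one (hyW : P.v ((y ^ 2 + y + 1) * W ^ 2) ≤ 1)
    (hVW : P.v (V + y * (W ^ 2 + W)) ≤ 1) :
    P.v (V + (((y + 1) * W) ^ 2 + (y + 1) * W + W)) ≤ 1 := by
  rw [show V + (((y + 1) * W) ^ 2 + (y + 1) * W + W) =
      (V + y * (W ^ 2 + W)) + (y ^ 2 + y + 1) * W ^ 2 by
    linear_combination W * CharTwo.two_eq_zero (R := K)]
  exact P.v.map_add_le hVW hyW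

theorem v_odd_reduction_le_one (hyW : P.v ((y ^ 2 + y + 1) * W ^ 2) ≤ 1)
    (hVW : P.v (V + ((y + 1) * (W ^ 2 + W) + W)) ≤ 1) :
    P.v (V + ((y * W) ^ 2 + y * W)) ≤ 1 := by
  rw [show V + ((y * W) ^ 2 + y * W) =
      (V + ((y + 1) * (W ^ 2 + W) + W)) + (y ^ 2 + y + 1) * W ^ 2 by
    linear_combination -(y * W ^ 2 + W ^ 2 + W) * CharTwo.two_eq_zero (R := K)]
  exact P.v.map_add_le hVW hyW

theorem v_add_sq_add_le_one {T z : K} (hT : P.v (T ^ 2 + T + V) ≤ 1)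
    (hVz : P.v (V + (z ^ 2 + z + W)) ≤ 1) : P.v ((T + z) ^ 2 + (T + z) + W) ≤ 1 := by
  rw [show (T + z) ^ 2 + (T + z) + W = (T ^ 2 + T) + (z ^ 2 + z + W) by
    linear_combination T * z * CharTwo.two_eq_zero (R := K)]
  exact v_add_le_one_trans hT hVz

theorem EvenStage.exists_ramified (hV : P.EvenStage r V) :
    ∃ w : K, P.IsParam (V + (w ^ 2 + w))⁻¹ := by
  induction r generalizing V with
  | zero => exact ⟨0, by simpa [EvenStage] using hV⟩
  | succ r ih =>
    obtain ⟨y, W, hyW, hVW, hW⟩ := hV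
    obtain ⟨w, hw⟩ := ih hW
    refine ⟨(y + 1) * W + w, hw.inv_of_add ?_⟩
    rw [show V + (((y + 1) * W + w) ^ 2 + ((y + 1) * W + w)) + (W + (w ^ 2 + w)) =
        V + (((y + 1) * W) ^ 2 + (y + 1) * W + W) by
      linear_combination (w ^ 2 + w + (y + 1) * W * w) * CharTwo.two_eq_zero (R := K)]
    exact v_even_reduction_le_one hyW hVW

theorem OddStage.exists_unramified (hV : P.OddStage (r + 1) V) :
    ∃ w : K, P.v (V + (w ^ 2 + w)) ≤ 1 := by
  obtain ⟨y, W, hyW, hVW, -⟩ := hV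
  exact ⟨y * W, v_odd_reduction_le_one hyW hVW⟩

theorem OddStage.evenStage_mul (hV : P.OddStage r V)
    (hyV : P.v ((y ^ 2 + y + 1) * V ^ 2) ≤ 1) : P.EvenStage r (y * V) := by
  have hy := (v_eq_one_of_cyclotomic (v_cyclotomic_lt_one_of_mul_sq_le_one hV.one_lt_v hyV)).1
  induction r generalizing y V with
  | zero =>
    refine IsParam.congr hV ?_
    rw [map_inv₀, map_mul, hy, one_mul, map_inv₀]
  | succ r ih =>
    have hV1 := hV.one_lt_v
    obtain ⟨y', W, hyW, hVW, hW⟩ := hV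
    have hy' := (v_eq_one_of_cyclotomic (v_cyclotomic_lt_one_of_mul_sq_le_one hW.one_lt_v hyW)).1
    have hred := v_odd_reduction_le_one hyW hVW
    refine ⟨y, y' * W, v_mul_sq_le_one_of_sq_add_le_one hV1 hyV (by rwa [add_comm]), ?_,
      ih hW hyW hy'⟩
    rwa [← mul_add, map_mul, hy, one_mul]

end CharTwo

end Place

section Extension

variable {K' : Type*} [Field K'] [Algebra k K'] [Algebra K K'] [IsScalarTower k K K']
  [Algebra.IsAlgebraic K K'] {Q : Place k K'} {T : K'}

theorem Place.EvenStage.map (hV : P.EvenStage r V) (hQ : Q.under K = P)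
    (hpar : ∀ t, P.IsParam t → Q.IsParam (algebraMap K K' t)) :
    Q.EvenStage r (algebraMap K K' V) := by
  induction r generalizing V with
  | zero =>
    change Q.IsParam _
    rw [← map_inv₀]
    exact hpar _ hV
  | succ r ih =>
    obtain ⟨y, W, hyW, hVW, hW⟩ := hV
    refine ⟨algebraMap K K' y, algebraMap K K' W, ?_, ?_, ih hW⟩
    · simpa using (v_algebraMap_le_one_iff hQ).2 hyW
    · simpa using (v_algebraMap_le_one_iff hQ).2 hVW

variable {z : K'} {c : K}

theorem IsArtinSchreier.isParam_inv_of_ramified (h : IsArtinSchreier K z c) (hc : P.IsParam c⁻¹)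
    (hQ : Q.under K = P) (hV : P.IsParam V⁻¹) (hT : Q.v (T ^ 2 + T + algebraMap K K' V) ≤ 1) :
    Q.IsParam T⁻¹ := by
  have hVc : Q.v (algebraMap K K' V) = Q.v (algebraMap K K' c) := by
    rw [Place.v_algebraMap_eq_iff hQ]
    simpa using hc.v_eq hV
  have hz := h.one_lt_v_of_ramified hc hQ
  rw [← h.equation, valuation_sq_add_of_one_lt hz] at hVc
  have hz_sq : 1 < Q.v z ^ 2 := one_lt_pow₀ hz two_ne_zero
  have hT_sq : Q.v (T ^ 2 + T) = Q.v z ^ 2 := by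
    rw [valuation_eq_of_add_le_one (hVc ▸ hz_sq) hT, hVc]
  have hT1 : 1 < Q.v T := by
    rw [← not_le, ← valuation_sq_add_le_one_iff, hT_sq, not_le]
    exact hz_sq
  rw [valuation_sq_add_of_one_lt hT1] at hT_sq
  refine (h.isParam_of_ramified hc hQ).congr ?_
  rw [map_inv₀, map_inv₀, (pow_left_inj₀ zero_le zero_le two_ne_zero).1 hT_sq]

variable [CharP K 2]

theorem Place.EvenStage.oddStage (hV : P.EvenStage r V) (h : IsArtinSchreier K z c)
    (hc : P.IsParam c⁻¹) (hQ : Q.under K = P) (hT : Q.v (T ^ 2 + T + algebraMap K K' V) ≤ 1) :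
    Q.OddStage r T := by
  have := charP_of_injective_algebraMap (algebraMap K K').injective 2
  induction r generalizing V T with
  | zero => exact h.isParam_inv_of_ramified hc hQ hV hT
  | succ r ih =>
    obtain ⟨y, W, hyW, hVW, hW⟩ := hV
    have hW1 := hW.one_lt_v
    have hy := v_eq_one_of_cyclotomic (v_cyclotomic_lt_one_of_mul_sq_le_one hW1 hyW)
    have hred := (v_algebraMap_le_one_iff hQ).2 (v_even_reduction_le_one hyW hVW)
    set W' := T + algebraMap K K' ((y + 1) * W) with hW'
    have hWW' : Q.v (W' ^ 2 + W' + algebraMap K K' W) ≤ 1 :=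
      v_add_sq_add_le_one hT (by simpa only [map_add, map_pow] using hred)
    rw [← v_algebraMap_le_one_iff hQ] at hyW
    rw [← one_lt_v_algebraMap_iff hQ] at hW1
    refine ⟨algebraMap K K' y, W', ?_, ?_, ih hW hWW'⟩
    · exact v_mul_sq_le_one_of_sq_add_le_one hW1 (by simpa using hyW) hWW'
    · rw [show T + ((algebraMap K K' y + 1) * (W' ^ 2 + W') + W') =
          algebraMap K K' (y + 1) * (W' ^ 2 + W' + algebraMap K K' W) by
        simp only [hW', map_add, map_mul, map_one]
        linear_combination T * two_eq_zero_of_algebra K (K' := K'),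
        map_mul, (v_algebraMap_eq_one_iff hQ).2 hy.2, one_mul]
      exact hWW'

theorem Place.OddStage.evenStage (hV : P.OddStage (r + 1) V) (hQ : Q.under K = P)
    (hpar : ∀ t, P.IsParam t → Q.IsParam (algebraMap K K' t))
    (hT : Q.v (T ^ 2 + T + algebraMap K K' V) ≤ 1) : Q.EvenStage r T := by
  have := charP_of_injective_algebraMap (algebraMap K K').injective 2
  obtain ⟨y, W, hyW, hVW, hW⟩ := hV
  refine ((hW.evenStage_mul hyW).map hQ hpar).of_add ?_
  have hred := (v_algebraMap_le_one_iff hQ).2 (v_odd_reduction_le_one hyW hVW)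
  rw [← valuation_sq_add_le_one_iff, ← add_zero (_ + _)]
  exact v_add_sq_add_le_one hT (by simpa using hred)

end Extension

end Stages

section LinearEquivalence

variable {k K : Type*} [Field k] [Field K] [Algebra k K]

/-- Linear equivalence of divisors, with a function `f` of divisor `D - E` as witness. -/
def Divisor.IsLinearlyEquivalent (D E : Divisor k K) : Prop :=
  ∃ f : K, f ≠ 0 ∧ ∀ (P : Place k K) (t : K), P.IsParam t → P.v f = P.v t ^ (D P - E P)

namespace Divisor.IsLinearlyEquivalent

variable {D D' E E' : Divisor k K}

theorem refl (D : Divisor k K) : D.IsLinearlyEquivalent D :=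
  ⟨1, one_ne_zero, fun P t _ => by rw [map_one, sub_self, zpow_zero]⟩

theorem add (h : D.IsLinearlyEquivalent E) (h' : D'.IsLinearlyEquivalent E') :
    (D + D').IsLinearlyEquivalent (E + E') := by
  obtain ⟨f, hf, hfv⟩ := h
  obtain ⟨f', hf', hfv'⟩ := h'
  refine ⟨f * f', mul_ne_zero hf hf', fun P t ht => ?_⟩
  rw [map_mul, hfv P t ht, hfv' P t ht, ← zpow_add₀ ht.v_pos.ne', Finsupp.add_apply,
    Finsupp.add_apply, add_sub_add_comm]

theorem exists_map_eq (h : D.IsLinearlyEquivalent E) (hK : IsCurve k K) :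
    ∃ e : K ≃ₗ[k] K, D.riemannRochSpace.map e.toLinearMap = E.riemannRochSpace := by
  obtain ⟨f, hf, hfv⟩ := h
  choose t ht using hK.exists_isParam
  refine ⟨(LinearEquiv.smulOfNeZero K K f hf).restrictScalars k, ?_⟩
  ext g
  rw [Submodule.mem_map_equiv, mem_riemannRochSpace_iff ht, mem_riemannRochSpace_iff ht]
  refine forall_congr' fun P => ?_
  have hsymm : ((LinearEquiv.smulOfNeZero K K f hf).restrictScalars k).symm g = g / f :=
    (div_eq_inv_mul g f).symm
  rw [hsymm, Place.mem_polar, Place.mem_polar, map_div₀, hfv P (t P) (ht P),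
    zpow_sub₀ (ht P).v_pos.ne', div_div_eq_mul_div,
    div_mul_cancel₀ _ (zpow_ne_zero _ (ht P).v_pos.ne')]

end Divisor.IsLinearlyEquivalent

end LinearEquivalence

section RationalFunctionField

open Polynomial

variable {k K : Type*} [Field k] [Field K] [Algebra k K] {x : K} {p : k[X]} {P : Place k K}

namespace Place

theorem v_aeval_le_one (hx : P.v x ≤ 1) (q : k[X]) : P.v (aeval x q) ≤ 1 := by
  rw [aeval_eq_sum_range]
  refine P.v.map_sum_le fun i _ => ?_
  rw [Algebra.smul_def, map_mul, map_pow]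
  exact mul_le_one' (P.v_algebraMap_le_one _) (pow_le_one₀ zero_le hx)

theorem v_aeval_of_one_lt (hx : 1 < P.v x) (hp : p ≠ 0) :
    P.v (aeval x p) = P.v x ^ p.natDegree := by
  have : P.v.IsTrivialOn k := ⟨fun a ha => P.v_algebraMap_eq_one ha⟩
  exact valuation_aeval_eq_valuation_X_pow_natDegree_of_one_lt_valuation_X x hx hp

theorem v_aeval_eq_one_of_isUnit (hp : IsUnit p) : P.v (aeval x p) = 1 := by
  obtain ⟨c, hc, rfl⟩ := Polynomial.isUnit_iff.1 hp
  rw [aeval_C, P.v_algebraMap_eq_one hc.ne_zero]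

theorem exists_v_aeval_lt_one (hx : Transcendental k x) (hp0 : p ≠ 0) (hp : ¬ IsUnit p) :
    ∃ P : Place k K, P.v x ≤ 1 ∧ P.v (aeval x p) < 1 := by
  let A : Subring K := (aeval x : k[X] →ₐ[k] K).toRingHom.range
  have hA (q : k[X]) : aeval x q ∈ A := ⟨q, rfl⟩
  let I : Ideal A := Ideal.span {⟨aeval x p, hA p⟩}
  have hinj := transcendental_iff_injective.1 hx
  have hI : I ≠ ⊤ := by
    rw [Ideal.ne_top_iff_one, Ideal.mem_span_singleton]
    rintro ⟨⟨_, q, rfl⟩, hq⟩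
    have hpq : aeval x (p * q) = aeval x (1 : k[X]) := by
      rw [map_mul, map_one]
      exact (congrArg Subtype.val hq).symm
    exact hp (IsUnit.of_mul_eq_one q (hinj hpq))
  obtain ⟨V, hAV, hIV⟩ := I.image_subset_nonunits_valuationSubring hI
  have hlt : V.valuation (aeval x p) < 1 :=
    V.mem_nonunits_iff.1 (hIV ⟨⟨aeval x p, hA p⟩, Ideal.mem_span_singleton_self _, rfl⟩)
  refine ⟨⟨V, fun a => hAV (by simpa using hA (C a)), fun hV => ?_⟩,
    (V.valuation_le_one_iff x).2 (hAV (by simpa using hA X)), hlt⟩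
  have hinv : V.valuation (aeval x p)⁻¹ ≤ 1 := by
    rw [V.valuation_le_one_iff, hV]
    exact ValuationSubring.mem_top _
  have hne : V.valuation (aeval x p) ≠ 0 := by
    rwa [Ne, map_eq_zero, map_eq_zero_iff _ hinj]
  rw [map_inv₀, inv_le_one₀ (zero_lt_iff.2 hne)] at hinv
  exact hlt.not_ge hinv

/-- `P` is the closed point of the affine line with coordinate `x` at which the irreducible
polynomial `p` vanishes. -/
structure IsZeroOf (P : Place k K) (x : K) (p : k[X]) : Prop where
  irreducible : Irreducible p
  v_le_one : P.v x ≤ 1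
  v_aeval_lt_one_iff : ∀ q, P.v (aeval x q) < 1 ↔ p ∣ q

theorem IsZeroOf.v_aeval_eq_one (h : P.IsZeroOf x p) {q : k[X]} (hq : ¬ p ∣ q) :
    P.v (aeval x q) = 1 :=
  (v_aeval_le_one h.v_le_one q).eq_of_not_lt fun hlt => hq ((h.v_aeval_lt_one_iff q).1 hlt)

theorem coe_aeval (hx : x ∈ P.ring) (q : k[X]) :
    ((aeval (⟨x, hx⟩ : P.ring) q : P.ring) : K) = aeval x q :=
  have : IsScalarTower k P.ring K := IsScalarTower.of_algebraMap_eq fun _ => rfl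
  (Polynomial.aeval_algebraMap_apply K (⟨x, hx⟩ : P.ring) q).symm

end Place

/-- `K` is the rational function field in the variable `x`. -/
structure IsCoordinate (k : Type*) {K : Type*} [Field k] [Field K] [Algebra k K] (x : K) :
    Prop where
  transcendental : Transcendental k x
  adjoin_eq_top : IntermediateField.adjoin k {x} = ⊤

namespace IsCoordinate

theorem ne_zero (h : IsCoordinate k x) : x ≠ 0 := by
  rintro rfl
  exact h.transcendental isAlgebraic_zero

theorem inv (h : IsCoordinate k x) : IsCoordinate k x⁻¹ where
  transcendental := fun ha => h.transcendental (by simpa using ha.inv)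
  adjoin_eq_top := by
    rw [eq_top_iff, ← h.adjoin_eq_top, IntermediateField.adjoin_simple_le_iff]
    simpa using inv_mem (IntermediateField.mem_adjoin_simple_self k x⁻¹)

theorem aeval_ne_zero (h : IsCoordinate k x) (hp : p ≠ 0) : aeval x p ≠ 0 := by
  rwa [Ne, map_eq_zero_iff _ (transcendental_iff_injective.1 h.transcendental)]

theorem exists_isCoprime_div (h : IsCoordinate k x) (f : K) :
    ∃ r s : k[X], IsCoprime r s ∧ s ≠ 0 ∧ f = aeval x r / aeval x s := by
  obtain ⟨r, s, rfl⟩ := (IntermediateField.mem_adjoin_simple_iff k f).1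
    (by rw [h.adjoin_eq_top]; trivial)
  rcases eq_or_ne s 0 with rfl | hs
  · exact ⟨0, 1, isCoprime_one_right, one_ne_zero, by simp⟩
  obtain ⟨r', s', d, hrs, rfl, rfl⟩ := UniqueFactorizationMonoid.exists_reduced_factors' r s hs
  refine ⟨r', s', hrs.isCoprime, right_ne_zero_of_mul hs, ?_⟩
  rw [map_mul, map_mul, mul_div_mul_left _ _ (h.aeval_ne_zero (left_ne_zero_of_mul hs))]

theorem exists_isZeroOf_of_v_le_one (h : IsCoordinate k x) (hP : P.v x ≤ 1) :
    ∃ p, P.IsZeroOf x p := by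
  have hx : x ∈ P.ring := Place.mem_ring_iff.2 hP
  let I : Ideal k[X] := (maximalIdeal P.ring).comap (aeval (⟨x, hx⟩ : P.ring))
  have hI_iff (q : k[X]) : q ∈ I ↔ P.v (aeval x q) < 1 := by
    rw [← Place.coe_aeval hx]
    exact Place.mem_maximalIdeal_iff
  have hI : I ≠ ⊥ := by
    intro hbot
    obtain ⟨f, hf⟩ := P.exists_one_lt_v
    obtain ⟨r, s, -, hs, rfl⟩ := h.exists_isCoprime_div f
    have hvs : P.v (aeval x s) = 1 :=
      (Place.v_aeval_le_one hP s).eq_of_not_lt fun hlt => hs (by rwa [← hI_iff, hbot] at hlt)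
    rw [map_div₀, hvs, div_one] at hf
    exact hf.not_ge (Place.v_aeval_le_one hP r)
  refine ⟨Submodule.IsPrincipal.generator I,
    (Submodule.IsPrincipal.prime_generator_of_isPrime I hI).irreducible, hP, fun q => ?_⟩
  rw [← Submodule.IsPrincipal.mem_iff_generator_dvd, hI_iff]

theorem isZeroOf_iff (h : IsCoordinate k x) (hp : Irreducible p) :
    P.IsZeroOf x p ↔ P.v x ≤ 1 ∧ P.v (aeval x p) < 1 := by
  refine ⟨fun hP => ⟨hP.v_le_one, (hP.v_aeval_lt_one_iff p).2 dvd_rfl⟩, fun ⟨hx, hlt⟩ => ?_⟩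
  obtain ⟨p', hP⟩ := h.exists_isZeroOf_of_v_le_one hx
  rw [hP.v_aeval_lt_one_iff] at hlt
  refine ⟨hp, hx, fun q => ?_⟩
  rw [hP.v_aeval_lt_one_iff, (hP.irreducible.associated_of_dvd hp hlt).dvd_iff_dvd_left]

theorem exists_isZeroOf (h : IsCoordinate k x) (hp : Irreducible p) :
    ∃ P : Place k K, P.IsZeroOf x p := by
  obtain ⟨P, hP⟩ := Place.exists_v_aeval_lt_one h.transcendental hp.ne_zero hp.not_isUnit
  exact ⟨P, (h.isZeroOf_iff hp).2 hP⟩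

theorem isZeroOf_inv_X_iff (h : IsCoordinate k x) : P.IsZeroOf x⁻¹ X ↔ 1 < P.v x := by
  rw [h.inv.isZeroOf_iff irreducible_X, aeval_X, and_iff_right_of_imp le_of_lt, map_inv₀,
    inv_lt_one₀ (by simpa [zero_lt_iff] using h.ne_zero)]

theorem exists_isCoordinate_isZeroOf (h : IsCoordinate k x) (P : Place k K) :
    ∃ (y : K) (p : k[X]), IsCoordinate k y ∧ P.IsZeroOf y p := by
  rcases le_or_gt (P.v x) 1 with hP | hP
  · obtain ⟨p, hp⟩ := h.exists_isZeroOf_of_v_le_one hP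
    exact ⟨x, p, h, hp⟩
  · exact ⟨x⁻¹, X, h.inv, h.isZeroOf_inv_X_iff.2 hP⟩

theorem isParam_of_isZeroOf (h : IsCoordinate k x) (hP : P.IsZeroOf x p) :
    P.IsParam (aeval x p) := by
  have hpow (q : k[X]) (hq : q ≠ 0) : ∃ n : ℕ, P.v (aeval x q) = P.v (aeval x p) ^ n := by
    obtain ⟨q', hq', hdvd⟩ :=
      (FiniteMultiplicity.of_prime_left hP.irreducible.prime hq).exists_eq_pow_mul_and_not_dvd
    refine ⟨multiplicity p q, ?_⟩
    conv_lhs => rw [hq', map_mul, map_pow, map_mul, map_pow, hP.v_aeval_eq_one hdvd, mul_one]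
  refine ⟨(hP.v_aeval_lt_one_iff p).2 dvd_rfl, fun f hf => ?_⟩
  obtain ⟨r, s, -, hs, rfl⟩ := h.exists_isCoprime_div f
  obtain ⟨m, hm⟩ := hpow r (by rintro rfl; simp at hf)
  obtain ⟨n, hn⟩ := hpow s hs
  refine ⟨m - n, ?_⟩
  have hp0 : P.v (aeval x p) ≠ 0 :=
    (_root_.map_ne_zero _).2 (h.aeval_ne_zero hP.irreducible.ne_zero)
  rw [map_div₀, hm, hn, zpow_sub₀ hp0, zpow_natCast, zpow_natCast]

theorem exists_not_dvd_div (h : IsCoordinate k x) (hP : P.IsZeroOf x p) {f : K} (hf : P.v f ≤ 1) :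
    ∃ r s : k[X], ¬ p ∣ s ∧ f = aeval x r / aeval x s := by
  obtain ⟨r, s, hrs, hs, rfl⟩ := h.exists_isCoprime_div f
  refine ⟨r, s, fun hps => hf.not_gt ?_, rfl⟩
  have hpr : ¬ p ∣ r := fun hpr => hP.irreducible.not_isUnit (hrs.isUnit_of_dvd' hpr hps)
  rw [map_div₀, hP.v_aeval_eq_one hpr, one_div,
    one_lt_inv₀ (zero_lt_iff.2 ((_root_.map_ne_zero _).2 (h.aeval_ne_zero hs)))]
  exact (hP.v_aeval_lt_one_iff s).2 hps

theorem eq_of_isZeroOf (h : IsCoordinate k x) {P' : Place k K} (hP : P.IsZeroOf x p)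
    (hP' : P'.IsZeroOf x p) : P = P' := by
  have hle {P P' : Place k K} (hP : P.IsZeroOf x p) (hP' : P'.IsZeroOf x p) :
      P.ring ≤ P'.ring := by
    intro f hf
    obtain ⟨r, s, hs, rfl⟩ := h.exists_not_dvd_div hP (Place.mem_ring_iff.1 hf)
    rw [Place.mem_ring_iff, map_div₀, hP'.v_aeval_eq_one hs, div_one]
    exact Place.v_aeval_le_one hP'.v_le_one r
  exact Place.ext (le_antisymm (hle hP hP') (hle hP' hP))

theorem exists_v_sub_aeval_lt_one (h : IsCoordinate k x) (hP : P.IsZeroOf x p) {f : K}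
    (hf : P.v f ≤ 1) : ∃ q : k[X], P.v (f - aeval x q) < 1 := by
  obtain ⟨r, s, hs, rfl⟩ := h.exists_not_dvd_div hP hf
  obtain ⟨a, b, hab⟩ : IsCoprime p s := hP.irreducible.coprime_iff_not_dvd.2 hs
  have hs0 : aeval x s ≠ 0 := h.aeval_ne_zero fun h0 => hs (h0 ▸ dvd_zero p)
  refine ⟨r * b, ?_⟩
  have hdiff : aeval x r / aeval x s - aeval x (r * b) = aeval x (r * a * p) / aeval x s := by
    rw [eq_div_iff hs0, sub_mul, div_mul_cancel₀ _ hs0, ← map_mul, ← map_sub]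
    congr 1
    linear_combination -r * hab
  rw [hdiff, map_div₀, hP.v_aeval_eq_one hs, div_one, hP.v_aeval_lt_one_iff]
  exact dvd_mul_left p _

theorem finite_and_degree_of_isZeroOf (h : IsCoordinate k x) (hP : P.IsZeroOf x p) :
    Module.Finite k (ResidueField P.ring) ∧ P.degree = p.natDegree := by
  have hx := Place.mem_ring_iff.2 hP.v_le_one
  let φ : k[X] →ₐ[k] ResidueField P.ring := aeval (residue P.ring ⟨x, hx⟩)
  have hφ (q : k[X]) : φ q = residue P.ring (aeval ⟨x, hx⟩ q) :=
    Polynomial.aeval_algebraMap_apply (ResidueField P.ring) (⟨x, hx⟩ : P.ring) q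
  have hsurj : Function.Surjective φ := by
    intro c
    obtain ⟨f, rfl⟩ := residue_surjective c
    obtain ⟨q, hq⟩ := h.exists_v_sub_aeval_lt_one hP (P.ring.valuation_le_one f)
    refine ⟨q, ?_⟩
    rw [hφ, eq_comm, Place.residue_eq_iff, Place.coe_aeval]
    exact hq
  have hker : RingHom.ker φ = Ideal.span {p} := by
    ext q
    rw [RingHom.mem_ker, hφ, Place.residue_eq_zero_iff, Place.coe_aeval, hP.v_aeval_lt_one_iff,
      Ideal.mem_span_singleton]
  have e : (k[X] ⧸ Ideal.span {p}) ≃ₗ[k] ResidueField P.ring :=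
    ((Ideal.quotientEquivAlgOfEq k hker.symm).trans
      (Ideal.quotientKerAlgEquivOfSurjective hsurj)).toLinearEquiv
  have hdeg : Module.finrank k (k[X] ⧸ Ideal.span {p}) = p.natDegree :=
    finrank_quotient_span_eq_natDegree
  have hfin : Module.Finite k (k[X] ⧸ Ideal.span {p}) :=
    Module.finite_of_finrank_pos (by rw [hdeg]; exact hP.irreducible.natDegree_pos)
  exact ⟨Module.Finite.equiv e, by rw [Place.degree, ← e.finrank_eq, hdeg]⟩

theorem finite_setOf_v_aeval_lt_one (h : IsCoordinate k x) {s : k[X]} (hs : s ≠ 0) :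
    {P : Place k K | P.v x ≤ 1 ∧ P.v (aeval x s) < 1}.Finite := by
  induction s using WfDvdMonoid.induction_on_irreducible with
  | zero => exact absurd rfl hs
  | unit s hu =>
    exact Set.finite_empty.subset fun P hP => (Place.v_aeval_eq_one_of_isUnit hu).not_lt hP.2
  | mul s q hs0 hq ih =>
    obtain ⟨P₀, hP₀⟩ := h.exists_isZeroOf hq
    refine ((Set.finite_singleton P₀).union (ih hs0)).subset fun P ⟨hx, hlt⟩ => ?_
    rw [map_mul, map_mul] at hlt
    by_cases hPq : P.v (aeval x q) < 1
    · exact .inl (h.eq_of_isZeroOf ((h.isZeroOf_iff hq).2 ⟨hx, hPq⟩) hP₀)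
    · rw [(Place.v_aeval_le_one hx q).eq_of_not_lt hPq, one_mul] at hlt
      exact .inr ⟨hx, hlt⟩

theorem isCurve (h : IsCoordinate k x) : IsCurve k K where
  exists_isParam P := by
    obtain ⟨y, p, hy, hP⟩ := h.exists_isCoordinate_isZeroOf P
    exact ⟨_, hy.isParam_of_isZeroOf hP⟩
  finite_residueField P := by
    obtain ⟨y, p, hy, hP⟩ := h.exists_isCoordinate_isZeroOf P
    exact (hy.finite_and_degree_of_isZeroOf hP).1
  finite_poles f := by
    obtain ⟨r, s, -, hs, rfl⟩ := h.exists_isCoprime_div f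
    obtain ⟨P₀, hP₀⟩ := h.inv.exists_isZeroOf irreducible_X
    refine ((Set.finite_singleton P₀).union (h.finite_setOf_v_aeval_lt_one hs)).subset
      fun P hP => ?_
    rcases lt_or_ge 1 (P.v x) with hx | hx
    · exact .inl (h.inv.eq_of_isZeroOf (h.isZeroOf_inv_X_iff.2 hx) hP₀)
    · refine .inr ⟨hx, lt_of_not_ge fun hle => hP ?_⟩
      rw [Place.mem_ring_iff, map_div₀, (Place.v_aeval_le_one hx s).antisymm hle, div_one]
      exact Place.v_aeval_le_one hx r

theorem exists_eq_aeval (h : IsCoordinate k x) {f : K}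
    (hf : ∀ P : Place k K, P.v x ≤ 1 → P.v f ≤ 1) : ∃ q : k[X], f = aeval x q := by
  obtain ⟨r, s, hrs, hs, rfl⟩ := h.exists_isCoprime_div f
  have hunit : IsUnit s := by
    by_contra hunit
    obtain ⟨p, hp, hps⟩ := WfDvdMonoid.exists_irreducible_factor hunit hs
    obtain ⟨P, hP⟩ := h.exists_isZeroOf hp
    have hpr : ¬ p ∣ r := fun hpr => hp.not_isUnit (hrs.isUnit_of_dvd' hpr hps)
    refine (hf P hP.v_le_one).not_gt ?_
    rw [map_div₀, hP.v_aeval_eq_one hpr, one_div,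
      one_lt_inv₀ (zero_lt_iff.2 ((_root_.map_ne_zero _).2 (h.aeval_ne_zero hs)))]
    exact (hP.v_aeval_lt_one_iff s).2 hps
  obtain ⟨c, -, rfl⟩ := Polynomial.isUnit_iff.1 hunit
  refine ⟨r * C c⁻¹, ?_⟩
  rw [map_mul, aeval_C, aeval_C, map_inv₀, div_eq_mul_inv]

section Infinity

variable (hP : 1 < P.v x)

include hP

theorem isParam_inv (h : IsCoordinate k x) : P.IsParam x⁻¹ := by
  simpa only [aeval_X] using h.inv.isParam_of_isZeroOf (h.isZeroOf_inv_X_iff.2 hP)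

theorem degree_eq_one (h : IsCoordinate k x) : P.degree = 1 := by
  rw [(h.inv.finite_and_degree_of_isZeroOf (h.isZeroOf_inv_X_iff.2 hP)).2, natDegree_X]

theorem one_lt_v_iff (h : IsCoordinate k x) {Q : Place k K} : 1 < Q.v x ↔ Q = P := by
  refine ⟨fun hQ => ?_, fun hQ => hQ ▸ hP⟩
  exact h.inv.eq_of_isZeroOf (h.isZeroOf_inv_X_iff.2 hQ) (h.isZeroOf_inv_X_iff.2 hP)

theorem isLinearlyEquivalent (h : IsCoordinate k x) (D : Divisor k K) :
    D.IsLinearlyEquivalent (Finsupp.single P D.degree) := by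
  induction D using Finsupp.induction_linear with
  | zero => simpa [Divisor.degree_zero] using Divisor.IsLinearlyEquivalent.refl (0 : Divisor k K)
  | add D D' hD hD' =>
    rw [Divisor.degree_add, Finsupp.single_add]
    exact hD.add hD'
  | single Q n =>
    rw [Divisor.degree_single]
    rcases lt_or_ge 1 (Q.v x) with hQ | hQ
    · rw [h.degree_eq_one hQ, (h.one_lt_v_iff hP).1 hQ, Nat.cast_one, mul_one]
      exact .refl _
    obtain ⟨p, hp⟩ := h.exists_isZeroOf_of_v_le_one hQ
    have hPQ : P ≠ Q := fun hPQ => hQ.not_gt (hPQ ▸ hP)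
    have hp0 := hp.irreducible.ne_zero
    refine ⟨aeval x p ^ n, zpow_ne_zero _ (h.aeval_ne_zero hp0), fun R t ht => ?_⟩
    rw [map_zpow₀]
    rcases lt_or_ge 1 (R.v x) with hR | hR
    · obtain rfl := (h.one_lt_v_iff hP).1 hR
      rw [Finsupp.single_eq_of_ne hPQ, Finsupp.single_eq_same, (h.isParam_inv hP).v_eq ht, map_inv₀,
        inv_zpow', Place.v_aeval_of_one_lt hP hp0,
        (h.finite_and_degree_of_isZeroOf hp).2, ← zpow_natCast, ← zpow_mul]
      congr 1
      ring
    have hRP : R ≠ P := fun hRP => hR.not_gt (hRP ▸ hP)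
    rw [Finsupp.single_eq_of_ne hRP, sub_zero]
    rcases eq_or_ne R Q with rfl | hRQ
    · rw [Finsupp.single_eq_same, (h.isParam_of_isZeroOf hp).v_eq ht]
    · have hRp : R.v (aeval x p) = 1 := (Place.v_aeval_le_one hR p).eq_of_not_lt fun hlt =>
        hRQ (h.eq_of_isZeroOf ((h.isZeroOf_iff hp.irreducible).2 ⟨hR, hlt⟩) hp)
      rw [Finsupp.single_eq_of_ne hRQ, zpow_zero, hRp, one_zpow]

theorem riemannRochSpace_single (h : IsCoordinate k x) (n : ℕ) :
    Divisor.riemannRochSpace (Finsupp.single P (n : ℤ)) =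
      (degreeLT k (n + 1)).map (aeval x).toLinearMap := by
  choose t ht using h.isCurve.exists_isParam
  have hfinite {Q : Place k K} (hQ : Q ≠ P) (f : K) :
      f ∈ Q.polar (t Q) (Finsupp.single P (n : ℤ) Q) ↔ Q.v f ≤ 1 := by
    rw [Finsupp.single_eq_of_ne hQ, Place.mem_polar, zpow_zero, mul_one]
  have hinfty (f : K) :
      f ∈ P.polar (t P) (Finsupp.single P (n : ℤ) P) ↔ P.v f ≤ P.v x ^ n := by
    rw [Finsupp.single_eq_same, Place.mem_polar, (h.isParam_inv hP).v_eq (ht P),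
      map_inv₀, zpow_natCast, inv_pow, mul_inv_le_iff₀ (pow_pos (zero_lt_one.trans hP) n), one_mul]
  ext f
  simp only [Divisor.mem_riemannRochSpace_iff ht, Submodule.mem_map, mem_degreeLT]
  constructor
  · intro hf
    obtain ⟨q, rfl⟩ := h.exists_eq_aeval fun Q hQ =>
      (hfinite (by rintro rfl; exact hQ.not_gt hP) f).1 (hf Q)
    refine ⟨q, ?_, rfl⟩
    rcases eq_or_ne q 0 with rfl | hq
    · simp
    have hdeg := (hinfty _).1 (hf P)
    rw [Place.v_aeval_of_one_lt hP hq, pow_le_pow_iff_right₀ hP] at hdeg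
    rw [degree_eq_natDegree hq]
    exact_mod_cast Nat.lt_succ_of_le hdeg
  · rintro ⟨q, hq, rfl⟩ Q
    rcases eq_or_ne Q P with rfl | hQ
    · refine (hinfty _).2 ?_
      rcases eq_or_ne q 0 with rfl | hq0
      · simp
      refine (Place.v_aeval_of_one_lt hP hq0).trans_le (pow_le_pow_right₀ hP.le ?_)
      exact Nat.lt_succ_iff.1 ((natDegree_lt_iff_degree_lt hq0).2 hq)
    · refine (hfinite hQ _).2 (Place.v_aeval_le_one (le_of_not_gt fun hx => hQ ?_) q)
      exact (h.one_lt_v_iff hP).1 hx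

theorem finite_and_ell_single (h : IsCoordinate k x) (n : ℕ) :
    Module.Finite k (Divisor.riemannRochSpace (Finsupp.single P (n : ℤ))) ∧
      Divisor.ell (Finsupp.single P (n : ℤ)) = n + 1 := by
  let e := (degreeLTEquiv k (n + 1)).symm.trans (Submodule.equivMapOfInjective
    (aeval x).toLinearMap (transcendental_iff_injective.1 h.transcendental) _)
  rw [Divisor.ell, h.riemannRochSpace_single hP]
  exact ⟨Module.Finite.equiv e, by rw [← e.finrank_eq, Module.finrank_fin_fun]⟩

end Infinity

theorem hasGenus (h : IsCoordinate k x) : HasGenus k K 0 := by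
  obtain ⟨P, hP⟩ := h.inv.exists_isZeroOf irreducible_X
  rw [h.isZeroOf_inv_X_iff] at hP
  intro D
  let D' : Divisor k K := D + Finsupp.single P (D.degree.natAbs : ℤ)
  obtain ⟨n, hn⟩ : ∃ n : ℕ, D'.degree = n := Int.eq_ofNat_of_zero_le (by
    rw [Divisor.degree_add, Divisor.degree_single, h.degree_eq_one hP]
    lia)
  obtain ⟨e, he⟩ := (h.isLinearlyEquivalent hP D').exists_map_eq h.isCurve
  obtain ⟨hfin, hell⟩ := h.finite_and_ell_single hP n
  rw [← hn, ← he] at hfin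
  rw [← hn, Divisor.ell, ← he, LinearEquiv.finrank_map_eq] at hell
  refine ⟨D', le_add_of_nonneg_right (single_natCast_nonneg P _),
    Module.Finite.equiv (e.submoduleMap _).symm, ?_⟩
  rw [Divisor.ell, hell]
  lia

end IsCoordinate

end RationalFunctionField

section DegreeSums

variable {k K : Type*} [Field k] [Field K] [Algebra k K] {S T : Set (Place k K)} {m n : ℕ}

/-- `S` is a finite set of points of total degree `n`. -/
def HasDegree (S : Set (Place k K)) (n : ℕ) : Prop :=
  S.Finite ∧ ∑ᶠ P ∈ S, P.degree = n

theorem hasDegree_singleton (P : Place k K) : HasDegree {P} P.degree :=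
  ⟨Set.finite_singleton P, finsum_mem_singleton⟩

theorem HasDegree.nonempty (h : HasDegree S n) (hn : n ≠ 0) : S.Nonempty := by
  rw [Set.nonempty_iff_ne_empty]
  rintro rfl
  exact hn (h.2.symm.trans finsum_mem_empty)

theorem HasDegree.union (hS : HasDegree S m) (hT : HasDegree T n) (hST : Disjoint S T) :
    HasDegree (S ∪ T) (m + n) :=
  ⟨hS.1.union hT.1, by rw [finsum_mem_union hST hS.1 hT.1, hS.2, hT.2]⟩

theorem HasDegree.biUnion {ι : Type*} {I : Finset ι} {S : ι → Set (Place k K)} {d : ι → ℕ}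
    (hS : ∀ i ∈ I, HasDegree (S i) (d i)) (hdisj : (I : Set ι).PairwiseDisjoint S) :
    HasDegree (⋃ i ∈ I, S i) (∑ i ∈ I, d i) := by
  refine ⟨I.finite_toSet.biUnion fun i hi => (hS i hi).1, ?_⟩
  rw [← finsum_mem_coe_finset]
  exact (finsum_mem_biUnion hdisj I.finite_toSet fun i hi => (hS i hi).1).trans
    (finsum_mem_congr rfl fun i hi => (hS i hi).2)

theorem HasDegree.exists_divisor (h : HasDegree S n) :
    ∃ E : Divisor k K, ⇑E = S.indicator 1 ∧ E.degree = n := by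
  obtain ⟨hfin, rfl⟩ := h
  let E : Divisor k K :=
    Finsupp.ofSupportFinite (S.indicator 1) (hfin.subset Set.support_indicator_subset)
  refine ⟨E, rfl, ?_⟩
  have hsupp : E.support ⊆ hfin.toFinset := fun P hP =>
    hfin.mem_toFinset.2 (Set.mem_of_indicator_ne_zero (Finsupp.mem_support_iff.1 hP))
  rw [finsum_mem_eq_finite_toFinset_sum _ hfin, Nat.cast_sum]
  refine (Finsupp.sum_of_support_subset E hsupp (fun P n => n * (P.degree : ℤ))
    fun P _ => zero_mul _).trans ?_
  refine Finset.sum_congr rfl fun P hP => ?_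
  have hEP : E P = 1 := Set.indicator_of_mem (hfin.mem_toFinset.1 hP) _
  rw [hEP, one_mul]

variable {K' : Type*} [Field K'] [Algebra k K'] [Algebra K K'] [IsScalarTower k K K']
  [Algebra.IsAlgebraic K K']

theorem HasDegree.of_under (hS : HasDegree S n) {T : Set (Place k K')}
    (hT : ∀ Q ∈ T, Q.under K ∈ S)
    (hfib : ∀ P ∈ S, HasDegree {Q ∈ T | Q.under K = P} (m * P.degree)) :
    HasDegree T (m * n) := by
  obtain ⟨hfin, rfl⟩ := hS
  have hunion : T = ⋃ P ∈ hfin.toFinset, {Q ∈ T | Q.under K = P} := by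
    ext Q
    simp only [Set.mem_iUnion, Set.Finite.mem_toFinset]
    exact ⟨fun hQ => ⟨_, hT Q hQ, hQ, rfl⟩, fun ⟨_, _, hQ, _⟩ => hQ⟩
  rw [hunion, finsum_mem_eq_finite_toFinset_sum _ hfin, Finset.mul_sum]
  refine HasDegree.biUnion (fun P hP => hfib P (hfin.mem_toFinset.1 hP)) fun P _ P' _ hne => ?_
  exact Set.disjoint_left.2 fun Q ⟨_, hQ⟩ ⟨_, hQ'⟩ => hne (hQ.symm.trans hQ')

theorem HasDegree.preimage_under (hS : HasDegree S n)
    (hfib : ∀ P ∈ S, HasDegree {Q : Place k K' | Q.under K = P} (m * P.degree)) :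
    HasDegree {Q : Place k K' | Q.under K ∈ S} (m * n) := by
  refine hS.of_under (fun _ hQ => hQ) fun P hP => ?_
  have hfiber : {Q ∈ {Q : Place k K' | Q.under K ∈ S} | Q.under K = P} = {Q | Q.under K = P} :=
    Set.ext fun Q => and_iff_right_of_imp fun hQ => Set.mem_ofPred.2 (hQ ▸ hP)
  exact hfiber ▸ hfib P hP

theorem IsFiber.hasDegree {P : Place k K} {z : K'} {e : ℕ} (h : IsFiber P z e) (hem : e * m = 2) :
    HasDegree {Q : Place k K' | Q.under K = P} (m * P.degree) := by
  obtain ⟨F, hF, hdeg⟩ := h.exists_finset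
  have hcoe : {Q : Place k K' | Q.under K = P} = F := Set.ext fun Q => (hF Q).symm
  have he : 0 < e := Nat.pos_of_ne_zero fun he => by simp [he] at hem
  rw [hcoe]
  refine ⟨F.finite_toSet, ?_⟩
  rw [finsum_mem_coe_finset]
  exact Nat.eq_of_mul_eq_mul_left he (by rw [hdeg, ← hem, mul_assoc])

end DegreeSums

section Values

/-- The right-hand side `x_j + 1 + 1 / x_j` of the equation of the next generator. -/
def towerStep {K : Type*} [Field K] (x : K) : K := x + 1 + 1 / x

theorem map_towerStep {K K' : Type*} [Field K] [Field K'] (f : K →+* K') (x : K) :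
    f (towerStep x) = towerStep (f x) := by
  simp [towerStep]

variable {k K : Type*} [Field k] [Field K] [Algebra k K] {P : Place k K} {x : K}

namespace Place

theorem v_eq_one_of_v_add_one_lt_one (h : P.v (x + 1) < 1) : P.v x = 1 := by
  rw [← add_sub_cancel_right x 1, P.v.map_sub_eq_of_lt_right (by rwa [map_one]), map_one]

theorem v_towerStep_le_one (hx : P.v x = 1) : P.v (towerStep x) ≤ 1 := by
  refine P.v.map_add_le (P.v.map_add_le hx.le P.v.map_one.le) ?_
  rw [one_div, map_inv₀, hx, inv_one]

section

variable [CharP K 2]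

theorem v_towerStep_add_le_one_of_one_lt (hx : 1 < P.v x) : P.v (towerStep x + x) ≤ 1 := by
  have hsum : towerStep x + x = 1 + x⁻¹ := by
    rw [towerStep]
    linear_combination x * CharTwo.two_eq_zero (R := K)
  rw [hsum]
  refine P.v.map_add_le P.v.map_one.le ?_
  rw [map_inv₀]
  exact inv_le_one_of_one_le₀ hx.le

theorem v_towerStep_add_inv_le_one_of_lt_one (hx : P.v x < 1) : P.v (towerStep x + x⁻¹) ≤ 1 := by
  have hsum : towerStep x + x⁻¹ = x + 1 := by
    rw [towerStep]
    linear_combination x⁻¹ * CharTwo.two_eq_zero (R := K)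
  rw [hsum]
  exact P.v.map_add_le hx.le P.v.map_one.le

theorem one_lt_v_towerStep (hx0 : x ≠ 0) (hx : P.v x ≠ 1) : 1 < P.v (towerStep x) := by
  rcases lt_or_gt_of_ne hx with hlt | hgt
  · have hinv : 1 < P.v x⁻¹ := by
      rw [map_inv₀]
      exact (one_lt_inv₀ (zero_lt_iff.2 ((map_ne_zero _).2 hx0))).2 hlt
    rwa [valuation_eq_of_add_le_one hinv (v_towerStep_add_inv_le_one_of_lt_one hlt)]
  · rwa [valuation_eq_of_add_le_one hgt (v_towerStep_add_le_one_of_one_lt hgt)]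

theorem v_towerStep_lt_one_iff (hx0 : x ≠ 0) :
    P.v (towerStep x) < 1 ↔ P.v (x ^ 2 + x + 1) < 1 := by
  have hmul : x ^ 2 + x + 1 = towerStep x * x := by
    rw [towerStep]
    field_simp
  by_cases hx : P.v x = 1
  · rw [hmul, map_mul, hx, mul_one]
  · exact iff_of_false (one_lt_v_towerStep hx0 hx).le.not_gt
      fun hlt => hx (v_eq_one_of_cyclotomic hlt).1

theorem v_towerStep_add_one_lt_one_iff (hx0 : x ≠ 0) :
    P.v (towerStep x + 1) < 1 ↔ P.v (x + 1) < 1 := by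
  have hmul : (x + 1) ^ 2 = (towerStep x + 1) * x := by
    rw [towerStep]
    field_simp
    ring
  by_cases hx : P.v x = 1
  · rw [← pow_lt_one_iff_of_nonneg zero_le two_ne_zero (a := P.v (x + 1)), ← map_pow, hmul,
      map_mul, hx, mul_one]
  · refine iff_of_false (fun hlt => ?_) fun hlt => hx (v_eq_one_of_v_add_one_lt_one hlt)
    have hnext := one_lt_v_towerStep hx0 hx
    rw [P.v.map_add_eq_of_lt_left (by rwa [map_one])] at hlt
    exact hlt.not_gt hnext

end

end Place

end Values

section Degrees

/-- Whether a point at which `x_n` vanishes is ramified between the levels `n + b` and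
`n + b + 1`. -/
def Ramifies (n b : ℕ) : Prop := Even b ∨ n / 2 ≤ b / 2

instance (n b : ℕ) : Decidable (Ramifies n b) := inferInstanceAs (Decidable (_ ∨ _))

/-- The total degree of the points of level `i` at which `x_n` vanishes. -/
def zeroDegree (i n : ℕ) : ℕ := 2 ^ ((n + 1) / 2 + min (n / 2) ((i - n) / 2))

/-- The total degree of the points of level `i` that are ramified in level `i + 1`: the pole of
`x_0` and the ramified points at which some `x_n` vanishes. -/
def ramifiedDegree (i : ℕ) : ℕ :=
  1 + ∑ n ∈ Finset.range (i + 1) with Ramifies n (i - n), zeroDegree i n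

/-- The genus of level `i`, as given by the Riemann–Hurwitz recursion. -/
def towerGenus : ℕ → ℤ
  | 0 => 0
  | i + 1 => 2 * towerGenus i - 1 + ramifiedDegree i

variable {i n : ℕ}

theorem zeroDegree_self (i : ℕ) : zeroDegree i i = 2 ^ ((i + 1) / 2) := by
  simp [zeroDegree]

theorem zeroDegree_succ_of_ramifies (hn : n ≤ i) (h : Ramifies n (i - n)) :
    zeroDegree (i + 1) n = zeroDegree i n := by
  unfold zeroDegree
  congr 2
  rcases h with ⟨m, hm⟩ | h <;> lia

theorem zeroDegree_succ_of_not_ramifies (hn : n ≤ i) (h : ¬ Ramifies n (i - n)) :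
    zeroDegree (i + 1) n = 2 * zeroDegree i n := by
  rw [Ramifies, not_or, Nat.not_even_iff_odd] at h
  obtain ⟨⟨m, hm⟩, hlt⟩ := h
  rw [zeroDegree, zeroDegree, ← pow_succ']
  congr 1
  lia

end Degrees

section Stage

variable {k K K' : Type*} [Field k] [Field K] [Field K'] [Algebra k K] [Algebra k K']
  [Algebra K K'] [IsScalarTower k K K'] [Algebra.IsAlgebraic K K']
  {P : Place k K} {Q : Place k K'} {n b : ℕ} {V V' : K} {z T : K'} {c : K}

namespace Place

/-- The local shape of `V` at a point at which `x_n` vanishes, where `V` is the right-hand side of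
the equation of `x_{n+b+1}`: the chain has lost one term for every two steps of the tower. -/
def Stage (P : Place k K) (n b : ℕ) (V : K) : Prop :=
  (Even b → P.EvenStage (n / 2 - b / 2) V) ∧ (¬ Even b → P.OddStage (n / 2 - b / 2) V)

variable [CharP K 2]

theorem Stage.of_add (hV : P.Stage n b V) (hVV' : P.v (V' + V) ≤ 1) : P.Stage n b V' :=
  ⟨fun hb => (hV.1 hb).of_add hVV', fun hb => (hV.2 hb).of_add hVV'⟩

theorem Stage.exists_ramified (hV : P.Stage n b V) (hr : Ramifies n b) :
    ∃ w : K, P.IsParam (V + (w ^ 2 + w))⁻¹ := by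
  by_cases hb : Even b
  · exact (hV.1 hb).exists_ramified
  · have hodd := hV.2 hb
    rw [Nat.sub_eq_zero_of_le (hr.resolve_left hb)] at hodd
    exact ⟨0, by simpa [OddStage] using hodd⟩

theorem Stage.exists_unramified (hV : P.Stage n b V) (hr : ¬ Ramifies n b) :
    ∃ w : K, P.v (V + (w ^ 2 + w)) ≤ 1 := by
  rw [Ramifies, not_or, not_le] at hr
  have hodd := hV.2 hr.1
  obtain ⟨r, hlen⟩ := Nat.exists_eq_succ_of_ne_zero (Nat.sub_pos_of_lt hr.2).ne'
  rw [hlen] at hodd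
  exact hodd.exists_unramified

theorem Stage.succ_of_ramifies (hV : P.Stage n b V) (hr : Ramifies n b)
    (h : IsArtinSchreier K z c) (hc : P.IsParam c⁻¹) (hQ : Q.under K = P)
    (hT : Q.v (T ^ 2 + T + algebraMap K K' V) ≤ 1) : Q.Stage n (b + 1) T := by
  by_cases hb : Even b
  · refine ⟨fun hb' => absurd hb (Nat.even_add_one.1 hb'), fun _ => ?_⟩
    have hdiv : (b + 1) / 2 = b / 2 := by
      obtain ⟨m, rfl⟩ := hb
      lia
    rw [hdiv]
    exact (hV.1 hb).oddStage h hc hQ hT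
  · refine ⟨fun _ => ?_, fun hb' => absurd (Nat.even_add_one.2 hb) hb'⟩
    have hle := hr.resolve_left hb
    have hodd := hV.2 hb
    rw [Nat.sub_eq_zero_of_le hle] at hodd
    rw [Nat.sub_eq_zero_of_le (hle.trans (Nat.div_le_div_right (Nat.le_succ b)))]
    exact h.isParam_inv_of_ramified hc hQ hodd hT

theorem Stage.succ_of_not_ramifies (hV : P.Stage n b V) (hr : ¬ Ramifies n b)
    (hQ : Q.under K = P) (hpar : ∀ t, P.IsParam t → Q.IsParam (algebraMap K K' t))
    (hT : Q.v (T ^ 2 + T + algebraMap K K' V) ≤ 1) : Q.Stage n (b + 1) T := by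
  rw [Ramifies, not_or, not_le] at hr
  have hodd := hV.2 hr.1
  refine ⟨fun _ => ?_, fun hb' => absurd (Nat.even_add_one.2 hr.1) hb'⟩
  have hdiv : n / 2 - b / 2 = (n / 2 - (b + 1) / 2) + 1 := by
    obtain ⟨m, rfl⟩ := Nat.not_even_iff_odd.1 hr.1
    lia
  rw [hdiv] at hodd
  exact hodd.evenStage hQ hpar hT

end Place

end Stage

theorem Place.IsParam.sq_add_ne {k K : Type*} [Field k] [Field K] [Algebra k K] {P : Place k K}
    {c : K} (hc : P.IsParam c⁻¹) (r : K) : r ^ 2 + r ≠ c := by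
  intro hr
  have hr1 : 1 < P.v r := by
    rw [← not_le, ← valuation_sq_add_le_one_iff, hr, not_le]
    exact hc.one_lt_v_of_inv
  have hr0 : r ≠ 0 := by
    rintro rfl
    simp at hr1
  obtain ⟨n, hn⟩ := hc.2 r hr0
  have hsq : P.v c⁻¹ ^ (-1 : ℤ) = P.v c⁻¹ ^ (n * 2) := by
    rw [map_inv₀, zpow_neg_one, inv_inv, ← map_inv₀, zpow_mul, ← hn, ← hr]
    exact valuation_sq_add_of_one_lt hr1
  rw [hc.zpow_inj] at hsq
  lia

theorem IsArtinSchreier.of_forall_sq_add_ne {K K' : Type*} [Field K] [Field K'] [Algebra K K']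
    {z : K'} {c : K} (hz : z ^ 2 + z = algebraMap K K' c)
    (hspan : ∀ f : K', ∃ a b : K, f = algebraMap K K' a + algebraMap K K' b * z)
    (hc : ∀ r : K, r ^ 2 + r ≠ c) : IsArtinSchreier K z c := by
  refine ⟨hz, hspan, fun a b hab => ?_⟩
  have hb : b = 0 := by
    by_contra hb
    have hz_eq : z = algebraMap K K' (-a / b) := by
      have hb' : algebraMap K K' b ≠ 0 := by simpa using hb
      rw [map_div₀, map_neg]
      field_simp
      linear_combination hab
    rw [hz_eq, ← map_pow, ← map_add] at hz
    exact hc _ ((algebraMap K K').injective hz)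
  subst hb
  exact ⟨by simpa using hab, rfl⟩

/-- What is known about the points of the curve with function field `K = k(x_0, …, x_i)`. -/
structure TowerLevel (k : Type*) {K : Type*} [Field k] [Field K] [Algebra k K] (i : ℕ)
    (x : ℕ → K) : Prop where
  isCurve : IsCurve k K
  hasGenus : HasGenus k K (towerGenus i)
  ne_zero : ∀ j ≤ i, x j ≠ 0
  equation : ∀ j < i, x (j + 1) ^ 2 + x (j + 1) = towerStep (x j)
  degree_pole : HasDegree {P : Place k K | 1 < P.v (x 0)} 1
  isParam_pole : ∀ P : Place k K, 1 < P.v (x 0) → P.IsParam (x i)⁻¹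
  degree_one : HasDegree {P : Place k K | P.v (x i + 1) < 1} (2 ^ ((i + 1) / 2))
  evenStage_one : ∀ P : Place k K, P.v (x i + 1) < 1 → P.EvenStage (i / 2) (x i + 1)⁻¹
  degree_cyclotomic :
    HasDegree {P : Place k K | P.v (x i ^ 2 + x i + 1) < 1} (2 ^ ((i + 2) / 2))
  evenStage_cyclotomic : ∀ P : Place k K, P.v (x i ^ 2 + x i + 1) < 1 →
    P.EvenStage ((i + 1) / 2) (towerStep (x i))⁻¹
  degree_zero : ∀ n ≤ i, HasDegree {P : Place k K | P.v (x n) < 1} (zeroDegree i n)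
  stage_zero : ∀ n ≤ i, ∀ P : Place k K, P.v (x n) < 1 → P.Stage n (i - n) (towerStep (x i))

/-- The points of level `i` that ramify in the next level. -/
def ramified (k : Type*) {K : Type*} [Field k] [Field K] [Algebra k K] (i : ℕ) (x : ℕ → K) :
    Set (Place k K) :=
  {P | 1 < P.v (x 0)} ∪
    ⋃ n ∈ (Finset.range (i + 1)).filter fun n => Ramifies n (i - n), {P | P.v (x n) < 1}

theorem mem_ramified_iff {k K : Type*} [Field k] [Field K] [Algebra k K] {i : ℕ} {x : ℕ → K}
    {P : Place k K} :
    P ∈ ramified k i x ↔ 1 < P.v (x 0) ∨ ∃ n ≤ i, Ramifies n (i - n) ∧ P.v (x n) < 1 := by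
  simp [ramified, and_assoc]

namespace TowerLevel

variable {k K : Type*} [Field k] [Field K] [Algebra k K] {i : ℕ} {x : ℕ → K} {P : Place k K}

theorem exists_of_one_lt_v_towerStep (h : TowerLevel k i x) (hP : 1 < P.v (towerStep (x i))) :
    1 < P.v (x 0) ∨ ∃ n ≤ i, P.v (x n) < 1 := by
  by_contra! ⟨hpole, hzero⟩
  have hunit (j : ℕ) (hj : j ≤ i) : P.v (x j) = 1 := by
    induction j with
    | zero => exact hpole.antisymm (hzero 0 hj)
    | succ j ih =>
      refine le_antisymm ?_ (hzero _ hj)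
      rw [← valuation_sq_add_le_one_iff, h.equation j hj]
      exact Place.v_towerStep_le_one (ih (Nat.le_of_succ_le hj))
  exact (Place.v_towerStep_le_one (hunit i le_rfl)).not_gt hP

variable [CharP K 2]

theorem one_lt_v_of_lt (h : TowerLevel k i x) {j m : ℕ} (hv : P.v (x j) ≠ 1) (hjm : j < m)
    (hm : m ≤ i) : 1 < P.v (x m) := by
  have hstep {l : ℕ} (hl : l < i) (hv : P.v (x l) ≠ 1) : 1 < P.v (x (l + 1)) := by
    have hnext := Place.one_lt_v_towerStep (h.ne_zero l hl.le) hv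
    rwa [← h.equation l hl, ← not_le, valuation_sq_add_le_one_iff, not_le] at hnext
  induction m, hjm using Nat.le_induction with
  | base => exact hstep hm hv
  | succ m _ ih => exact hstep hm (ih (Nat.le_of_succ_le hm)).ne'

theorem one_lt_v_towerStep (h : TowerLevel k i x) {j : ℕ} (hj : j ≤ i) (hv : P.v (x j) ≠ 1) :
    1 < P.v (towerStep (x i)) := by
  refine Place.one_lt_v_towerStep (h.ne_zero i le_rfl) ?_
  rcases hj.eq_or_lt with rfl | hlt
  · exact hv
  · exact (h.one_lt_v_of_lt hv hlt le_rfl).ne'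

theorem isParam_inv_towerStep (h : TowerLevel k i x) (hP : 1 < P.v (x 0)) :
    P.IsParam (towerStep (x i))⁻¹ :=
  (h.isParam_pole P hP).inv_of_add
    (Place.v_towerStep_add_le_one_of_one_lt (h.isParam_pole P hP).one_lt_v_of_inv)

theorem eq_of_zeros (h : TowerLevel k i x) {m n : ℕ} (hm : m ≤ i) (hn : n ≤ i)
    (hPm : P.v (x m) < 1) (hPn : P.v (x n) < 1) : m = n := by
  by_contra hne
  rcases lt_or_gt_of_ne hne with hlt | hlt
  · exact (h.one_lt_v_of_lt hPm.ne hlt hn).not_gt hPn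
  · exact (h.one_lt_v_of_lt hPn.ne hlt hm).not_gt hPm

theorem one_le_v_of_pole (h : TowerLevel k i x) {n : ℕ} (hn : n ≤ i) (hP : 1 < P.v (x 0)) :
    1 ≤ P.v (x n) := by
  rcases Nat.eq_zero_or_pos n with rfl | hpos
  · exact hP.le
  · exact (h.one_lt_v_of_lt hP.ne' hpos hn).le

theorem hasDegree_ramified (h : TowerLevel k i x) :
    HasDegree (ramified k i x) (ramifiedDegree i) := by
  have hle {n : ℕ} (hn : n ∈ (Finset.range (i + 1)).filter fun n => Ramifies n (i - n)) :
      n ≤ i := Nat.lt_succ_iff.1 (Finset.mem_range.1 (Finset.mem_filter.1 hn).1)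
  refine h.degree_pole.union (HasDegree.biUnion (fun n hn => h.degree_zero n (hle hn)) ?_) ?_
  · exact fun m hm n hn hmn => Set.disjoint_left.2 fun P hPm hPn =>
      hmn (h.eq_of_zeros (hle hm) (hle hn) hPm hPn)
  · refine Set.disjoint_left.2 fun P hP hzero => ?_
    obtain ⟨n, hn, hPn⟩ := Set.mem_iUnion₂.1 hzero
    exact (h.one_le_v_of_pole (hle hn) hP).not_gt hPn

theorem notMem_ramified_of_zero (h : TowerLevel k i x) {n : ℕ} (hn : n ≤ i)
    (hP : P.v (x n) < 1) (hr : ¬ Ramifies n (i - n)) : P ∉ ramified k i x := by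
  rw [mem_ramified_iff]
  rintro (hpole | ⟨m, hm, hr', hPm⟩)
  · exact (h.one_le_v_of_pole hn hpole).not_gt hP
  · exact hr (h.eq_of_zeros hm hn hPm hP ▸ hr')

theorem notMem_ramified_of_v_le_one (h : TowerLevel k i x) (hP : P.v (towerStep (x i)) ≤ 1) :
    P ∉ ramified k i x := by
  rw [mem_ramified_iff]
  rintro (hpole | ⟨n, hn, -, hzero⟩)
  · exact (h.one_lt_v_towerStep (Nat.zero_le i) hpole.ne').not_ge hP
  · exact (h.one_lt_v_towerStep hn hzero.ne).not_ge hP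

theorem exists_isParam_inv_of_mem_ramified (h : TowerLevel k i x) (hP : P ∈ ramified k i x) :
    ∃ w : K, P.IsParam (towerStep (x i) + (w ^ 2 + w))⁻¹ := by
  rcases mem_ramified_iff.1 hP with hpole | ⟨n, hn, hr, hzero⟩
  · exact ⟨0, by simpa using h.isParam_inv_towerStep hpole⟩
  · exact (h.stage_zero n hn P hzero).exists_ramified hr

theorem exists_v_le_one_of_notMem_ramified (h : TowerLevel k i x) (hP : P ∉ ramified k i x) :
    ∃ w : K, P.v (towerStep (x i) + (w ^ 2 + w)) ≤ 1 ∧ (P.v (towerStep (x i)) ≤ 1 → w = 0) := by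
  rcases le_or_gt (P.v (towerStep (x i))) 1 with hle | hgt
  · exact ⟨0, by simpa using hle, fun _ => rfl⟩
  · rw [mem_ramified_iff, not_or] at hP
    obtain ⟨n, hn, hzero⟩ := (h.exists_of_one_lt_v_towerStep hgt).resolve_left hP.1
    obtain ⟨w, hw⟩ := (h.stage_zero n hn P hzero).exists_unramified
      fun hr => hP.2 ⟨n, hn, hr, hzero⟩
    exact ⟨w, hw, fun hle => absurd hgt hle.not_gt⟩

theorem isArtinSchreier (h : TowerLevel k i x) {K' : Type*} [Field K'] [Algebra K K'] {y : K'}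
    (hy : y ^ 2 + y = algebraMap K K' (towerStep (x i)))
    (hspan : ∀ f : K', ∃ a b : K, f = algebraMap K K' a + algebraMap K K' b * y) :
    IsArtinSchreier K y (towerStep (x i)) := by
  obtain ⟨P, hP⟩ := h.degree_pole.nonempty one_ne_zero
  exact .of_forall_sq_add_ne hy hspan (h.isParam_inv_towerStep hP).sq_add_ne

end TowerLevel

theorem Place.EvenStage.succ_inv_towerStep {k K : Type*} [Field k] [Field K] [Algebra k K]
    [CharP K 2] {P : Place k K} {r : ℕ} {x y : K} (h : P.EvenStage r (x + 1)⁻¹)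
    (hx : P.v x = 1) (hy : y ≠ 0) (hxy : (y ^ 2 + y + 1) * x = (x + 1) ^ 2) :
    P.EvenStage (r + 1) (towerStep y)⁻¹ := by
  have htower : towerStep y * (y * x) = (x + 1) ^ 2 := by
    rw [← hxy, towerStep]
    field_simp
  have hx0 : x ≠ 0 := by
    rintro rfl
    simp at hx
  refine ⟨y, (x + 1)⁻¹, ?_, ?_, h⟩
  · calc P.v ((y ^ 2 + y + 1) * (x + 1)⁻¹ ^ 2)
        = P.v ((y ^ 2 + y + 1) * x * (x + 1)⁻¹ ^ 2) := by
          rw [map_mul, map_mul, map_mul, hx, mul_one]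
      _ = P.v ((x + 1) * (x + 1)⁻¹) ^ 2 := by rw [hxy, ← mul_pow, map_pow]
      _ ≤ 1 := pow_le_one₀ zero_le (by rw [map_mul, map_inv₀]; exact mul_inv_le_one)
  · suffices hsum : (towerStep y)⁻¹ + y * ((x + 1)⁻¹ ^ 2 + (x + 1)⁻¹) = 0 by
      rw [hsum, map_zero]
      exact zero_le_one
    rcases eq_or_ne (x + 1) 0 with hx1 | hx1
    · have hzero : towerStep y = 0 := by simpa [hx1, hy, hx0] using htower
      simp [hzero, hx1]
    · rw [eq_div_of_mul_eq (mul_ne_zero hy hx0) htower]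
      field_simp
      linear_combination y * (x + 1) * CharTwo.two_eq_zero (R := K)

namespace TowerLevel

variable {k K K' : Type*} [Field k] [Field K] [Field K'] [Algebra k K] [Algebra k K']
  [Algebra K K'] [IsScalarTower k K K'] [Algebra.IsAlgebraic K K'] [CharP K 2]
  {i : ℕ} {x : ℕ → K} {y : K'} {P : Place k K} {Q : Place k K'}

theorem isParam_of_notMem_ramified (h : TowerLevel k i x)
    (hA : IsArtinSchreier K y (towerStep (x i))) (hP : P ∉ ramified k i x) (hQ : Q.under K = P)
    (t : K) (ht : P.IsParam t) : Q.IsParam (algebraMap K K' t) := by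
  obtain ⟨w, hw, -⟩ := h.exists_v_le_one_of_notMem_ramified hP
  exact (hA.shift w).isParam_of_unramified hw hQ ht

open Classical in
theorem exists_isFiber (h : TowerLevel k i x) (hA : IsArtinSchreier K y (towerStep (x i)))
    (P : Place k K) : ∃ w : K,
      IsFiber P (y + algebraMap K K' w) (if P ∈ ramified k i x then 2 else 1) ∧
        (P.v (towerStep (x i)) ≤ 1 → w = 0) := by
  split_ifs with hP
  · obtain ⟨w, hw⟩ := h.exists_isParam_inv_of_mem_ramified hP
    exact ⟨w, (hA.shift w).isFiber_of_ramified hw (h.isCurve.finite_residueField P),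
      fun hle => absurd hP (h.notMem_ramified_of_v_le_one hle)⟩
  · obtain ⟨w, hw, hw0⟩ := h.exists_v_le_one_of_notMem_ramified hP
    exact ⟨w, (hA.shift w).isFiber_of_unramified hw (h.isCurve.finite_residueField P), hw0⟩

theorem hasDegree_fiber_of_mem_ramified (h : TowerLevel k i x)
    (hA : IsArtinSchreier K y (towerStep (x i))) (hP : P ∈ ramified k i x) :
    HasDegree {Q : Place k K' | Q.under K = P} (1 * P.degree) := by
  obtain ⟨w, hw, -⟩ := h.exists_isFiber hA P
  rw [if_pos hP] at hw
  exact hw.hasDegree rfl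

theorem hasDegree_fiber_of_notMem_ramified (h : TowerLevel k i x)
    (hA : IsArtinSchreier K y (towerStep (x i))) (hP : P ∉ ramified k i x) :
    HasDegree {Q : Place k K' | Q.under K = P} (2 * P.degree) := by
  obtain ⟨w, hw, -⟩ := h.exists_isFiber hA P
  rw [if_neg hP] at hw
  exact hw.hasDegree rfl

theorem isCurve_and_hasGenus_succ (h : TowerLevel k i x)
    (hA : IsArtinSchreier K y (towerStep (x i))) :
    IsCurve k K' ∧ HasGenus k K' (towerGenus (i + 1)) := by
  classical
  choose w hF hw using h.exists_isFiber hA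
  obtain ⟨E, hE, hdeg⟩ := h.hasDegree_ramified.exists_divisor
  refine ⟨h.isCurve.of_isFiber hA hF, ?_⟩
  rw [towerGenus, ← hdeg]
  refine .of_isFiber h.isCurve h.hasGenus hA hF (fun P => ?_) ?_ fun P => ?_
  · split_ifs <;> decide
  · exact (h.isCurve.finite_poles (towerStep (x i))).subset fun P hP hmem =>
      hP (hw P (Place.mem_ring_iff.1 hmem))
  · rw [hE, Set.indicator_apply]
    split_ifs <;> simp

theorem hasDegree_gen (h : TowerLevel k i x) (hA : IsArtinSchreier K y (towerStep (x i))) :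
    HasDegree {Q : Place k K' | Q.v y < 1} (2 ^ ((i + 2) / 2)) := by
  have hiff {P : Place k K} := P.v_towerStep_lt_one_iff (h.ne_zero i le_rfl)
  rw [← one_mul (2 ^ ((i + 2) / 2))]
  refine h.degree_cyclotomic.of_under
    (fun Q hQ => hiff.1 (hA.v_under_lt_one hQ)) fun P hP => ?_
  have hc := hiff.2 hP
  obtain ⟨Q, hQ, hy⟩ := hA.exists_under_eq_of_split hc
  have hfiber : {Q' ∈ {Q : Place k K' | Q.v y < 1} | Q'.under K = P} = {Q} := Set.ext fun Q' =>
    ⟨fun hQ' => hA.eq_of_split hc.le hQ'.2 hQ'.1 hQ hy, by rintro rfl; exact ⟨hy, hQ⟩⟩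
  rw [hfiber, one_mul,
    ← (hA.degree_of_split hc.le hQ hy (h.isCurve.finite_residueField P)).2]
  exact hasDegree_singleton Q

theorem evenStage_gen_mul_inv (h : TowerLevel k i x)
    (hA : IsArtinSchreier K y (towerStep (x i))) (hy : Q.v y < 1) :
    Q.EvenStage ((i + 1) / 2) (y * (y + 1))⁻¹ := by
  have hc := hA.v_under_lt_one hy
  have hstage := (h.evenStage_cyclotomic _
    ((Place.v_towerStep_lt_one_iff (h.ne_zero i le_rfl)).1 hc)).map rfl
      (h.isParam_of_notMem_ramified hA (h.notMem_ramified_of_v_le_one hc.le) rfl)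
  rwa [map_inv₀, ← hA.equation, sq, ← mul_add_one] at hstage

theorem evenStage_one_succ (h : TowerLevel k i x) (hA : IsArtinSchreier K y (towerStep (x i)))
    (hy : Q.v (y + 1) < 1) : Q.EvenStage ((i + 1) / 2) (y + 1)⁻¹ := by
  have := charP_of_injective_algebraMap (algebraMap K K').injective 2
  have hstage := h.evenStage_gen_mul_inv hA.add_one hy
  rw [add_assoc, CharTwo.add_self_eq_zero, add_zero] at hstage
  have hy0 := hA.gen_ne_zero
  have hy1 := hA.add_one.gen_ne_zero
  refine hstage.of_add ?_
  have hsum : (y + 1)⁻¹ + ((y + 1) * y)⁻¹ = y⁻¹ := by field_simp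
  rw [hsum, map_inv₀, Place.v_eq_one_of_v_add_one_lt_one hy, inv_one]

theorem stage_zero_succ_self (h : TowerLevel k i x)
    (hA : IsArtinSchreier K y (towerStep (x i))) (hy : Q.v y < 1) :
    Q.Stage (i + 1) 0 (towerStep y) := by
  have := charP_of_injective_algebraMap (algebraMap K K').injective 2
  have hy0 := hA.gen_ne_zero
  have hy1 := hA.add_one.gen_ne_zero
  refine ⟨fun _ => (h.evenStage_gen_mul_inv hA hy).of_add ?_, fun hodd => absurd Even.zero hodd⟩
  have hsum : towerStep y + (y * (y + 1))⁻¹ = (y + 1) + (y + 1)⁻¹ := by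
    rw [towerStep]
    field_simp
    linear_combination CharTwo.two_eq_zero (R := K')
  have hv : Q.v (y + 1) = 1 := by
    rw [Q.v.map_add_eq_of_lt_right (by rwa [map_one]), map_one]
  rw [hsum]
  refine Q.v.map_add_le hv.le ?_
  rw [map_inv₀, hv, inv_one]

theorem v_cyclotomic_lt_one_iff (h : TowerLevel k i x)
    (hA : IsArtinSchreier K y (towerStep (x i))) :
    Q.v (y ^ 2 + y + 1) < 1 ↔ (Q.under K).v (x i + 1) < 1 := by
  rw [hA.equation, ← map_one (algebraMap K K'), ← map_add, Place.v_algebraMap_lt_one_iff rfl,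
    Place.v_towerStep_add_one_lt_one_iff (h.ne_zero i le_rfl)]

theorem notMem_ramified_of_v_add_one_lt_one (h : TowerLevel k i x) (hP : P.v (x i + 1) < 1) :
    P ∉ ramified k i x :=
  h.notMem_ramified_of_v_le_one
    (Place.v_towerStep_le_one (Place.v_eq_one_of_v_add_one_lt_one hP))

theorem hasDegree_cyclotomic_succ (h : TowerLevel k i x)
    (hA : IsArtinSchreier K y (towerStep (x i))) :
    HasDegree {Q : Place k K' | Q.v (y ^ 2 + y + 1) < 1} (2 ^ ((i + 1 + 2) / 2)) := by
  rw [show (i + 1 + 2) / 2 = (i + 1) / 2 + 1 by lia, pow_succ' 2]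
  have hset : {Q : Place k K' | Q.v (y ^ 2 + y + 1) < 1} =
      {Q | Q.under K ∈ {P : Place k K | P.v (x i + 1) < 1}} :=
    Set.ext fun _ => h.v_cyclotomic_lt_one_iff hA
  rw [hset]
  exact h.degree_one.preimage_under fun P hP =>
    h.hasDegree_fiber_of_notMem_ramified hA (h.notMem_ramified_of_v_add_one_lt_one hP)

theorem evenStage_cyclotomic_succ (h : TowerLevel k i x)
    (hA : IsArtinSchreier K y (towerStep (x i))) (hy : Q.v (y ^ 2 + y + 1) < 1) :
    Q.EvenStage ((i + 1 + 1) / 2) (towerStep y)⁻¹ := by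
  have := charP_of_injective_algebraMap (algebraMap K K').injective 2
  have hP := (h.v_cyclotomic_lt_one_iff hA).1 hy
  have hstage := (h.evenStage_one _ hP).map (Q := Q) rfl
    (h.isParam_of_notMem_ramified hA (h.notMem_ramified_of_v_add_one_lt_one hP) rfl)
  rw [map_inv₀, map_add, map_one] at hstage
  rw [show (i + 1 + 1) / 2 = i / 2 + 1 by lia]
  refine hstage.succ_inv_towerStep
    ((Place.v_algebraMap_eq_one_iff rfl).2 (Place.v_eq_one_of_v_add_one_lt_one hP))
    hA.gen_ne_zero ?_
  have hx0 : algebraMap K K' (x i) ≠ 0 := (map_ne_zero _).2 (h.ne_zero i le_rfl)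
  rw [hA.equation, towerStep, map_add, map_add, map_div₀, map_one]
  field_simp
  ring

theorem stage_zero_succ (h : TowerLevel k i x) (hA : IsArtinSchreier K y (towerStep (x i)))
    {n : ℕ} (hn : n ≤ i) (hP : (Q.under K).v (x n) < 1) :
    Q.Stage n (i + 1 - n) (towerStep y) := by
  have := charP_of_injective_algebraMap (algebraMap K K').injective 2
  have hy : 1 < Q.v y := by
    have hc := h.one_lt_v_towerStep hn hP.ne
    rwa [← Place.one_lt_v_algebraMap_iff rfl, ← hA.equation, ← not_le,
      valuation_sq_add_le_one_iff, not_le] at hc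
  have hT : Q.v (y ^ 2 + y + algebraMap K K' (towerStep (x i))) ≤ 1 := by
    rw [hA.sq_add_gen_add_eq_zero, map_zero]
    exact zero_le_one
  rw [Nat.sub_add_comm hn]
  refine Place.Stage.of_add ?_ (Place.v_towerStep_add_le_one_of_one_lt hy)
  have hstage := h.stage_zero n hn _ hP
  by_cases hr : Ramifies n (i - n)
  · obtain ⟨w, hw⟩ :=
      h.exists_isParam_inv_of_mem_ramified (mem_ramified_iff.2 (.inr ⟨n, hn, hr, hP⟩))
    exact hstage.succ_of_ramifies hr (hA.shift w) hw rfl hT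
  · exact hstage.succ_of_not_ramifies hr rfl
      (h.isParam_of_notMem_ramified hA (h.notMem_ramified_of_zero hn hP hr) rfl) hT

theorem hasDegree_zero_succ (h : TowerLevel k i x) (hA : IsArtinSchreier K y (towerStep (x i)))
    {n : ℕ} (hn : n ≤ i) :
    HasDegree {Q : Place k K' | Q.v (algebraMap K K' (x n)) < 1} (zeroDegree (i + 1) n) := by
  have hset : {Q : Place k K' | Q.v (algebraMap K K' (x n)) < 1} =
      {Q | Q.under K ∈ {P : Place k K | P.v (x n) < 1}} :=
    Set.ext fun _ => Place.v_algebraMap_lt_one_iff rfl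
  rw [hset]
  by_cases hr : Ramifies n (i - n)
  · rw [zeroDegree_succ_of_ramifies hn hr, ← one_mul (zeroDegree i n)]
    exact (h.degree_zero n hn).preimage_under fun P hP =>
      h.hasDegree_fiber_of_mem_ramified hA (mem_ramified_iff.2 (.inr ⟨n, hn, hr, hP⟩))
  · rw [zeroDegree_succ_of_not_ramifies hn hr]
    exact (h.degree_zero n hn).preimage_under fun P hP =>
      h.hasDegree_fiber_of_notMem_ramified hA (h.notMem_ramified_of_zero hn hP hr)

theorem hasDegree_pole_succ (h : TowerLevel k i x)
    (hA : IsArtinSchreier K y (towerStep (x i))) :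
    HasDegree {Q : Place k K' | 1 < Q.v (algebraMap K K' (x 0))} 1 := by
  have hset : {Q : Place k K' | 1 < Q.v (algebraMap K K' (x 0))} =
      {Q | Q.under K ∈ {P : Place k K | 1 < P.v (x 0)}} :=
    Set.ext fun _ => Place.one_lt_v_algebraMap_iff rfl
  rw [hset, ← one_mul 1]
  exact h.degree_pole.preimage_under fun P hP =>
    h.hasDegree_fiber_of_mem_ramified hA (mem_ramified_iff.2 (.inl hP))

theorem isParam_pole_succ (h : TowerLevel k i x)
    (hA : IsArtinSchreier K y (towerStep (x i)))
    (hQ : 1 < Q.v (algebraMap K K' (x 0))) : Q.IsParam y⁻¹ :=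
  hA.isParam_of_ramified (h.isParam_inv_towerStep ((Place.one_lt_v_algebraMap_iff rfl).1 hQ)) rfl

theorem succ (h : TowerLevel k i x) (hA : IsArtinSchreier K y (towerStep (x i))) {x' : ℕ → K'}
    (hx' : ∀ j ≤ i, x' j = algebraMap K K' (x j)) (hy : x' (i + 1) = y) :
    TowerLevel k (i + 1) x' where
  isCurve := (h.isCurve_and_hasGenus_succ hA).1
  hasGenus := (h.isCurve_and_hasGenus_succ hA).2
  ne_zero j hj := by
    rcases Nat.le_succ_iff.1 hj with hj | rfl
    · exact hx' j hj ▸ (map_ne_zero _).2 (h.ne_zero j hj)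
    · exact hy ▸ hA.gen_ne_zero
  equation j hj := by
    rcases Nat.lt_succ_iff_lt_or_eq.1 hj with hj | rfl
    · rw [hx' (j + 1) hj, hx' j hj.le, ← map_towerStep, ← h.equation j hj, map_add, map_pow]
    · rw [hy, hx' j le_rfl, hA.equation, map_towerStep]
  degree_pole := hx' 0 (Nat.zero_le i) ▸ h.hasDegree_pole_succ hA
  isParam_pole Q hQ := by
    rw [hx' 0 (Nat.zero_le i)] at hQ
    exact hy ▸ h.isParam_pole_succ hA hQ
  degree_one := hy ▸ h.hasDegree_gen hA.add_one
  evenStage_one Q hQ := by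
    rw [hy] at hQ ⊢
    exact h.evenStage_one_succ hA hQ
  degree_cyclotomic := hy ▸ h.hasDegree_cyclotomic_succ hA
  evenStage_cyclotomic Q hQ := by
    rw [hy] at hQ ⊢
    exact h.evenStage_cyclotomic_succ hA hQ
  degree_zero n hn := by
    rcases Nat.le_succ_iff.1 hn with hn | rfl
    · exact hx' n hn ▸ h.hasDegree_zero_succ hA hn
    · rw [hy, zeroDegree_self]
      exact h.hasDegree_gen hA
  stage_zero n hn Q hQ := by
    rcases Nat.le_succ_iff.1 hn with hn | rfl
    · rw [hx' n hn, Place.v_algebraMap_lt_one_iff rfl] at hQ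
      exact hy ▸ h.stage_zero_succ hA hn hQ
    · rw [hy] at hQ ⊢
      rw [Nat.sub_self]
      exact h.stage_zero_succ_self hA hQ

end TowerLevel

section Base

open Polynomial

variable {k K : Type*} [Field k] [Field K] [Algebra k K] {x : K} {p q : k[X]} {P : Place k K}

theorem squarefree_X_add_C (a : k) : Squarefree (X + C a) :=
  (irreducible_of_degree_eq_one (degree_X_add_C a)).squarefree

theorem squarefree_X_sq_add_X_add_one [CharP k 2] : Squarefree (X ^ 2 + X + 1 : k[X]) := by
  have hder : derivative (X ^ 2 + X + 1 : k[X]) = 1 := by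
    simp [CharTwo.two_eq_zero, one_add_one_eq_two]
  refine Separable.squarefree ?_
  rw [Polynomial.Separable, hder]
  exact isCoprime_one_right

namespace Place

theorem v_le_one_of_v_aeval_lt_one (hp : p ≠ 0) (hP : P.v (aeval x p) < 1) : P.v x ≤ 1 := by
  by_contra! hx
  rw [v_aeval_of_one_lt hx hp] at hP
  exact (one_le_pow₀ hx.le).not_gt hP

theorem v_aeval_eq_one_of_isCoprime (hpq : IsCoprime p q) (hx : P.v x ≤ 1)
    (hP : P.v (aeval x p) < 1) : P.v (aeval x q) = 1 := by
  obtain ⟨a, b, hab⟩ := hpq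
  refine (v_aeval_le_one hx q).eq_of_not_lt fun hq => ?_
  have hlt : P.v (aeval x (a * p + b * q)) < 1 := by
    rw [map_add, map_mul, map_mul]
    refine P.v.map_add_lt ?_ ?_ <;> rw [map_mul]
    · exact mul_lt_one_of_nonneg_of_lt_one_right (v_aeval_le_one hx a) zero_le hP
    · exact mul_lt_one_of_nonneg_of_lt_one_right (v_aeval_le_one hx b) zero_le hq
  rw [hab, map_one, map_one] at hlt
  exact hlt.false

theorem v_aeval_mul_lt_one_iff (hp : p ≠ 0) (hq : q ≠ 0) :
    P.v (aeval x (p * q)) < 1 ↔ P.v (aeval x p) < 1 ∨ P.v (aeval x q) < 1 := by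
  refine ⟨fun hP => ?_, ?_⟩
  · contrapose! hP
    rw [map_mul, map_mul]
    exact one_le_mul hP.1 hP.2
  · rw [map_mul, map_mul]
    rintro (hP | hP)
    · exact mul_lt_one_of_nonneg_of_lt_one_left zero_le hP
        (v_aeval_le_one (v_le_one_of_v_aeval_lt_one hp hP) q)
    · exact mul_lt_one_of_nonneg_of_lt_one_right
        (v_aeval_le_one (v_le_one_of_v_aeval_lt_one hq hP) p) zero_le hP

end Place

namespace IsCoordinate

theorem hasDegree_zeros_of_irreducible (h : IsCoordinate k x) (hp : Irreducible p) :
    HasDegree {P : Place k K | P.v (aeval x p) < 1} p.natDegree := by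
  obtain ⟨P, hP⟩ := h.exists_isZeroOf hp
  have hset : {P : Place k K | P.v (aeval x p) < 1} = {P} := by
    ext Q
    refine ⟨fun hQ => ?_, fun hQ => ?_⟩
    · exact h.eq_of_isZeroOf
        ((h.isZeroOf_iff hp).2 ⟨Place.v_le_one_of_v_aeval_lt_one hp.ne_zero hQ, hQ⟩) hP
    · obtain rfl : Q = P := hQ
      exact ((h.isZeroOf_iff hp).1 hP).2
  rw [hset, ← (h.finite_and_degree_of_isZeroOf hP).2]
  exact hasDegree_singleton P

theorem hasDegree_zeros (h : IsCoordinate k x) (hp : Squarefree p) :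
    HasDegree {P : Place k K | P.v (aeval x p) < 1} p.natDegree := by
  induction p using WfDvdMonoid.induction_on_irreducible with
  | zero => exact absurd hp not_squarefree_zero
  | unit p hu =>
    have hset : {P : Place k K | P.v (aeval x p) < 1} = ∅ :=
      Set.eq_empty_of_forall_notMem fun P => (Place.v_aeval_eq_one_of_isUnit hu).not_lt
    rw [natDegree_eq_zero_of_isUnit hu, hset]
    exact ⟨Set.finite_empty, finsum_mem_empty⟩
  | mul p q hp0 hq ih =>
    obtain ⟨hrel, -, hsq⟩ := squarefree_mul_iff.1 hp
    have hset : {P : Place k K | P.v (aeval x (q * p)) < 1} =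
        {P | P.v (aeval x q) < 1} ∪ {P | P.v (aeval x p) < 1} :=
      Set.ext fun P => Place.v_aeval_mul_lt_one_iff hq.ne_zero hp0
    rw [natDegree_mul hq.ne_zero hp0, hset]
    refine (h.hasDegree_zeros_of_irreducible hq).union (ih hsq) (Set.disjoint_left.2 ?_)
    intro P hPq hPp
    have hPx := Place.v_le_one_of_v_aeval_lt_one hq.ne_zero hPq
    exact (Place.v_aeval_eq_one_of_isCoprime hrel.isCoprime hPx hPq).not_lt hPp

theorem isParam_of_squarefree (h : IsCoordinate k x) (hp : Squarefree p)
    (hP : P.v (aeval x p) < 1) : P.IsParam (aeval x p) := by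
  induction p using WfDvdMonoid.induction_on_irreducible with
  | zero => exact absurd hp not_squarefree_zero
  | unit p hu => exact absurd hP (Place.v_aeval_eq_one_of_isUnit hu).not_lt
  | mul p q hp0 hq ih =>
    obtain ⟨hrel, -, hsq⟩ := squarefree_mul_iff.1 hp
    have hqp : IsCoprime q p := hrel.isCoprime
    rcases (Place.v_aeval_mul_lt_one_iff hq.ne_zero hp0).1 hP with hPq | hPp
    · have hPx := Place.v_le_one_of_v_aeval_lt_one hq.ne_zero hPq
      refine (h.isParam_of_isZeroOf ((h.isZeroOf_iff hq).2 ⟨hPx, hPq⟩)).congr ?_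
      rw [map_mul, map_mul, Place.v_aeval_eq_one_of_isCoprime hqp hPx hPq, mul_one]
    · have hPx := Place.v_le_one_of_v_aeval_lt_one hp0 hPp
      refine (ih hsq hPp).congr ?_
      rw [map_mul, map_mul, Place.v_aeval_eq_one_of_isCoprime hqp.symm hPx hPp, one_mul]

theorem hasDegree_zeros_add (h : IsCoordinate k x) (a : k) :
    HasDegree {P : Place k K | P.v (x + algebraMap k K a) < 1} 1 := by
  simpa using h.hasDegree_zeros (squarefree_X_add_C a)

theorem isParam_add (h : IsCoordinate k x) {a : k} (hP : P.v (x + algebraMap k K a) < 1) :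
    P.IsParam (x + algebraMap k K a) := by
  simpa using h.isParam_of_squarefree (squarefree_X_add_C a) (by simpa using hP)

section CharTwo

variable [CharP k 2]

theorem hasDegree_zeros_cyclotomic (h : IsCoordinate k x) :
    HasDegree {P : Place k K | P.v (x ^ 2 + x + 1) < 1} 2 := by
  have hdeg : (X ^ 2 + X + 1 : k[X]).natDegree = 2 := by compute_degree!
  simpa [hdeg] using h.hasDegree_zeros squarefree_X_sq_add_X_add_one

theorem isParam_cyclotomic (h : IsCoordinate k x) (hP : P.v (x ^ 2 + x + 1) < 1) :
    P.IsParam (x ^ 2 + x + 1) := by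
  simpa using h.isParam_of_squarefree squarefree_X_sq_add_X_add_one (by simpa using hP)

theorem towerLevel {x : ℕ → K} (h : IsCoordinate k (x 0)) : TowerLevel k 0 x := by
  have : CharP K 2 := charP_of_injective_algebraMap (algebraMap k K).injective 2
  obtain ⟨Q, hQ⟩ := h.inv.exists_isZeroOf irreducible_X
  have hpole : 1 < Q.v (x 0) := h.isZeroOf_inv_X_iff.1 hQ
  exact
  { isCurve := h.isCurve
    hasGenus := h.hasGenus
    ne_zero j hj := Nat.le_zero.1 hj ▸ h.ne_zero
    equation j hj := absurd hj (Nat.not_lt_zero j)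
    degree_pole := by
      have hset : {P : Place k K | 1 < P.v (x 0)} = {Q} := Set.ext fun _ => h.one_lt_v_iff hpole
      rw [hset, ← h.degree_eq_one hpole]
      exact hasDegree_singleton Q
    isParam_pole P hP := h.isParam_inv hP
    degree_one := by simpa using h.hasDegree_zeros_add 1
    evenStage_one P hP := by
      rw [Nat.zero_div, Place.EvenStage, inv_inv]
      rw [← map_one (algebraMap k K)] at hP ⊢
      exact h.isParam_add hP
    degree_cyclotomic := h.hasDegree_zeros_cyclotomic
    evenStage_cyclotomic P hP := by
      have hmul : x 0 ^ 2 + x 0 + 1 = towerStep (x 0) * x 0 := by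
        have := h.ne_zero
        rw [towerStep]
        field_simp
      rw [Place.EvenStage, inv_inv]
      refine (h.isParam_cyclotomic hP).congr ?_
      rw [hmul, map_mul, (Place.v_eq_one_of_cyclotomic hP).1, mul_one]
    degree_zero n hn := by
      obtain rfl := Nat.le_zero.1 hn
      simpa [zeroDegree_self] using h.hasDegree_zeros_add 0
    stage_zero n hn P hP := by
      obtain rfl := Nat.le_zero.1 hn
      refine ⟨fun _ => ?_, fun hb => absurd Even.zero hb⟩
      have hinv : P.IsParam (x 0)⁻¹⁻¹ := by simpa using h.isParam_add (a := 0) (by simpa using hP)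
      exact hinv.inv_of_add (Place.v_towerStep_add_inv_le_one_of_lt_one hP) }

end CharTwo

end IsCoordinate

end Base

section Induction

theorem exists_eq_add_mul_of_adjoin_eq_top {R S : Type*} [CommRing R] [CommRing S] [Algebra R S]
    {y : S} {c : R} (hy : y ^ 2 + y = algebraMap R S c) (htop : Algebra.adjoin R {y} = ⊤) (f : S) :
    ∃ a b : R, f = algebraMap R S a + algebraMap R S b * y := by
  have hf : f ∈ Algebra.adjoin R {y} := htop ▸ Algebra.mem_top
  induction hf using Algebra.adjoin_induction with
  | mem f hf => exact ⟨0, 1, by simpa using hf⟩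
  | algebraMap a => exact ⟨a, 0, by simp⟩
  | add f g _ _ hf hg =>
    obtain ⟨a, b, rfl⟩ := hf
    obtain ⟨a', b', rfl⟩ := hg
    exact ⟨a + a', b + b', by rw [map_add, map_add]; ring⟩
  | mul f g _ _ hf hg =>
    obtain ⟨a, b, rfl⟩ := hf
    obtain ⟨a', b', rfl⟩ := hg
    refine ⟨a * a' + b * b' * c, a * b' + b * a' - b * b', ?_⟩
    simp only [map_add, map_sub, map_mul, ← hy]
    ring

variable {k K : Type*} [Field k] [Field K] [Algebra k K] {i : ℕ} {x : ℕ → K}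

/-- `K = k(x_0, …, x_i)` is generated as in `IsTowerFunctionField`, with the generators indexed by
the natural numbers; the values `x j` for `j > i` are irrelevant. -/
structure IsTower (k : Type*) {K : Type*} [Field k] [Field K] [Algebra k K] (i : ℕ)
    (x : ℕ → K) : Prop where
  transcendental : Transcendental k (x 0)
  equation : ∀ j < i, x (j + 1) ^ 2 + x (j + 1) = towerStep (x j)
  adjoin_eq_top : IntermediateField.adjoin k (x '' Set.Iic i) = ⊤

/-- The generators `x_0, …, x_i` as elements of the field `k(x_0, …, x_i)`. -/
def towerRestrict (k : Type*) {K : Type*} [Field k] [Field K] [Algebra k K] (i : ℕ) (x : ℕ → K)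
    (j : ℕ) : IntermediateField.adjoin k (x '' Set.Iic i) :=
  ⟨x (min j i), IntermediateField.subset_adjoin k _ ⟨_, min_le_right j i, rfl⟩⟩

theorem algebraMap_towerRestrict {j : ℕ} (hj : j ≤ i) :
    algebraMap _ K (towerRestrict k i x j) = x j :=
  congrArg x (min_eq_left hj)

namespace IsTower

theorem restrict (h : IsTower k (i + 1) x) : IsTower k i (towerRestrict k i x) where
  transcendental := by
    refine (transcendental_algebraMap_iff (FaithfulSMul.algebraMap_injective _ K)).1 ?_
    rw [algebraMap_towerRestrict (Nat.zero_le i)]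
    exact h.transcendental
  equation j hj := by
    refine (algebraMap _ K).injective ?_
    rw [map_add, map_pow, map_towerStep, algebraMap_towerRestrict hj,
      algebraMap_towerRestrict hj.le]
    exact h.equation j (hj.trans i.lt_succ_self)
  adjoin_eq_top := by
    apply IntermediateField.lift_injective
    rw [IntermediateField.lift_adjoin, IntermediateField.lift_top, ← Set.image_comp]
    congr 1
    exact Set.image_congr fun j hj => algebraMap_towerRestrict (k := k) hj

theorem algebraMap_towerStep_towerRestrict (h : IsTower k (i + 1) x) :
    x (i + 1) ^ 2 + x (i + 1) = algebraMap _ K (towerStep (towerRestrict k i x i)) := by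
  rw [map_towerStep, algebraMap_towerRestrict le_rfl]
  exact h.equation i i.lt_succ_self

theorem algebraAdjoin_eq_top (h : IsTower k (i + 1) x) :
    Algebra.adjoin (IntermediateField.adjoin k (x '' Set.Iic i)) {x (i + 1)} = ⊤ := by
  let F := IntermediateField.adjoin k (x '' Set.Iic i)
  have hint : IsIntegral F (x (i + 1)) := by
    refine ⟨.X ^ 2 + .X - .C (towerStep (towerRestrict k i x i)), by monicity!, ?_⟩
    simp [h.algebraMap_towerStep_towerRestrict]
  have htop : IntermediateField.adjoin F {x (i + 1)} = ⊤ := by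
    apply IntermediateField.restrictScalars_injective k
    rw [IntermediateField.restrictScalars_top, IntermediateField.adjoin_adjoin_left,
      ← h.adjoin_eq_top, Set.union_singleton, ← Set.image_insert_eq]
    congr 2
    ext j
    simp [Nat.le_succ_iff, or_comm]
  rw [← IntermediateField.adjoin_simple_toSubalgebra_of_isAlgebraic hint.isAlgebraic, htop,
    IntermediateField.top_toSubalgebra]

theorem isCoordinate (h : IsTower k 0 x) : IsCoordinate k (x 0) where
  transcendental := h.transcendental
  adjoin_eq_top := by simpa [Set.Iic] using h.adjoin_eq_top

theorem towerLevel [CharP k 2] (h : IsTower k i x) : TowerLevel k i x := by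
  induction i generalizing K with
  | zero => exact h.isCoordinate.towerLevel
  | succ i ih =>
    let F := IntermediateField.adjoin k (x '' Set.Iic i)
    have : CharP F 2 := charP_of_injective_algebraMap (algebraMap k F).injective 2
    have hlevel : TowerLevel k i (towerRestrict k i x) := ih h.restrict
    have hy := h.algebraMap_towerStep_towerRestrict
    have hA : IsArtinSchreier F (x (i + 1)) (towerStep (towerRestrict k i x i)) :=
      hlevel.isArtinSchreier hy (exists_eq_add_mul_of_adjoin_eq_top hy h.algebraAdjoin_eq_top)
    have := hA.isAlgebraic
    exact hlevel.succ hA (fun j hj => (algebraMap_towerRestrict hj).symm) rfl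

end IsTower

theorem IsTowerFunctionField.isTower {x : Fin (i + 1) → K} (h : IsTowerFunctionField k i x) :
    IsTower k i fun j => x (Fin.ofNat (i + 1) j) where
  transcendental := h.transcendental
  equation j hj := by
    have hsucc : Fin.ofNat (i + 1) (j + 1) = Fin.succ ⟨j, hj⟩ := by ext; simp [hj]
    have hcast : Fin.ofNat (i + 1) j = Fin.castSucc ⟨j, hj⟩ := by ext; simp [hj.trans]
    rw [hsucc, hcast]
    exact h.equation ⟨j, hj⟩
  adjoin_eq_top := by
    rw [← h.adjoin_eq_top]
    congr 1
    ext f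
    constructor
    · rintro ⟨j, -, rfl⟩
      exact ⟨_, rfl⟩
    · rintro ⟨j, rfl⟩
      exact ⟨j, Nat.lt_succ_iff.1 j.2, congrArg x (by simp)⟩

end Induction

section ClosedForm

theorem ramifies_add_two_add_two {n b : ℕ} : Ramifies (n + 2) (b + 2) ↔ Ramifies n b := by
  unfold Ramifies
  grind

theorem zeroDegree_add_four_add_two {i n : ℕ} (hn : n ≤ i) :
    zeroDegree (i + 4) (n + 2) = 4 * zeroDegree i n := by
  have hexp : (n + 2 + 1) / 2 + min ((n + 2) / 2) ((i + 4 - (n + 2)) / 2) =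
      2 + ((n + 1) / 2 + min (n / 2) ((i - n) / 2)) := by lia
  rw [zeroDegree, zeroDegree, hexp, pow_add]
  norm_num

/- The zeros of `x_n` at level `i` correspond to those of `x_{n+2}` at level `i + 4`; besides these,
the zeros of `x_0`, `x_1` and `x_{i+4}` ramify, while those of `x_{i+3}` do not. -/
theorem ramifiedDegree_add_four (i : ℕ) :
    ramifiedDegree (i + 4) = 4 * ramifiedDegree i + 2 ^ ((i + 5) / 2) := by
  have hshift : ∑ n ∈ Finset.range (i + 1),
        (if Ramifies (n + 2) (i + 4 - (n + 2)) then zeroDegree (i + 4) (n + 2) else 0) =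
      4 * ∑ n ∈ Finset.range (i + 1), if Ramifies n (i - n) then zeroDegree i n else 0 := by
    rw [Finset.mul_sum]
    refine Finset.sum_congr rfl fun n hn => ?_
    have hni := Finset.mem_range_succ_iff.1 hn
    have hsub : i + 4 - (n + 2) = i - n + 2 := by lia
    rw [hsub, mul_ite, mul_zero, zeroDegree_add_four_add_two hni]
    simp only [ramifies_add_two_add_two]
  have hzero : Ramifies 0 (i + 4) := .inr (Nat.zero_le _)
  have hone : Ramifies 1 (i + 3) := .inr (Nat.zero_le _)
  have hpred : ¬ Ramifies (i + 3) 1 := by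
    unfold Ramifies
    grind
  have hself : Ramifies (i + 4) 0 := .inl Even.zero
  rw [ramifiedDegree, ramifiedDegree, Finset.sum_filter, Finset.sum_filter, Finset.sum_range_succ,
    Finset.sum_range_succ, Finset.sum_range_succ', Finset.sum_range_succ', hshift]
  simp [hzero, hone, hpred, hself, zeroDegree]
  ring

theorem ramifiedDegree_two_mul (a : ℕ) : ramifiedDegree (2 * a) = 2 ^ a * (a + 2 - a / 2) := by
  induction a using Nat.twoStepInduction with
  | zero => decide
  | one => decide
  | more a ih _ =>
    have hpow : (2 * a + 5) / 2 = a + 2 := by lia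
    have hsub : a + 2 + 2 - (a + 2) / 2 = a + 2 - a / 2 + 1 := by lia
    rw [mul_add 2 a 2, ramifiedDegree_add_four, ih, hpow, hsub]
    ring

theorem ramifiedDegree_two_mul_add_one (a : ℕ) :
    ramifiedDegree (2 * a + 1) = 2 ^ (a + 1) * (2 + a / 2) := by
  induction a using Nat.twoStepInduction with
  | zero => decide
  | one => decide
  | more a ih _ =>
    have hidx : 2 * (a + 2) + 1 = 2 * a + 1 + 4 := by lia
    have hpow : (2 * a + 1 + 5) / 2 = a + 3 := by lia
    have hdiv : (a + 2) / 2 = a / 2 + 1 := by lia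
    rw [hidx, ramifiedDegree_add_four, ih, hpow, hdiv]
    ring

theorem towerGenus_two_mul_add_one_eq (a : ℕ) :
    towerGenus (2 * a + 1) = 2 * towerGenus (2 * a) - 1 + 2 ^ a * (a + 2 - (a / 2 : ℕ)) := by
  rw [towerGenus, ramifiedDegree_two_mul]
  push_cast [Nat.cast_sub (show a / 2 ≤ a + 2 by lia)]
  rfl

theorem towerGenus_two_mul (a : ℕ) :
    towerGenus (2 * a) = 4 ^ (a + 1) + 1 - (a + 5) * 2 ^ a := by
  induction a with
  | zero => simp [towerGenus]
  | succ a ih =>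
    rw [mul_add_one, towerGenus, towerGenus_two_mul_add_one_eq, ih, ramifiedDegree_two_mul_add_one]
    push_cast
    ring

theorem towerGenus_two_mul_add_one (a : ℕ) :
    towerGenus (2 * a + 1) = 2 * 4 ^ (a + 1) + 1 - (a + 8 + (a / 2 : ℕ)) * 2 ^ a := by
  rw [towerGenus_two_mul_add_one_eq, towerGenus_two_mul]
  ring

theorem towerGenus_of_even {i : ℕ} (hi : Even i) :
    (towerGenus i : ℚ) = 2 ^ (i + 2) + 1 - ((i : ℚ) + 10) * (2 : ℚ) ^ ((i : ℤ) / 2 - 1) := by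
  obtain ⟨a, rfl⟩ := even_iff_exists_two_mul.1 hi
  have hexp : ((2 * a : ℕ) : ℤ) / 2 - 1 = a - 1 := by lia
  have hpow : (2 : ℚ) ^ (2 * a + 2) = 4 ^ (a + 1) := by
    rw [← mul_add_one, pow_mul]
    norm_num
  rw [towerGenus_two_mul, hexp, zpow_sub_one₀ two_ne_zero, zpow_natCast, hpow]
  push_cast
  ring

theorem towerGenus_of_odd {i : ℕ} (hi : Odd i) :
    (towerGenus i : ℚ) = 2 ^ (i + 2) + 1 -
      ((i : ℚ) + 2 * ((i / 4 : ℕ) : ℚ) + 15) * (2 : ℚ) ^ (((i : ℤ) - 3) / 2) := by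
  obtain ⟨a, rfl⟩ := hi
  have hexp : (((2 * a + 1 : ℕ) : ℤ) - 3) / 2 = a - 1 := by lia
  have hdiv : (2 * a + 1) / 4 = a / 2 := by lia
  have hpow : (2 : ℚ) ^ (2 * a + 1 + 2) = 2 * 4 ^ (a + 1) := by
    rw [add_right_comm, ← mul_add_one, pow_succ', pow_mul]
    norm_num
  rw [towerGenus_two_mul_add_one, hexp, hdiv, zpow_sub_one₀ two_ne_zero, zpow_natCast, hpow]
  generalize a / 2 = m
  push_cast
  ring

end ClosedForm

end CurveTower

end

theorem mainTheorem2_general (k : Type*) [Field k] [CharP k 2] (K : Type*) [Field K] [Algebra k K]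
    (i : ℕ) (x : Fin (i + 1) → K) (hx : CurveTower.IsTowerFunctionField k i x) :
    ∃ g : ℤ, CurveTower.IsGenus k K g ∧
      (Even i → (g : ℚ) = 2 ^ (i + 2) + 1 - ((i : ℚ) + 10) * (2 : ℚ) ^ ((i : ℤ) / 2 - 1)) ∧
      (Odd i → (g : ℚ) = 2 ^ (i + 2) + 1 -
        ((i : ℚ) + 2 * ((i / 4 : ℕ) : ℚ) + 15) * (2 : ℚ) ^ (((i : ℤ) - 3) / 2)) := by
  have hlevel := hx.isTower.towerLevel
  exact ⟨CurveTower.towerGenus i, hlevel.hasGenus.isGenus hlevel.isCurve,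
    CurveTower.towerGenus_of_even, CurveTower.towerGenus_of_odd⟩

theorem mainTheorem2 (k : Type*) [Field k] [Algebra (ZMod 2) k] [Algebra.IsAlgebraic (ZMod 2) k]
    (K : Type*) [Field K] [Algebra k K] (i : ℕ) (x : Fin (i + 1) → K)
    (hx : CurveTower.IsTowerFunctionField k i x) :
    ∃ g : ℤ, CurveTower.IsGenus k K g ∧
      (Even i → (g : ℚ) = 2 ^ (i + 2) + 1 - ((i : ℚ) + 10) * (2 : ℚ) ^ ((i : ℤ) / 2 - 1)) ∧
      (Odd i → (g : ℚ) = 2 ^ (i + 2) + 1 -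
        ((i : ℚ) + 2 * ((i / 4 : ℕ) : ℚ) + 15) * (2 : ℚ) ^ (((i : ℤ) - 3) / 2)) :=
  have : CharP k 2 := charP_of_injective_algebraMap (algebraMap (ZMod 2) k).injective 2
  mainTheorem2_general k K i x hx
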